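/- Let $\mathrm{M}$ be a loopless matroid of rank $d$ on a finite set $E$, and let $i\in E$. The Chow ring of $\mathrm{M}$ is the graded $\mathbb{Q}$-algebra $$\mathrm{CH}(\mathrm{M})=\mathbb{Q}[x_F \mid F \text{ a nonempty proper flat of } \mathrm{M}]/(I+J),$$ where $I$ is generated by the forms $\sum_{F\ni i_1}x_F-\sum_{F\ni i_2}x_F$ for distinct $i_1,i_2\in E$, and $J$ by the products $x_{F_1}x_{F_2}$ for incomparable $F_1,F_2$. There is a unique linear map $\deg:\mathrm{CH}^{d-1}(\mathrm{M})\to\mathbb{Q}$ that sends $\prod_{F\in\mathscr{F}}x_F$ to $1$ for every complete flag $\mathscr{F}$ of nonempty proper flats; the Poincaré pairing of elements $\eta_1,\eta_2$ of complementary degrees ($k$ and $d-1-k$) is $\deg(\eta_1\eta_2)$. Let $\theta_i:\mathrm{CH}(\mathrm{M}\setminus i)\to\mathrm{CH}(\mathrm{M})$ be the graded algebra homomorphism $x_F\mapsto x_F+x_{F\cup i}$, where $x_S=0$ if $S$ is not a nonempty proper flat of $\mathrm{M}$; it makes $\mathrm{CH}(\mathrm{M})$ a $\mathrm{CH}(\mathrm{M}\setminus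 i)$-module. Let $\mathrm{CH}_{(i)}$ be its image, and let $\mathscr{S}_i$ be the set of nonempty proper subsets $F$ of $E\setminus i$ such that $F$ and $F\cup i$ are both flats of $\mathrm{M}$. (1) If $i$ is not a coloop of $\mathrm{M}$, then $$\mathrm{CH}(\mathrm{M})=\mathrm{CH}_{(i)}\oplus\bigoplus_{F\in\mathscr{S}_i}x_{F\cup i}\,\mathrm{CH}_{(i)},$$ every summand is an indecomposable graded $\mathrm{CH}(\mathrm{M}\setminus i)$-module, and any two distinct summands are orthogonal for the Poincaré pairing. (2) If $i$ is a coloop of $\mathrm{M}$, then $$\mathrm{CH}(\mathrm{M})=\mathrm{CH}_{(i)}\oplus x_{E\setminus i}\,\mathrm{CH}_{(i)}\oplus\bigoplus_{F\in\mathscr{S}_i}x_{F\cup i}\,\mathrm{CH}_{(i)},$$ and every summand is an indecomposable graded $\mathrm{CH}(\mathrm{M}\setminus i)$-module, except that the second summand is zero when $E=\{i\}$. Any two distinct summands other than the pair of the first two are orthogonal for the Poincaré pairing; the first two are not orthogonal when $E\neq\{i\}$. (3) There are isomorphisms of graded $\mathrm{CH}(\mathrm{M}\setminus i)$-modules $\mathrm{CH}_{(i)}\cong\mathrm{CH}(\mathrm{M}\setminus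 i)$ and, for $F\in\mathscr{S}_i$, $x_{F\cup i}\,\mathrm{CH}_{(i)}\cong\mathrm{CH}(\mathrm{M}_{F\cup i})\otimes_{\mathbb{Q}}\mathrm{CH}(\mathrm{M}^F)[-1]$; if $i$ is a coloop and $E\ne\{i\}$, also $x_{E\setminus i}\,\mathrm{CH}_{(i)}\cong\mathrm{CH}(\mathrm{M}\setminus i)[-1]$. Here $[-1]$ raises all degrees by one, $\mathrm{M}_{F\cup i}$ is the contraction of $\mathrm{M}$ by $F\cup i$, $\mathrm{M}^F$ is the restriction of $\mathrm{M}$ to $F$, and $\mathrm{CH}(\mathrm{M}\setminus i)$ acts on the tensor product through the algebra homomorphism that sends $x_G$ to $1\otimes x_G$ if $G\subsetneq F$, to $x_{G\setminus F}\otimes 1$ if $G\supsetneq F$ (which is $0$ if $G\setminus F$ is not a flat of $\mathrm{M}_{F\cup i}$), to $0$ if $G$ and $F$ are incomparable, and $x_F$ to $-1\otimes\sum_{j\in G}x_G-\sum_{l\notin G}x_G\otimes1$ for any $j\in F$ and $l\in E\setminus(F\cup i)$, the sums being over nonempty proper flats of $\mathrm{M}^F$ and of $\mathrm{M}_{F\cup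 i}$ respectively. -/

import Mathlib

open scoped TensorProduct Matroid

namespace MatroidChow

universe u

variable {α : Type u}

/-- The nonempty proper flats of a matroid, ordered by inclusion. -/
abbrev PFlat (M : Matroid α) : Type u :=
  {F : Set α // M.IsFlat F ∧ F.Nonempty ∧ F ≠ M.E}

/-- The linear form `∑_{j ∈ F} x_F` in the polynomial ring on the nonempty proper flats
(a finite sum when the ground set is finite). -/
noncomputable def linForm (M : Matroid α) (j : α) : MvPolynomial (PFlat M) ℚ :=
  ∑ᶠ (F : PFlat M) (_ : j ∈ F.1), MvPolynomial.X F

/-- The ideal generated by the differences of the linear forms `∑_{j ∈ F} x_F`, for `j ∈ E`. -/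
noncomputable def linIdeal (M : Matroid α) : Ideal (MvPolynomial (PFlat M) ℚ) :=
  Ideal.span {p | ∃ j₁ ∈ M.E, ∃ j₂ ∈ M.E, j₁ ≠ j₂ ∧ p = linForm M j₁ - linForm M j₂}

/-- The ideal generated by the products `x_F x_G` for incomparable `F` and `G`. -/
noncomputable def monIdeal (M : Matroid α) : Ideal (MvPolynomial (PFlat M) ℚ) :=
  Ideal.span {p | ∃ F G : PFlat M, ¬ F ≤ G ∧ ¬ G ≤ F ∧
    p = MvPolynomial.X F * MvPolynomial.X G}

/-- The Chow ring of a matroid, with rational coefficients. -/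
def CH (M : Matroid α) : Type u :=
  MvPolynomial (PFlat M) ℚ ⧸ (linIdeal M + monIdeal M)

noncomputable instance instCommRingCH (M : Matroid α) : CommRing (CH M) :=
  inferInstanceAs (CommRing (MvPolynomial (PFlat M) ℚ ⧸ (linIdeal M + monIdeal M)))

noncomputable instance instAlgebraCH (M : Matroid α) : Algebra ℚ (CH M) :=
  inferInstanceAs (Algebra ℚ (MvPolynomial (PFlat M) ℚ ⧸ (linIdeal M + monIdeal M)))

/-- The quotient map from the polynomial ring to the Chow ring. -/
noncomputable def toCH (M : Matroid α) : MvPolynomial (PFlat M) ℚ →ₐ[ℚ] CH M :=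
  Ideal.Quotient.mkₐ ℚ (linIdeal M + monIdeal M)

open Classical in
/-- The class `x_S`, which is zero if `S` is not a nonempty proper flat of `M`. -/
noncomputable def x (M : Matroid α) (S : Set α) : CH M :=
  if h : M.IsFlat S ∧ S.Nonempty ∧ S ≠ M.E then toCH M (MvPolynomial.X ⟨S, h⟩) else 0

/-- The graded piece `CH^k`: classes of homogeneous polynomials of degree `k`. -/
noncomputable def gr (M : Matroid α) (k : ℕ) : Submodule ℚ (CH M) :=
  (MvPolynomial.homogeneousSubmodule (PFlat M) ℚ k).map (toCH M).toLinearMap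

/-! ### The pullback along a deletion -/

theorem x_of_pflat (M : Matroid α) (F : PFlat M) : x M F.1 = toCH M (MvPolynomial.X F) := by
  simp [x, F.2]

theorem x_of_not (M : Matroid α) {S : Set α} (h : ¬ (M.IsFlat S ∧ S.Nonempty ∧ S ≠ M.E)) :
    x M S = 0 := by
  simp only [x, dif_neg h]

theorem x_mul_x (M : Matroid α) {S T : Set α} (h₁ : ¬ S ⊆ T) (h₂ : ¬ T ⊆ S) :
    x M S * x M T = 0 := by
  by_cases hS : M.IsFlat S ∧ S.Nonempty ∧ S ≠ M.E
  swap
  · rw [x_of_not M hS, zero_mul]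
  by_cases hT : M.IsFlat T ∧ T.Nonempty ∧ T ≠ M.E
  swap
  · rw [x_of_not M hT, mul_zero]
  rw [x_of_pflat M ⟨S, hS⟩, x_of_pflat M ⟨T, hT⟩, ← map_mul]
  refine Ideal.Quotient.eq_zero_iff_mem.2 (Ideal.mem_sup_right (Ideal.subset_span ?_))
  exact ⟨⟨S, hS⟩, ⟨T, hT⟩, h₁, h₂, rfl⟩

theorem toCH_linForm (M : Matroid α) {j₁ j₂ : α} (h₁ : j₁ ∈ M.E) (h₂ : j₂ ∈ M.E) :
    toCH M (linForm M j₁) = toCH M (linForm M j₂) := by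
  by_cases h : j₁ = j₂
  · rw [h]
  rw [← sub_eq_zero, ← map_sub]
  refine Ideal.Quotient.eq_zero_iff_mem.2 (Ideal.mem_sup_left (Ideal.subset_span ?_))
  exact ⟨j₁, h₁, j₂, h₂, h, rfl⟩

theorem finite_pflat (M : Matroid α) [M.Finite] : Finite (PFlat M) :=
  Set.Finite.to_subtype
    (M.ground_finite.finite_subsets.subset fun _ hF => hF.1.subset_ground)

open Classical in
theorem map_linForm (M : Matroid α) [M.Finite] {A : Type*} [CommRing A] [Algebra ℚ A]
    (φ : MvPolynomial (PFlat M) ℚ →ₐ[ℚ] A) (f : Set α → A)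
    (hf : ∀ F : PFlat M, φ (MvPolynomial.X F) = f F.1) (j : α) (E : Finset α) (hE : ↑E = M.E)
    (h0 : ∀ S ⊆ M.E, ¬ (M.IsFlat S ∧ S.Nonempty ∧ S ≠ M.E) → j ∈ S → f S = 0) :
    φ (linForm M j) = ∑ T ∈ E.powerset, if j ∈ T then f ↑T else 0 := by
  have := finite_pflat M
  have : Fintype (PFlat M) := Fintype.ofFinite _
  have e1 : φ (linForm M j) = ∑ F : PFlat M, if j ∈ F.1 then f F.1 else 0 := by
    rw [linForm, finsum_eq_sum_of_fintype, map_sum]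
    refine Finset.sum_congr rfl fun F _ => ?_
    by_cases h : j ∈ F.1 <;> simp [h, hf]
  rw [e1]
  have hfin : ∀ F : PFlat M, F.1.Finite := fun F =>
    M.ground_finite.subset F.2.1.subset_ground
  refine Finset.sum_of_injOn (fun F => (hfin F).toFinset) ?_ ?_ ?_ ?_
  · intro F _ G _ h
    apply Subtype.ext
    simpa using h
  · intro F _
    simp only [Finset.coe_powerset, Set.mem_preimage, Set.mem_powerset_iff, Set.Finite.coe_toFinset]
    rw [hE]
    exact F.2.1.subset_ground
  · intro T hT hn
    split_ifs with hj
    swap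
    · rfl
    refine h0 T ?_ ?_ hj
    · rw [← hE]
      exact_mod_cast Finset.mem_powerset.1 hT
    · intro hF
      exact hn ⟨⟨↑T, hF⟩, by simp, by simp⟩
  · intro F _
    simp

theorem isFlat_delete (M : Matroid α) (i : α) {T G : Set α} (hG : M.IsFlat G)
    (hT : T = G \ {i}) : (M ＼ {i}).IsFlat T := by
  rw [Matroid.isFlat_iff_closure_eq, Matroid.delete_closure_eq]
  subst hT
  refine subset_antisymm (Set.sdiff_subset_sdiff_left ?_) ?_
  · conv_rhs => rw [← hG.closure]
    exact M.closure_subset_closure (Set.sdiff_subset.trans Set.sdiff_subset)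
  · intro a ha
    refine ⟨M.subset_closure _ (Set.sdiff_subset.trans (Set.sdiff_subset.trans
      hG.subset_ground)) ⟨ha, ha.2⟩, ha.2⟩

/-- The polynomial form of the pullback along the deletion: `x_F ↦ x_F + x_{F ∪ i}`. -/
noncomputable def thetaPoly (M : Matroid α) (i : α) :
    MvPolynomial (PFlat (M ＼ {i})) ℚ →ₐ[ℚ] CH M :=
  MvPolynomial.aeval fun F => x M F.1 + x M (insert i F.1)

open Classical in
theorem thetaPoly_linForm (M : Matroid α) [M.Finite] (i j : α) (hj : j ∈ (M ＼ {i}).E) :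
    thetaPoly M i (linForm (M ＼ {i}) j) = toCH M (linForm M j) - x M (M.E \ {i}) := by
  obtain ⟨E, hE⟩ := M.ground_finite.exists_finset_coe
  have hE' : ((E.erase i : Finset α) : Set α) = (M ＼ {i}).E := by
    simp [hE]
  have hji : j ≠ i := hj.2
  have hjE : j ∈ M.E := hj.1
  let f : Set α → CH M := fun S =>
    if S = M.E \ {i} then 0 else x M S + x M (insert i S)
  rw [map_linForm (M ＼ {i}) (thetaPoly M i) f ?_ j _ hE' ?_,
    map_linForm M (toCH M) (x M) (fun F => (x_of_pflat M F).symm) j E hE ?_]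
  · have hs : ∀ T ∈ (E.erase i).powerset, (if j ∈ T then f ↑T else 0) =
        (if j ∈ T then x M ↑T else 0) +
          (if j ∈ T then x M (insert i (T : Set α)) else 0) -
          (if T = E.erase i then x M (M.E \ {i}) else 0) := by
      intro T hT
      by_cases hTE : T = E.erase i
      · subst hTE
        have hjm : j ∈ E.erase i := by
          rw [← Finset.mem_coe, hE']
          exact hj
        have h0 : x M (insert i (M.E \ {i})) = 0 := by
          apply x_of_not
          rintro ⟨h1, -, h3⟩
          have hi : i ∈ M.E := h1.subset_ground (Set.mem_insert _ _)
          exact h3 (by rw [Set.insert_sdiff_singleton, Set.insert_eq_of_mem hi])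
        have hc : ((E.erase i : Finset α) : Set α) = M.E \ {i} := hE'
        simp only [if_pos hjm, if_true, hc, f, h0]
        simp
      · have hc : (T : Set α) ≠ M.E \ {i} := by
          intro h
          apply hTE
          rw [← Finset.coe_inj, h, hE']
          rfl
        simp only [f, if_neg hc, if_neg hTE, sub_zero]
        split_ifs <;> simp
    rw [Finset.sum_congr rfl hs, Finset.sum_sub_distrib, Finset.sum_add_distrib,
      Finset.sum_ite_eq' , if_pos (Finset.mem_powerset_self _)]
    congr 1
    by_cases hi : i ∈ E
    · conv_rhs => rw [← Finset.insert_erase hi,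
        Finset.sum_powerset_insert (Finset.notMem_erase i E)]
      congr 1
      refine Finset.sum_congr rfl fun T _ => ?_
      simp [hji]
    · rw [Finset.erase_eq_of_notMem hi]
      convert add_zero _
      refine Finset.sum_eq_zero fun T _ => ?_
      rw [x_of_not M (S := insert i (T : Set α)), ite_self]
      rintro ⟨h1, -, -⟩
      apply hi
      rw [← Finset.mem_coe, hE]
      exact h1.subset_ground (Set.mem_insert _ _)
  · intro S _ hS _
    exact x_of_not M hS
  · intro F
    have : F.1 ≠ M.E \ {i} := F.2.2.2
    simp [thetaPoly, f, this]
  · intro S hSE hS hjS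
    by_cases hc : S = M.E \ {i}
    · simp [f, hc]
    have hiS : i ∉ S := fun h => (hSE h).2 rfl
    have hnf : ¬ (M ＼ {i}).IsFlat S := fun h => hS ⟨h, ⟨j, hjS⟩, hc⟩
    simp only [f, if_neg hc]
    rw [x_of_not M, x_of_not M, add_zero]
    · rintro ⟨h1, -, -⟩
      exact hnf (isFlat_delete M i h1 (by simp [hiS]))
    · rintro ⟨h1, -, -⟩
      exact hnf (isFlat_delete M i h1 (by simp [hiS]))

theorem thetaPoly_eq_zero (M : Matroid α) [M.Finite] (i : α)
    (p : MvPolynomial (PFlat (M ＼ {i})) ℚ)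
    (hp : p ∈ linIdeal (M ＼ {i}) + monIdeal (M ＼ {i})) : thetaPoly M i p = 0 := by
  have h : linIdeal (M ＼ {i}) + monIdeal (M ＼ {i}) ≤ RingHom.ker (thetaPoly M i) := by
    refine sup_le (Ideal.span_le.2 ?_) (Ideal.span_le.2 ?_)
    · rintro _ ⟨j₁, h₁, j₂, h₂, -, rfl⟩
      rw [SetLike.mem_coe, RingHom.mem_ker, map_sub, thetaPoly_linForm M i j₁ h₁,
        thetaPoly_linForm M i j₂ h₂, toCH_linForm M h₁.1 h₂.1, sub_self]
    · rintro _ ⟨F, G, h₁, h₂, rfl⟩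
      have hF : i ∉ F.1 := fun h => (F.2.1.subset_ground h).2 rfl
      have hG : i ∉ G.1 := fun h => (G.2.1.subset_ground h).2 rfl
      have h₁' : ¬ F.1 ⊆ G.1 := h₁
      have h₂' : ¬ G.1 ⊆ F.1 := h₂
      have k₁ : ¬ F.1 ⊆ insert i G.1 := fun h => h₁' ((Set.subset_insert_iff_of_notMem hF).1 h)
      have k₂ : ¬ G.1 ⊆ insert i F.1 := fun h => h₂' ((Set.subset_insert_iff_of_notMem hG).1 h)
      have l₁ : ¬ insert i F.1 ⊆ G.1 := fun h => hG (h (Set.mem_insert _ _))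
      have l₂ : ¬ insert i G.1 ⊆ F.1 := fun h => hF (h (Set.mem_insert _ _))
      have m₁ : ¬ insert i F.1 ⊆ insert i G.1 := fun h => k₁ ((Set.subset_insert _ _).trans h)
      have m₂ : ¬ insert i G.1 ⊆ insert i F.1 := fun h => k₂ ((Set.subset_insert _ _).trans h)
      rw [SetLike.mem_coe, RingHom.mem_ker]
      simp only [thetaPoly, map_mul, MvPolynomial.aeval_X]
      rw [add_mul, mul_add, mul_add, x_mul_x M h₁' h₂', x_mul_x M k₁ l₂, x_mul_x M l₁ k₂,
        x_mul_x M m₁ m₂]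
      simp
  exact h hp

/-- The homomorphism `θ_i : CH(M ∖ i) → CH(M)`, `x_F ↦ x_F + x_{F ∪ i}`. -/
noncomputable def theta (M : Matroid α) [M.Finite] (i : α) : CH (M ＼ {i}) →ₐ[ℚ] CH M :=
  Ideal.Quotient.liftₐ (linIdeal (M ＼ {i}) + monIdeal (M ＼ {i})) (thetaPoly M i)
    (thetaPoly_eq_zero M i)

theorem theta_x (M : Matroid α) [M.Finite] (i : α) (F : PFlat (M ＼ {i})) :
    theta M i (x (M ＼ {i}) F.1) = x M F.1 + x M (insert i F.1) := by
  rw [x_of_pflat (M ＼ {i}) F]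
  exact MvPolynomial.aeval_X _ _

/-- `CH(M)` as an algebra, hence a module, over `CH(M ∖ i)` through `θ_i`. -/
noncomputable instance instAlgebraDelete (M : Matroid α) [M.Finite] (i : α) :
    Algebra (CH (M ＼ {i})) (CH M) :=
  (theta M i).toRingHom.toAlgebra

/-! ### The summands -/

/-- `CH_(i)`, the image of `θ_i`, as a `CH(M ∖ i)`-submodule of `CH(M)`. -/
noncomputable def imTheta (M : Matroid α) [M.Finite] (i : α) :
    Submodule (CH (M ＼ {i})) (CH M) :=
  LinearMap.range (Algebra.linearMap (CH (M ＼ {i})) (CH M))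

/-- `x_S · CH_(i)` as a `CH(M ∖ i)`-submodule of `CH(M)`. -/
noncomputable def xImTheta (M : Matroid α) [M.Finite] (i : α) (S : Set α) :
    Submodule (CH (M ＼ {i})) (CH M) :=
  (imTheta M i).map (LinearMap.mulLeft (CH (M ＼ {i})) (x M S))

/-- The nonempty proper subsets `F` of `E ∖ i` such that `F` and `F ∪ i` are both flats. -/
def Si (M : Matroid α) (i : α) : Set (Set α) :=
  {F | F.Nonempty ∧ F ⊂ M.E \ {i} ∧ M.IsFlat F ∧ M.IsFlat (insert i F)}

/-- The summands when `i` is not a coloop. -/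
noncomputable def summand (M : Matroid α) [M.Finite] (i : α) :
    Option (Si M i) → Submodule (CH (M ＼ {i})) (CH M)
  | none => imTheta M i
  | some F => xImTheta M i (insert i F.1)

/-- The summands when `i` is a coloop: `none` is the first one, `some none` the second one. -/
noncomputable def summandColoop (M : Matroid α) [M.Finite] (i : α) :
    Option (Option (Si M i)) → Submodule (CH (M ＼ {i})) (CH M)
  | none => imTheta M i
  | some none => xImTheta M i (M.E \ {i})
  | some (some F) => xImTheta M i (insert i F.1)

/-- A submodule of `CH(M)` is graded if each of its elements is a finite sum of homogeneous
elements that lie in it. -/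
def IsGradedSubmodule (M : Matroid α) [M.Finite] (i : α)
    (N : Submodule (CH (M ＼ {i})) (CH M)) : Prop :=
  ∀ a ∈ N, ∃ c : ℕ →₀ CH M, (∀ k, c k ∈ N ∧ c k ∈ gr M k) ∧ a = c.sum fun _ b => b

/-- A nonzero submodule that is not the direct sum of two nonzero submodules, graded or not. -/
def IsIndecomposable {R V : Type*} [CommRing R] [AddCommGroup V] [Module R V]
    (N : Submodule R V) : Prop :=
  N ≠ ⊥ ∧ ∀ A B : Submodule R V, Disjoint A B → A ⊔ B = N → A = ⊥ ∨ B = ⊥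

open Classical in
/-- `V` is the internal direct sum of the submodules `N s`. -/
def IsDirectSum {R V ι : Type*} [CommRing R] [AddCommGroup V] [Module R V]
    (N : ι → Submodule R V) : Prop :=
  DirectSum.IsInternal N

/-! ### The Poincaré pairing -/

/-- `deg` is the degree map `CH^{d-1}(M) → ℚ`, extended by zero to the other degrees:
it sends the monomial of every complete flag of nonempty proper flats to `1`. -/
structure IsDegreeMap (M : Matroid α) (deg : CH M →ₗ[ℚ] ℚ) : Prop where
  eq_zero : ∀ k : ℕ, (k : ℕ∞) + 1 ≠ M.eRank → ∀ a ∈ gr M k, deg a = 0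
  flag : ∀ C : Finset (PFlat M), IsMaxChain (· ≤ ·) (C : Set (PFlat M)) →
    deg (∏ F ∈ C, x M F.1) = 1

/-- Orthogonality of two submodules for the pairing `(a, b) ↦ deg (a b)`. -/
def IsOrtho (M : Matroid α) [M.Finite] (i : α) (deg : CH M →ₗ[ℚ] ℚ)
    (N₁ N₂ : Submodule (CH (M ＼ {i})) (CH M)) : Prop :=
  ∀ a ∈ N₁, ∀ b ∈ N₂, deg (a * b) = 0

/-! ### The identification of the summands -/

/-- The graded piece of degree `k` of `CH(M) ⊗ CH(N)`. -/
noncomputable def grTensor (M N : Matroid α) (k : ℕ) : Submodule ℚ (CH M ⊗[ℚ] CH N) :=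
  ⨆ p ∈ Finset.HasAntidiagonal.antidiagonal k,
    Submodule.map₂ (TensorProduct.mk ℚ (CH M) (CH N)) (gr M p.1) (gr N p.2)

/-- `∑_{j ∈ G} x_G`, which is the class `α` of `M` for every `j ∈ E`. -/
noncomputable def alphaAt (M : Matroid α) (j : α) : CH M :=
  ∑ᶠ (G : PFlat M) (_ : j ∈ G.1), x M G.1

/-- `∑_{j ∉ G} x_G`, which is the class `β` of `M` for every `j ∈ E`. -/
noncomputable def betaAt (M : Matroid α) (j : α) : CH M :=
  ∑ᶠ (G : PFlat M) (_ : j ∉ G.1), x M G.1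

/-- `ρ` is the restriction homomorphism `CH(M ∖ i) → CH(M_{F ∪ i}) ⊗ CH(M^F)` through which
the tensor product is a `CH(M ∖ i)`-module, given by its values on all generators `x_G`. Here
`M_{F ∪ i}` is the contraction of `F ∪ i` and `M^F` is the localization at `F`. -/
structure IsRestriction (M : Matroid α) (i : α) (F : Set α)
    (ρ : CH (M ＼ {i}) →ₐ[ℚ] CH (M ／ (insert i F)) ⊗[ℚ] CH (M ↾ F)) : Prop where
  incomparable : ∀ G : PFlat (M ＼ {i}), ¬ G.1 ⊆ F → ¬ F ⊆ G.1 → ρ (x (M ＼ {i}) G.1) = 0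
  below : ∀ G : PFlat (M ＼ {i}), G.1 ⊂ F →
    ρ (x (M ＼ {i}) G.1) = 1 ⊗ₜ[ℚ] x (M ↾ F) G.1
  above : ∀ G : PFlat (M ＼ {i}), F ⊂ G.1 →
    ρ (x (M ＼ {i}) G.1) = x (M ／ (insert i F)) (G.1 \ F) ⊗ₜ[ℚ] 1
  self : ∀ j ∈ F, ∀ l ∈ M.E \ insert i F,
    ρ (x (M ＼ {i}) F) =
      - (1 ⊗ₜ[ℚ] alphaAt (M ↾ F) j) - betaAt (M ／ (insert i F)) l ⊗ₜ[ℚ] 1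

/-- An isomorphism of graded `CH(M ∖ i)`-modules `CH(M ∖ i)[-s] ≅ N`. -/
def IsoDelete (M : Matroid α) [M.Finite] (i : α) (s : ℕ)
    (N : Submodule (CH (M ＼ {i})) (CH M)) : Prop :=
  ∃ e : CH (M ＼ {i}) ≃ₗ[CH (M ＼ {i})] N,
    ∀ (k : ℕ) (a : CH (M ＼ {i})), a ∈ gr (M ＼ {i}) k ↔ (e a : CH M) ∈ gr M (k + s)

/-- An isomorphism of graded `CH(M ∖ i)`-modules
`CH(M_{F ∪ i}) ⊗ CH(M^F)[-1] ≅ x_{F ∪ i} · CH_(i)`. -/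
def IsoTensor (M : Matroid α) [M.Finite] (i : α) (F : Set α) : Prop :=
  ∃ ρ : CH (M ＼ {i}) →ₐ[ℚ] CH (M ／ (insert i F)) ⊗[ℚ] CH (M ↾ F),
    IsRestriction M i F ρ ∧
    ∃ e : (CH (M ／ (insert i F)) ⊗[ℚ] CH (M ↾ F)) ≃+ xImTheta M i (insert i F),
      (∀ a t, e (ρ a * t) = a • e t) ∧
      ∀ k t, t ∈ grTensor (M ／ (insert i F)) (M ↾ F) k ↔ (e t : CH M) ∈ gr M (k + 1)

end MatroidChow

/-!
The proof is by induction on `|E|`, together with Poincaré duality for `CH(M)`.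

The degree map pairs the classes of flags with the Minkowski weight that is `1` on all complete
flags; capping with a divisor `x_F` acts on Minkowski weights, so it defines a functional on
`CH(M)`.

The ring `CH(M)` is generated over `CH_(i)` by the `x_{F ∪ i}`, `F ∈ 𝒮_i`, and `x_{E ∖ i}`, and the
products of these generators lie in the sum of the proposed summands; hence the summands span. For
`F ∈ 𝒮_i` the summand `x_{F ∪ i} CH_(i)` is killed by the degree map for lack of degree: it is a
quotient of a ring of socle degree `d - 3`, shifted by one. Together with
`x_{F ∪ i} x_{G ∪ i} = x_{F ∪ i} θ_i(x_G)` for `F ⊂ G` this makes the summands orthogonal.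

The ring `CH(M_{F ∪ i}) ⊗ CH(M^F)` maps to `CH(M) / Ann(x_{F ∪ i}) ≅ x_{F ∪ i} CH(M)`, which
realizes it as the summand of `F`. The map is injective since the pairing on the tensor product,
nondegenerate by induction, is computed by `deg(x_F x_{F ∪ i} ·)`. On the remaining summands the
pairing of `M` restricts to the one of `M ∖ i`. So the pairing is nondegenerate on the
sum of the summands, which makes the sum direct and proves duality for `M`. Each summand is a
nonzero cyclic module over the local ring `CH(M ∖ i)`, hence indecomposable.
-/

namespace MatroidChow

universe u

variable {α : Type u}

/-! ### Flats, ranks and flags -/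

/-- The sets that index the generators of the Chow ring, as a predicate. -/
abbrev IsProperFlat (M : Matroid α) (S : Set α) : Prop := M.IsFlat S ∧ S.Nonempty ∧ S ≠ M.E

/-- The rank of a set, as a natural number (`0` if it is infinite). -/
noncomputable def rk (M : Matroid α) (S : Set α) : ℕ := (M.eRk S).toNat

/-- The socle degree `d - 1` of the Chow ring; truncation makes it `0` for the empty matroid. -/
noncomputable def topDeg (M : Matroid α) : ℕ := rk M M.E - 1

/-- A flag of nonempty proper flats, not necessarily complete. -/
structure IsFlag (M : Matroid α) (s : Finset (Set α)) : Prop where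
  isProperFlat : ∀ S ∈ s, IsProperFlat M S
  isChain : IsChain (· ⊆ ·) (s : Set (Set α))

/-- `A` and `B` are consecutive members of the chain obtained from `s` by adding `∅` and the
ground set. -/
structure IsGap (M : Matroid α) (s : Finset (Set α)) (A B : Set α) : Prop where
  lower : A = ∅ ∨ A ∈ s
  upper : B = M.E ∨ B ∈ s
  ssubset : A ⊂ B
  subset_or_subset : ∀ S ∈ s, S ⊆ A ∨ B ⊆ S

section Rank

theorem isFlat_empty (M : Matroid α) [M.Loopless] : M.IsFlat ∅ := by
  rw [Matroid.isFlat_iff_closure_eq, Matroid.closure_empty, Matroid.loops_eq_empty]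

theorem rk_empty (M : Matroid α) : rk M ∅ = 0 := by simp [rk]

variable (M : Matroid α) [M.RankFinite]

theorem coe_rk (S : Set α) : (rk M S : ℕ∞) = M.eRk S :=
  ENat.natCast_toNat (Matroid.eRk_ne_top_iff.2 (Matroid.RankFinite.isRkFinite S))

theorem rk_mono {S T : Set α} (h : S ⊆ T) : rk M S ≤ rk M T := by
  have := M.eRk_mono h
  rw [← coe_rk, ← coe_rk] at this
  exact_mod_cast this

theorem rk_insert {S : Set α} {e : α} (he : e ∈ M.E) (h : e ∉ M.closure S) :
    rk M (insert e S) = rk M S + 1 := by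
  have := Matroid.eRk_insert_eq_add_one (M := M) ⟨he, h⟩
  rw [← coe_rk, ← coe_rk] at this
  exact_mod_cast this

variable {M}

theorem rk_lt_of_ssubset {S T : Set α} (hS : M.IsFlat S) (hT : T ⊆ M.E) (h : S ⊂ T) :
    rk M S < rk M T := by
  obtain ⟨e, heT, heS⟩ := Set.exists_of_ssubset h
  have hrank := rk_insert M (hT heT) (by rwa [hS.closure] : e ∉ M.closure S)
  have hle := rk_mono M (Set.insert_subset heT h.subset)
  omega

theorem eq_of_subset_of_rk_le {S T : Set α} (hS : M.IsFlat S) (hT : T ⊆ M.E) (h : S ⊆ T)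
    (hr : rk M T ≤ rk M S) : S = T := by
  by_contra hne
  exact (rk_lt_of_ssubset hS hT (h.ssubset_of_ne hne)).not_ge hr

theorem rk_pos [M.Loopless] {S : Set α} (hS : S ⊆ M.E) (h : S.Nonempty) : 0 < rk M S :=
  (Nat.zero_le _).trans_lt
    (rk_lt_of_ssubset (isFlat_empty M) hS (Set.empty_ssubset.2 h))

theorem IsProperFlat.rk_mem_Ico [M.Loopless] {S : Set α} (h : IsProperFlat M S) :
    rk M S ∈ Finset.Ico 1 (rk M M.E) :=
  Finset.mem_Ico.2 ⟨rk_pos h.1.subset_ground h.2.1,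
    rk_lt_of_ssubset h.1 subset_rfl (h.1.subset_ground.ssubset_of_ne h.2.2)⟩

theorem exists_least_isFlat_insert {A : Set α} (hA : M.IsFlat A) {e : α} (heE : e ∈ M.E)
    (heA : e ∉ A) :
    ∃ H, M.IsFlat H ∧ A ⊂ H ∧ e ∈ H ∧ rk M H = rk M A + 1 ∧
      ∀ K, M.IsFlat K → A ⊆ K → e ∈ K → H ⊆ K := by
  have hsub : insert e A ⊆ M.closure (insert e A) :=
    M.subset_closure _ (Set.insert_subset heE hA.subset_ground)
  refine ⟨M.closure (insert e A), M.isFlat_closure _, (Set.ssubset_insert heA).trans_subset hsub,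
    hsub (Set.mem_insert e A), ?_, fun K hK hAK heK => ?_⟩
  · rw [← rk_insert M heE (by rwa [hA.closure]), rk, rk, Matroid.eRk_closure_eq]
  · exact (M.closure_subset_closure (Set.insert_subset heK hAK)).trans_eq hK.closure

theorem existsUnique_isFlat_between {A B : Set α} (hA : M.IsFlat A) (hB : M.IsFlat B)
    (hr : rk M B = rk M A + 2) (hAB : A ⊆ B) {e : α} (heB : e ∈ B) (heA : e ∉ A) :
    ∃! H, M.IsFlat H ∧ A ⊂ H ∧ H ⊂ B ∧ e ∈ H := by
  obtain ⟨H, hH, hAH, heH, hrH, hmin⟩ :=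
    exists_least_isFlat_insert hA (hB.subset_ground heB) heA
  have hHB : H ⊂ B := (hmin B hB hAB heB).ssubset_of_ne (by rintro rfl; omega)
  refine ⟨H, ⟨hH, hAH, hHB, heH⟩, fun K ⟨hK, hAK, hKB, heK⟩ => ?_⟩
  have hrK := rk_lt_of_ssubset hK hB.subset_ground hKB
  exact (eq_of_subset_of_rk_le hH hK.subset_ground (hmin K hK hAK.subset heK) (by omega)).symm

end Rank

section Flags

variable {M : Matroid α} {s t : Finset (Set α)} {A B G H S T : Set α}

theorem isFlag_empty (M : Matroid α) : IsFlag M ∅ := ⟨by simp, by simp⟩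

theorem IsFlag.mono (h : IsFlag M t) (hst : s ⊆ t) : IsFlag M s :=
  ⟨fun S hS => h.isProperFlat S (hst hS), h.isChain.mono (Finset.coe_subset.2 hst)⟩

theorem IsFlag.subset_or_subset (h : IsFlag M s) (hS : S ∈ s) (hT : T ∈ s) : S ⊆ T ∨ T ⊆ S :=
  h.isChain.total hS hT

open Classical in
theorem isFlag_insert_iff :
    IsFlag M (insert H s) ↔ IsProperFlat M H ∧ IsFlag M s ∧ ∀ S ∈ s, S ⊆ H ∨ H ⊆ S := by
  constructor
  · intro h
    exact ⟨h.isProperFlat H (Finset.mem_insert_self _ _), h.mono (Finset.subset_insert _ _),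
      fun S hS => h.subset_or_subset (Finset.mem_insert_of_mem hS) (Finset.mem_insert_self _ _)⟩
  · rintro ⟨hH, hs, hsH⟩
    refine ⟨(Finset.forall_mem_insert _ _ _).2 ⟨hH, hs.isProperFlat⟩, ?_⟩
    rw [Finset.coe_insert]
    exact hs.isChain.insert fun S hS _ => (hsH S hS).symm

theorem IsFlag.exists_isGap (h : IsFlag M s) (P : Set α → Prop)
    (hP : ∀ S T, S ⊆ T → P T → P S) (h0 : P ∅) (hE : ¬ P M.E) :
    ∃ A B, IsGap M s A B ∧ P A ∧ ¬ P B := by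
  classical
  let s' := insert ∅ (insert M.E s)
  have hs' : IsChain (· ⊆ ·) (s' : Set (Set α)) := by
    simp only [s', Finset.coe_insert]
    refine (h.isChain.insert fun S hS _ => Or.inr ?_).insert fun S _ _ => Or.inl S.empty_subset
    exact (h.isProperFlat S hS).1.subset_ground
  obtain ⟨A, hA, hAmax⟩ := (s'.filter P).exists_maximal ⟨∅, by simp [s', h0]⟩
  obtain ⟨B, hB, hBmin⟩ := (s'.filter (¬ P ·)).exists_minimal ⟨M.E, by simp [s', hE]⟩
  rw [Finset.mem_filter] at hA hB
  have hAB : A ⊆ B := (hs'.total hA.1 hB.1).resolve_right fun hBA => hB.2 (hP B A hBA hA.2)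
  have hmem : ∀ S, S ∈ s' ↔ S = ∅ ∨ S = M.E ∨ S ∈ s := by simp [s']
  refine ⟨A, B, ⟨?_, ?_, hAB.ssubset_of_ne ?_, fun S hS => ?_⟩, hA.2, hB.2⟩
  · exact ((hmem A).1 hA.1).imp_right fun h => h.resolve_left (by rintro rfl; exact hE hA.2)
  · exact ((hmem B).1 hB.1).resolve_left (by rintro rfl; exact hB.2 h0)
  · rintro rfl
    exact hB.2 hA.2
  · have hSs' : S ∈ s' := (hmem S).2 (Or.inr (Or.inr hS))
    by_cases hPS : P S
    · exact Or.inl ((hs'.total hSs' hA.1).elim id (hAmax (by simp [hSs', hPS])))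
    · exact Or.inr ((hs'.total hB.1 hSs').elim id (hBmin (by simp [hSs', hPS])))

theorem IsFlag.exists_isGap_below (h : IsFlag M s) (hG : G ∈ s) : ∃ A, IsGap M s A G := by
  have hGf := h.isProperFlat G hG
  obtain ⟨A, B, hAB, hAG, hBG⟩ := h.exists_isGap (· ⊂ G) (fun _ _ => LE.le.trans_ssubset)
    (Set.empty_ssubset.2 hGf.2.1) fun hE => hE.not_subset hGf.1.subset_ground
  have hBG' : B ⊆ G := (hAB.subset_or_subset G hG).resolve_left hAG.not_subset
  obtain rfl : B = G := not_not.1 fun hne => hBG (hBG'.ssubset_of_ne hne)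
  exact ⟨A, hAB⟩

theorem IsFlag.exists_isGap_above (h : IsFlag M s) (hG : G ∈ s) : ∃ B, IsGap M s G B := by
  have hGf := h.isProperFlat G hG
  obtain ⟨A, B, hAB, hAG, hBG⟩ := h.exists_isGap (· ⊆ G) (fun _ _ => subset_trans)
    G.empty_subset fun hE => hGf.2.2 (hGf.1.subset_ground.antisymm hE)
  obtain rfl : A = G := hAG.antisymm ((hAB.subset_or_subset G hG).resolve_right hBG)
  exact ⟨B, hAB⟩

theorem IsGap.isFlat_upper (h : IsFlag M s) (hg : IsGap M s A B) : M.IsFlat B := by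
  rcases hg.upper with rfl | hB
  · exact M.ground_isFlat
  · exact (h.isProperFlat B hB).1

theorem IsGap.isFlat_lower [M.Loopless] (h : IsFlag M s) (hg : IsGap M s A B) : M.IsFlat A := by
  rcases hg.lower with rfl | hA
  · exact isFlat_empty M
  · exact (h.isProperFlat A hA).1

theorem IsFlag.exists_separating (h : IsFlag M s) (hG : G ∈ s) :
    ∃ j ∈ G, ∃ l ∈ M.E, l ∉ G ∧ ∀ H ∈ s, j ∈ H → l ∉ H → H = G := by
  obtain ⟨A, hAG⟩ := h.exists_isGap_below hG
  obtain ⟨B, hGB⟩ := h.exists_isGap_above hG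
  obtain ⟨j, hjG, hjA⟩ := Set.exists_of_ssubset hAG.ssubset
  obtain ⟨l, hlB, hlG⟩ := Set.exists_of_ssubset hGB.ssubset
  refine ⟨j, hjG, l, (hGB.isFlat_upper h).subset_ground hlB, hlG, fun H hH hjH hlH => ?_⟩
  have hGH : G ⊆ H := (hAG.subset_or_subset H hH).resolve_left fun hHA => hjA (hHA hjH)
  have hHG : H ⊆ G := (hGB.subset_or_subset H hH).resolve_right fun hBH => hlH (hBH hlB)
  exact hHG.antisymm hGH

open Classical in
theorem IsGap.isFlag_insert (h : IsFlag M s) (hg : IsGap M s A B) (hH : M.IsFlat H) (hAH : A ⊂ H)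
    (hHB : H ⊂ B) : H ∉ s ∧ IsFlag M (insert H s) := by
  refine ⟨fun hHs => ?_, isFlag_insert_iff.2 ⟨⟨hH, ?_, ?_⟩, h, fun S hS => ?_⟩⟩
  · exact (hg.subset_or_subset H hHs).elim hAH.not_subset hHB.not_subset
  · exact Set.nonempty_iff_ne_empty.2 (by rintro rfl; exact hAH.not_subset A.empty_subset)
  · rintro rfl
    exact hHB.not_subset (hg.isFlat_upper h).subset_ground
  · exact (hg.subset_or_subset S hS).imp (·.trans hAH.subset) hHB.subset.trans

section RankFinite

variable [M.RankFinite]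

theorem IsFlag.rk_injOn (h : IsFlag M s) : Set.InjOn (rk M) s := by
  intro S hS T hT hr
  rcases h.subset_or_subset hS hT with hST | hTS
  · exact eq_of_subset_of_rk_le (h.isProperFlat S hS).1 (h.isProperFlat T hT).1.subset_ground hST
      hr.ge
  · exact (eq_of_subset_of_rk_le (h.isProperFlat T hT).1 (h.isProperFlat S hS).1.subset_ground hTS
      hr.le).symm

theorem IsFlag.exists_isGap_of_card_lt (h : IsFlag M s) (hs : s.card < topDeg M) :
    ∃ A B, IsGap M s A B ∧ rk M A + 1 < rk M B := by
  classical
  obtain ⟨k, hk, hks⟩ := Finset.exists_mem_notMem_of_card_lt_card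
    (s := s.image (rk M)) (t := Finset.Ico 1 (rk M M.E))
    (by simpa [topDeg] using Finset.card_image_le.trans_lt hs)
  rw [Finset.mem_Ico] at hk
  obtain ⟨A, B, hAB, hA, hB⟩ := h.exists_isGap (rk M · < k)
    (fun S T hST => (rk_mono M hST).trans_lt) (by rw [rk_empty]; omega) (by omega)
  have hBk : rk M B ≠ k := by
    rcases hAB.upper with rfl | hBs
    · omega
    · exact fun h => hks (Finset.mem_image.2 ⟨B, hBs, h⟩)
  exact ⟨A, B, hAB, by omega⟩

variable [M.Loopless]

theorem IsFlag.card_le_topDeg (h : IsFlag M s) : s.card ≤ topDeg M := by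
  have := Finset.card_le_card_of_injOn (rk M) (fun S hS => (h.isProperFlat S hS).rk_mem_Ico)
    h.rk_injOn
  simpa only [topDeg, Nat.card_Ico] using this

open Classical in
theorem IsGap.exists_insert (h : IsFlag M s) (hg : IsGap M s A B) (hr : rk M A + 1 < rk M B) :
    ∃ H, A ⊂ H ∧ H ⊂ B ∧ rk M H = rk M A + 1 ∧ H ∉ s ∧ IsFlag M (insert H s) := by
  obtain ⟨e, heB, heA⟩ := Set.exists_of_ssubset hg.ssubset
  have hB := hg.isFlat_upper h
  obtain ⟨H, hH, hAH, -, hrH, hmin⟩ :=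
    exists_least_isFlat_insert (hg.isFlat_lower h) (hB.subset_ground heB) heA
  have hHB : H ⊂ B := (hmin B hB hg.ssubset.subset heB).ssubset_of_ne (by rintro rfl; omega)
  exact ⟨H, hAH, hHB, hrH, hg.isFlag_insert h hH hAH hHB⟩

theorem IsGap.card_lt_topDeg (h : IsFlag M s) (hg : IsGap M s A B) (hr : rk M A + 1 < rk M B) :
    s.card < topDeg M := by
  classical
  obtain ⟨H, -, -, -, hHs, hf⟩ := hg.exists_insert h hr
  have := hf.card_le_topDeg
  rwa [Finset.card_insert_of_notMem hHs] at this

open Classical in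
theorem IsFlag.exists_insert (h : IsFlag M s) (hs : s.card < topDeg M) :
    ∃ H, H ∉ s ∧ IsFlag M (insert H s) := by
  obtain ⟨A, B, hAB, hr⟩ := h.exists_isGap_of_card_lt hs
  obtain ⟨H, -, -, -, hH⟩ := hAB.exists_insert h hr
  exact ⟨H, hH⟩

theorem IsFlag.exists_complete (h : IsFlag M s) :
    ∃ t, s ⊆ t ∧ IsFlag M t ∧ t.card = topDeg M := by
  classical
  induction hn : topDeg M - s.card generalizing s with
  | zero => exact ⟨s, subset_rfl, h, h.card_le_topDeg.antisymm (Nat.sub_eq_zero_iff_le.1 hn)⟩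
  | succ n ih =>
    obtain ⟨H, hH, hf⟩ := h.exists_insert (by omega)
    obtain ⟨t, hst, ht⟩ := ih hf (by rw [Finset.card_insert_of_notMem hH]; omega)
    exact ⟨t, (Finset.subset_insert _ _).trans hst, ht⟩

theorem IsFlag.exists_isGap_of_card_add_one (h : IsFlag M s) (hs : s.card + 1 = topDeg M) :
    ∃ A B, IsGap M s A B ∧ rk M B = rk M A + 2 := by
  classical
  obtain ⟨A, B, hAB, hr⟩ := h.exists_isGap_of_card_lt (by omega)
  refine ⟨A, B, hAB, le_antisymm (not_lt.1 fun hlt => ?_) hr⟩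
  obtain ⟨H, hAH, hHB, hrH, hHs, hf⟩ := hAB.exists_insert h hr
  have hHB' : IsGap M (insert H s) H B := by
    refine ⟨Or.inr (Finset.mem_insert_self _ _), hAB.upper.imp_right Finset.mem_insert_of_mem, hHB,
      (Finset.forall_mem_insert _ _ _).2 ⟨Or.inl subset_rfl, fun S hS => ?_⟩⟩
    exact (hAB.subset_or_subset S hS).imp_left (·.trans hAH.subset)
  have := hHB'.card_lt_topDeg hf (by omega)
  rw [Finset.card_insert_of_notMem hHs] at this
  omega

open Classical in
theorem IsGap.ssubset_of_isFlag_insert (hg : IsGap M s A B) (hs : s.card + 1 = topDeg M)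
    (hr : rk M A + 1 < rk M B) (hHs : H ∉ s) (hf : IsFlag M (insert H s)) : A ⊂ H ∧ H ⊂ B := by
  obtain ⟨hH, -, hsH⟩ := isFlag_insert_iff.1 hf
  have hout : ¬ (H ⊆ A ∨ B ⊆ H) := fun hout => by
    have hg' : IsGap M (insert H s) A B :=
      ⟨hg.lower.imp_right Finset.mem_insert_of_mem, hg.upper.imp_right Finset.mem_insert_of_mem,
        hg.ssubset, (Finset.forall_mem_insert _ _ _).2 ⟨hout, hg.subset_or_subset⟩⟩
    have := hg'.card_lt_topDeg hf hr
    rw [Finset.card_insert_of_notMem hHs] at this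
    omega
  rw [not_or] at hout
  refine ⟨ssubset_of_subset_not_subset ?_ hout.1, ssubset_of_subset_not_subset ?_ hout.2⟩
  · rcases hg.lower with rfl | hA
    · exact H.empty_subset
    · exact (hsH A hA).resolve_right hout.1
  · rcases hg.upper with rfl | hB
    · exact hH.1.subset_ground
    · exact (hsH B hB).resolve_left hout.2

end RankFinite

open Classical in
theorem isFlag_image_val {C : Finset (PFlat M)} (hC : IsChain (· ≤ ·) (C : Set (PFlat M))) :
    IsFlag M (C.image Subtype.val) := by
  refine ⟨fun S hS => ?_, ?_⟩
  · obtain ⟨F, -, rfl⟩ := Finset.mem_image.1 hS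
    exact F.2
  · rw [Finset.coe_image]
    exact hC.image_of_map_rel _ _ Subtype.val fun _ _ h => h

open Classical in
theorem isMaxChain_iff [M.Finite] [M.Loopless] (C : Finset (PFlat M)) :
    IsMaxChain (· ≤ ·) (C : Set (PFlat M)) ↔
      IsFlag M (C.image Subtype.val) ∧ (C.image Subtype.val).card = topDeg M := by
  have := finite_pflat M
  constructor
  · intro h
    have hC := isFlag_image_val h.1
    refine ⟨hC, hC.card_le_topDeg.eq_of_not_lt fun hlt => ?_⟩
    obtain ⟨H, hHC, hf⟩ := hC.exists_insert hlt
    obtain ⟨hH, -, hCH⟩ := isFlag_insert_iff.1 hf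
    have hins : IsChain (· ≤ ·) (insert (⟨H, hH⟩ : PFlat M) (C : Set (PFlat M))) :=
      h.1.insert fun G hG _ => (hCH G.1 (Finset.mem_image_of_mem _ hG)).symm
    have hmem : (⟨H, hH⟩ : PFlat M) ∈ (C : Set (PFlat M)) :=
      h.2 hins (Set.subset_insert _ _) ▸ Set.mem_insert _ _
    exact hHC (Finset.mem_image_of_mem Subtype.val hmem)
  · rintro ⟨h, hc⟩
    refine ⟨fun F hF G hG _ => h.subset_or_subset (Finset.mem_image_of_mem _ hF)
      (Finset.mem_image_of_mem _ hG), fun t ht hCt => ?_⟩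
    obtain ⟨t, rfl⟩ := t.toFinite.exists_finset_coe
    have hle := (isFlag_image_val ht).card_le_topDeg
    rw [Finset.card_image_of_injective _ Subtype.val_injective] at hle hc
    exact congrArg _ (Finset.eq_of_subset_of_card_le (Finset.coe_subset.1 hCt) (by omega))

end Flags

/-! ### Presentation and grading of the Chow ring -/

section Generators

variable (M : Matroid α)

theorem toCH_surjective : Function.Surjective (toCH M) :=
  Ideal.Quotient.mkₐ_surjective ℚ _

theorem adjoin_x : Algebra.adjoin ℚ (Set.range (x M)) = ⊤ := by
  rw [eq_top_iff]
  rintro a -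
  obtain ⟨p, rfl⟩ := toCH_surjective M a
  induction p using MvPolynomial.induction_on with
  | C c =>
    rw [← MvPolynomial.algebraMap_eq, AlgHom.commutes]
    exact Subalgebra.algebraMap_mem _ c
  | add p q hp hq =>
    rw [map_add]
    exact add_mem hp hq
  | mul_X p F hp =>
    rw [map_mul, ← x_of_pflat]
    exact mul_mem hp (Algebra.subset_adjoin ⟨F.1, rfl⟩)

theorem gr_pow (k : ℕ) : gr M k = gr M 1 ^ k := by
  rw [gr, gr, ← MvPolynomial.homogeneousSubmodule_one_pow]
  exact Submodule.map_pow _ (toCH M) k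

theorem one_mem_gr : (1 : CH M) ∈ gr M 0 := by
  rw [gr_pow, pow_zero]
  exact Submodule.one_le.1 le_rfl

variable {M} in
theorem mul_mem_gr {k l : ℕ} {a b : CH M} (ha : a ∈ gr M k) (hb : b ∈ gr M l) :
    a * b ∈ gr M (k + l) := by
  rw [gr_pow] at *
  rw [pow_add]
  exact Submodule.mul_mem_mul ha hb

theorem gr_one_eq : gr M 1 = Submodule.span ℚ (Set.range (x M)) := by
  rw [gr, MvPolynomial.homogeneousSubmodule_one_eq_span_X, Submodule.map_span]
  refine le_antisymm (Submodule.span_mono ?_) (Submodule.span_le.2 ?_)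
  · rintro _ ⟨_, ⟨F, rfl⟩, rfl⟩
    exact ⟨F.1, x_of_pflat M F⟩
  · rintro _ ⟨S, rfl⟩
    by_cases hS : IsProperFlat M S
    · exact Submodule.subset_span ⟨_, ⟨⟨S, hS⟩, rfl⟩, (x_of_pflat M ⟨S, hS⟩).symm⟩
    · rw [x_of_not M hS]
      exact zero_mem _

theorem x_mem_gr (S : Set α) : x M S ∈ gr M 1 := by
  rw [gr_one_eq]
  exact Submodule.subset_span ⟨S, rfl⟩

variable {M} in
theorem map_mem_of_mem_gr {A : Type*} [CommRing A] [Algebra ℚ A] (φ : CH M →ₐ[ℚ] A)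
    (𝒢 : ℕ → Submodule ℚ A) (h1 : 1 ∈ 𝒢 0)
    (hmul : ∀ k a b, a ∈ 𝒢 1 → b ∈ 𝒢 k → a * b ∈ 𝒢 (k + 1))
    (hx : ∀ F : PFlat M, φ (x M F.1) ∈ 𝒢 1) {k : ℕ} {a : CH M} (ha : a ∈ gr M k) :
    φ a ∈ 𝒢 k := by
  have hone : gr M 1 ≤ (𝒢 1).comap φ.toLinearMap := by
    rw [gr_one_eq, Submodule.span_le]
    rintro _ ⟨S, rfl⟩
    by_cases hS : IsProperFlat M S
    · exact hx ⟨S, hS⟩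
    · rw [x_of_not M hS]
      exact zero_mem _
  induction k generalizing a with
  | zero =>
    rw [gr_pow, pow_zero, Submodule.mem_one] at ha
    obtain ⟨c, rfl⟩ := ha
    rw [AlgHom.commutes, Algebra.algebraMap_eq_smul_one]
    exact Submodule.smul_mem _ _ h1
  | succ k ih =>
    rw [gr_pow, pow_succ', ← gr_pow] at ha
    induction ha using Submodule.mul_induction_on' with
    | mem_mul_mem a ha b hb =>
      rw [map_mul]
      exact hmul k _ _ (hone ha) (ih hb)
    | add a _ b _ ha hb =>
      rw [map_add]
      exact add_mem ha hb

variable {M} in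
theorem exists_components (a : CH M) :
    ∃ c : ℕ →₀ CH M, (∀ k, c k ∈ gr M k) ∧ a = c.sum fun _ b => b := by
  have h : a ∈ ⨆ k, gr M k := by
    obtain ⟨p, rfl⟩ := toCH_surjective M a
    rw [← MvPolynomial.sum_homogeneousComponent p, map_sum]
    refine sum_mem fun k _ => Submodule.mem_iSup_of_mem k ?_
    exact ⟨_, MvPolynomial.homogeneousComponent_mem k p, rfl⟩
  obtain ⟨c, hc, h⟩ := (Submodule.mem_iSup_iff_exists_finsupp _ _).1 h
  exact ⟨c, hc, h.symm⟩

/-- The monomial `∏_{S ∈ s} x_S`. -/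
noncomputable def xs (s : Finset (Set α)) : CH M := ∏ S ∈ s, x M S

variable {M} {s : Finset (Set α)} {S T : Set α}

theorem xs_mul_x_eq_zero (hT : T ∈ s) (h₁ : ¬ S ⊆ T) (h₂ : ¬ T ⊆ S) : xs M s * x M S = 0 := by
  classical
  rw [xs, ← Finset.mul_prod_erase s _ hT, mul_right_comm, x_mul_x M h₂ h₁, zero_mul]

open Classical in
theorem xs_insert (hS : S ∉ s) : xs M (insert S s) = xs M s * x M S := by
  rw [xs, xs, Finset.prod_insert hS, mul_comm]

open Classical in
theorem IsFlag.xs_mul_x_of_not_isFlag_insert (hs : IsFlag M s) (h : ¬ IsFlag M (insert S s)) :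
    xs M s * x M S = 0 := by
  by_cases hS : IsProperFlat M S
  · have hcomp : ¬ ∀ T ∈ s, T ⊆ S ∨ S ⊆ T := fun hcomp => h (isFlag_insert_iff.2 ⟨hS, hs, hcomp⟩)
    push Not at hcomp
    obtain ⟨T, hT, hTS, hST⟩ := hcomp
    exact xs_mul_x_eq_zero hT hST hTS
  · rw [x_of_not M hS, mul_zero]

theorem xs_mem_gr (s : Finset (Set α)) : xs M s ∈ gr M s.card := by
  classical
  induction s using Finset.induction_on with
  | empty => simpa [xs] using one_mem_gr M
  | insert S s hS ih =>
    rw [xs_insert hS, Finset.card_insert_of_notMem hS]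
    exact mul_mem_gr ih (x_mem_gr M S)

end Generators

section Balanced

variable (M : Matroid α) [M.Finite]

/-- All subsets of the ground set: sums over nonempty proper flats are written as sums over this
set of families extended by zero. -/
noncomputable def groundSubsets : Finset (Set α) := M.ground_finite.finite_subsets.toFinset

theorem mem_groundSubsets {S : Set α} : S ∈ groundSubsets M ↔ S ⊆ M.E := by
  simp [groundSubsets]

variable (V : Type*) [AddCommGroup V] [Module ℚ V]

open Classical in
/-- The families of vectors, indexed by the nonempty proper flats and extended by zero, that
satisfy the linear relations of the Chow ring; they are the linear maps from `CH^1` to `V`. -/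
noncomputable def balanced : Submodule ℚ (Set α → V) where
  carrier := {c | (∀ S, ¬ IsProperFlat M S → c S = 0) ∧ ∀ j ∈ M.E, ∀ l ∈ M.E,
    ∑ S ∈ groundSubsets M with j ∈ S, c S = ∑ S ∈ groundSubsets M with l ∈ S, c S}
  zero_mem' := by simp
  add_mem' := fun {c c'} hc hc' => by
    refine ⟨fun S hS => ?_, fun j hj l hl => ?_⟩
    · rw [Pi.add_apply, hc.1 S hS, hc'.1 S hS, add_zero]
    · simp only [Pi.add_apply, Finset.sum_add_distrib, hc.2 j hj l hl, hc'.2 j hj l hl]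
  smul_mem' := fun r c hc => by
    refine ⟨fun S hS => ?_, fun j hj l hl => ?_⟩
    · rw [Pi.smul_apply, hc.1 S hS, smul_zero]
    · simp only [Pi.smul_apply, ← Finset.smul_sum, hc.2 j hj l hl]

variable {M V} {W : Type*} [AddCommGroup W] [Module ℚ W] {c c' : Set α → V}
  {s : Finset (Set α)} {G H : Set α}

theorem comp_mem_balanced (φ : V →ₗ[ℚ] W) (hc : c ∈ balanced M V) :
    (fun S => φ (c S)) ∈ balanced M W := by
  refine ⟨fun S hS => by simp only [hc.1 S hS, map_zero], fun j hj l hl => ?_⟩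
  rw [← map_sum, ← map_sum, hc.2 j hj l hl]

open Classical in
theorem eq_neg_sum_of_mem_balanced (hc : c ∈ balanced M V) (hG : G ⊆ M.E) {j l : α} (hj : j ∈ G)
    (hl : l ∈ M.E) (hlG : l ∉ G) (h0 : ∀ S, l ∈ S → j ∉ S → c S = 0) :
    c G = - ∑ S ∈ groundSubsets M with (j ∈ S ∧ l ∉ S) ∧ S ≠ G, c S := by
  have hboth := hc.2 j (hG hj) l hl
  rw [← Finset.sum_filter_add_sum_filter_not _ (l ∈ ·),
    ← Finset.sum_filter_add_sum_filter_not {S ∈ groundSubsets M | l ∈ S} (j ∈ ·),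
    Finset.filter_comm (j ∈ ·) (l ∈ ·), add_right_inj, Finset.filter_filter,
    Finset.filter_filter] at hboth
  have hright : ∑ S ∈ groundSubsets M with l ∈ S ∧ j ∉ S, c S = 0 :=
    Finset.sum_eq_zero fun S hS => h0 S (Finset.mem_filter.1 hS).2.1 (Finset.mem_filter.1 hS).2.2
  rw [eq_neg_iff_add_eq_zero, ← hright, ← hboth, ← Finset.filter_filter, Finset.filter_ne']
  exact Finset.add_sum_erase _ c
    (Finset.mem_filter.2 ⟨(mem_groundSubsets M).2 hG, hj, hlG⟩)

theorem IsFlag.balanced_ext (hs : IsFlag M s) (hc : c ∈ balanced M V) (hc' : c' ∈ balanced M V)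
    (h : ∀ H, H ∉ s → c H = c' H) : c = c' := by
  classical
  have hd := sub_mem hc hc'
  have hd0 : ∀ H, H ∉ s → (c - c') H = 0 := fun H hH => sub_eq_zero.2 (h H hH)
  refine sub_eq_zero.1 (funext fun G => ?_)
  by_cases hG : G ∈ s
  · obtain ⟨j, hj, l, hl, hlG, hsep⟩ := hs.exists_separating hG
    have hzero : ∀ H, H ≠ G → (j ∈ H ∧ l ∉ H) → (c - c') H = 0 := fun H hH hjl =>
      hd0 H fun hHs => hH (hsep H hHs hjl.1 hjl.2)
    have hzero' : ∀ H, l ∈ H → j ∉ H → (c - c') H = 0 := fun H hlH hjH => hd0 H fun hHs =>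
      (hs.subset_or_subset hHs hG).elim (fun hHG => hlG (hHG hlH)) fun hGH => hjH (hGH hj)
    rw [eq_neg_sum_of_mem_balanced hd (hs.isProperFlat G hG).1.subset_ground hj hl hlG hzero',
      Finset.sum_eq_zero, neg_zero, Pi.zero_apply]
    intro H hH
    obtain ⟨-, hjl, hne⟩ := Finset.mem_filter.1 hH
    exact hzero H hne hjl
  · exact hd0 G hG

variable {A : Type*} [CommRing A] [Algebra ℚ A]

open Classical in
theorem map_linForm_eq_sum (φ : MvPolynomial (PFlat M) ℚ →ₐ[ℚ] A) (f : Set α → A)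
    (hf : ∀ F : PFlat M, φ (MvPolynomial.X F) = f F.1) (h0 : ∀ S, ¬ IsProperFlat M S → f S = 0)
    (j : α) : φ (linForm M j) = ∑ S ∈ groundSubsets M with j ∈ S, f S := by
  obtain ⟨E, hE⟩ := M.ground_finite.exists_finset_coe
  rw [map_linForm M φ f hf j E hE fun S _ hS _ => h0 S hS, Finset.sum_filter]
  refine Finset.sum_nbij (fun T => (T : Set α)) (fun T hT => ?_) Finset.coe_injective.injOn
    (fun S hS => ?_) fun T _ => by
      simp only [Finset.mem_coe]
  · rw [mem_groundSubsets, ← hE]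
    exact Finset.coe_subset.2 (Finset.mem_powerset.1 hT)
  · have hSE : S ⊆ E := by rwa [hE, ← mem_groundSubsets]
    obtain ⟨T, rfl⟩ := (E.finite_toSet.subset hSE).exists_finset_coe
    exact ⟨T, Finset.mem_powerset.2 (Finset.coe_subset.1 hSE), rfl⟩

variable (M) in
theorem x_mem_balanced : x M ∈ balanced M (CH M) := by
  refine ⟨fun S hS => x_of_not M hS, fun j hj l hl => ?_⟩
  have hx := map_linForm_eq_sum (toCH M) (x M) (fun F => (x_of_pflat M F).symm)
    fun S hS => x_of_not M hS
  rw [← hx, ← hx, toCH_linForm M hj hl]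

/-- The homomorphism from the Chow ring with prescribed images of the generators. -/
noncomputable def liftCH (f : Set α → A)
    (hmul : ∀ S T, ¬ S ⊆ T → ¬ T ⊆ S → f S * f T = 0) (hlin : f ∈ balanced M A) : CH M →ₐ[ℚ] A :=
  Ideal.Quotient.liftₐ (linIdeal M + monIdeal M) (MvPolynomial.aeval fun F : PFlat M => f F.1) (by
    have h : linIdeal M + monIdeal M ≤
        RingHom.ker (MvPolynomial.aeval fun F : PFlat M => f F.1 : _ →ₐ[ℚ] A) := by
      have hsum := map_linForm_eq_sum (MvPolynomial.aeval fun F : PFlat M => f F.1) f (by simp)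
        hlin.1
      refine sup_le (Ideal.span_le.2 ?_) (Ideal.span_le.2 ?_)
      · rintro _ ⟨j, hj, l, hl, -, rfl⟩
        rw [SetLike.mem_coe, RingHom.mem_ker, map_sub, hsum, hsum, hlin.2 j hj l hl, sub_self]
      · rintro _ ⟨F, G, h₁, h₂, rfl⟩
        simpa using hmul F.1 G.1 h₁ h₂
    exact fun p hp => h hp)

theorem liftCH_x (f : Set α → A) (hmul) (hlin : f ∈ balanced M A) (S : Set α) :
    liftCH f hmul hlin (x M S) = f S := by
  by_cases hS : IsProperFlat M S
  · rw [x_of_pflat M ⟨S, hS⟩]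
    exact MvPolynomial.aeval_X _ _
  · rw [x_of_not M hS, map_zero, hlin.1 S hS]

end Balanced

section Grading

variable (M : Matroid α) [M.Finite]

/-- The homomorphism `CH(M) → CH(M)[t]` that multiplies the part of degree `k` by `t ^ k`. -/
noncomputable def gradeHom : CH M →ₐ[ℚ] Polynomial (CH M) :=
  liftCH (fun S => Polynomial.monomial 1 (x M S))
    (fun S T h₁ h₂ => by rw [Polynomial.monomial_mul_monomial, x_mul_x M h₁ h₂, map_zero])
    (comp_mem_balanced ((Polynomial.monomial 1).restrictScalars ℚ) (x_mem_balanced M))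

variable {M}

theorem gradeHom_of_mem {k : ℕ} {a : CH M} (ha : a ∈ gr M k) :
    gradeHom M a = Polynomial.monomial k a := by
  let 𝒢 : ℕ → Submodule ℚ (CH M × Polynomial (CH M)) := fun k =>
    LinearMap.graph ((Polynomial.monomial k).restrictScalars ℚ : CH M →ₗ[ℚ] Polynomial (CH M))
  refine map_mem_of_mem_gr ((AlgHom.id ℚ (CH M)).prod (gradeHom M)) 𝒢 ?_ ?_ ?_ ha
  · simp [𝒢, LinearMap.mem_graph_iff]
  · rintro k ⟨a, a'⟩ ⟨b, b'⟩ ha hb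
    simp only [𝒢, LinearMap.mem_graph_iff, LinearMap.coe_restrictScalars, Prod.mk_mul_mk] at *
    rw [ha, hb, Polynomial.monomial_mul_monomial, add_comm]
  · intro F
    exact liftCH_x _ _ _ F.1

theorem eq_zero_of_sum_mem_gr {c : ℕ →₀ CH M} (hc : ∀ k, c k ∈ gr M k) {m : ℕ}
    (h : (c.sum fun _ b => b) ∈ gr M m) {k : ℕ} (hk : k ≠ m) : c k = 0 := by
  have hsum := gradeHom_of_mem h
  rw [Finsupp.sum, map_sum, Finset.sum_congr rfl fun l _ => gradeHom_of_mem (hc l)] at hsum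
  have hcoeff := congrArg (Polynomial.coeff · k) hsum
  simpa only [Polynomial.finsetSum_coeff, Polynomial.coeff_monomial, if_neg hk.symm,
    Finset.sum_ite_eq', Finsupp.mem_support_iff, ne_eq, ite_not, ite_eq_left_iff,
    Classical.not_imp, ite_eq_right_iff, imp_self, not_imp_self] using hcoeff

variable (M)

theorem gr_le_span (k : ℕ) :
    gr M k ≤ Submodule.span ℚ {a | ∃ s, IsFlag M s ∧ s.card = k ∧ a = xs M s} := by
  classical
  induction k with
  | zero =>
    rw [gr_pow, pow_zero, Submodule.one_eq_span, Submodule.span_le]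
    rintro _ rfl
    exact Submodule.subset_span ⟨∅, isFlag_empty M, rfl, by simp [xs]⟩
  | succ k ih =>
    rw [gr_pow, pow_succ, ← gr_pow, gr_one_eq]
    refine (mul_le_mul_left ih _).trans ?_
    rw [Submodule.span_mul_span, Submodule.span_le]
    rintro _ ⟨_, ⟨s, hs, rfl, rfl⟩, _, ⟨G, rfl⟩, rfl⟩
    have hnew : ∀ S, S ∉ s → xs M s * x M S ∈
        Submodule.span ℚ {a | ∃ t, IsFlag M t ∧ t.card = s.card + 1 ∧ a = xs M t} := by
      intro S hS
      by_cases hf : IsFlag M (insert S s)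
      · rw [← xs_insert hS]
        exact Submodule.subset_span ⟨_, hf, Finset.card_insert_of_notMem hS, rfl⟩
      · rw [hs.xs_mul_x_of_not_isFlag_insert hf]
        exact zero_mem _
    simp only [SetLike.mem_coe]
    by_cases hGs : G ∈ s
    · obtain ⟨j, hj, l, hl, hlG, hsep⟩ := hs.exists_separating hGs
      have hbal := comp_mem_balanced (LinearMap.mulLeft ℚ (xs M s)) (x_mem_balanced M)
      rw [← LinearMap.mulLeft_apply (R := ℚ), eq_neg_sum_of_mem_balanced hbal
        (hs.isProperFlat G hGs).1.subset_ground hj hl hlG fun S hlS hjS =>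
          xs_mul_x_eq_zero hGs (fun hSG => hlG (hSG hlS)) fun hGS => hjS (hGS hj)]
      refine neg_mem (sum_mem fun S hS => hnew S fun hSs => ?_)
      obtain ⟨-, hjlS, hSG⟩ := Finset.mem_filter.1 hS
      exact hSG (hsep S hSs hjlS.1 hjlS.2)
    · exact hnew G hGs

theorem span_xs : Submodule.span ℚ {a | ∃ s, IsFlag M s ∧ a = xs M s} = ⊤ := by
  rw [eq_top_iff]
  rintro a -
  obtain ⟨c, hc, rfl⟩ := exists_components a
  refine sum_mem fun k _ => Submodule.span_mono ?_ (gr_le_span M k (hc k))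
  rintro _ ⟨s, hs, -, rfl⟩
  exact ⟨s, hs, rfl⟩

theorem finite_CH : Module.Finite ℚ (CH M) := by
  classical
  refine ⟨⟨((groundSubsets M).powerset.image (xs M) : Finset (CH M)), ?_⟩⟩
  rw [eq_top_iff, ← span_xs M]
  refine Submodule.span_mono ?_
  rintro _ ⟨s, hs, rfl⟩
  refine Finset.mem_coe.2 (Finset.mem_image_of_mem _ (Finset.mem_powerset.2 fun S hS => ?_))
  exact (mem_groundSubsets M).2 (hs.isProperFlat S hS).1.subset_ground

variable {M} [M.Loopless]

theorem eq_zero_of_mem_gr {k : ℕ} (hk : topDeg M < k) {a : CH M} (ha : a ∈ gr M k) : a = 0 := by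
  have hspan := gr_le_span M k ha
  rw [← Submodule.mem_bot ℚ]
  refine (Submodule.span_le.2 ?_ : _ ≤ (⊥ : Submodule ℚ (CH M))) hspan
  rintro _ ⟨s, hs, rfl, rfl⟩
  exact absurd hs.card_le_topDeg hk.not_ge

theorem exists_scalar_add_nilpotent (a : CH M) :
    ∃ (c : ℚ) (n : CH M), IsNilpotent n ∧ a = algebraMap ℚ (CH M) c + n := by
  have h : a ∈ Algebra.adjoin ℚ (Set.range (x M)) := by
    rw [adjoin_x]
    trivial
  induction h using Algebra.adjoin_induction with
  | mem a ha =>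
    obtain ⟨S, rfl⟩ := ha
    refine ⟨0, x M S, ⟨topDeg M + 1, ?_⟩, by rw [map_zero, zero_add]⟩
    refine eq_zero_of_mem_gr (Nat.lt_succ_self _) ?_
    rw [gr_pow]
    exact Submodule.pow_mem_pow _ (x_mem_gr M S) _
  | algebraMap c => exact ⟨c, 0, IsNilpotent.zero, by rw [add_zero]⟩
  | add a b _ _ ha hb =>
    obtain ⟨c, n, hn, rfl⟩ := ha
    obtain ⟨d, m, hm, rfl⟩ := hb
    exact ⟨c + d, n + m, (Commute.all n m).isNilpotent_add hn hm, by rw [map_add]; ring⟩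
  | mul a b _ _ ha hb =>
    obtain ⟨c, n, hn, rfl⟩ := ha
    obtain ⟨d, m, hm, rfl⟩ := hb
    refine ⟨c * d, algebraMap ℚ _ c * m + n * (algebraMap ℚ _ d + m), ?_, by rw [map_mul]; ring⟩
    exact (Commute.all _ _).isNilpotent_add ((Commute.all _ _).isNilpotent_mul_left hm)
      ((Commute.all _ _).isNilpotent_mul_right hn)

end Grading

/-! ### The degree map, by intersecting Minkowski weights with generators -/

section CommutingLift

variable {M : Matroid α} [M.Finite]

theorem mem_balanced_of_comp_mem {V W : Type*} [AddCommGroup V] [Module ℚ V] [AddCommGroup W]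
    [Module ℚ W] {c : Set α → V} (φ : V →ₗ[ℚ] W) (hφ : Function.Injective φ)
    (h : (fun S => φ (c S)) ∈ balanced M W) : c ∈ balanced M V := by
  refine ⟨fun S hS => hφ ((h.1 S hS).trans (map_zero φ).symm), fun j hj l hl => hφ ?_⟩
  rw [map_sum, map_sum, h.2 j hj l hl]

open scoped IsMulCommutative in
theorem exists_algHom_of_commute {A : Type*} [Ring A] [Algebra ℚ A] {f : Set α → A}
    (hcomm : ∀ S T, f S * f T = f T * f S) (hmul : ∀ S T, ¬ S ⊆ T → ¬ T ⊆ S → f S * f T = 0)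
    (hlin : f ∈ balanced M A) : ∃ φ : CH M →ₐ[ℚ] A, ∀ S, φ (x M S) = f S := by
  let B := Algebra.adjoin ℚ (Set.range f)
  have : IsMulCommutative B := Algebra.isMulCommutative_adjoin ℚ (by
    rintro _ ⟨S, rfl⟩ _ ⟨T, rfl⟩
    exact hcomm S T)
  let g : Set α → B := fun S => ⟨f S, Algebra.subset_adjoin ⟨S, rfl⟩⟩
  have hg : g ∈ balanced M B :=
    mem_balanced_of_comp_mem B.val.toLinearMap Subtype.val_injective hlin
  refine ⟨B.val.comp (liftCH g (fun S T h₁ h₂ => Subtype.ext (hmul S T h₁ h₂)) hg), fun S => ?_⟩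
  rw [AlgHom.comp_apply, liftCH_x]
  rfl

end CommutingLift

section MinkowskiWeights

variable (M : Matroid α) [M.Finite] (V : Type*) [AddCommGroup V] [Module ℚ V]

open Classical in
/-- The functions on flags that satisfy the balancing condition around every flag: Minkowski
weights on the Bergman fan, of all dimensions at once. Around `s`, the value at `insert H s` is
prescribed to be that of a balanced family at `H`. -/
noncomputable def minkowskiWeights : Submodule ℚ (Finset (Set α) → V) where
  carrier := {w | (∀ s, ¬ IsFlag M s → w s = 0) ∧
    ∀ s, IsFlag M s → ∃ c ∈ balanced M V, ∀ H, H ∉ s → c H = w (insert H s)}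
  zero_mem' := ⟨fun _ _ => rfl, fun _ _ => ⟨0, zero_mem _, fun _ _ => rfl⟩⟩
  add_mem' := by
    rintro w w' ⟨hw, hw'⟩ ⟨hv, hv'⟩
    refine ⟨fun s hs => by rw [Pi.add_apply, hw s hs, hv s hs, add_zero], fun s hs => ?_⟩
    obtain ⟨c, hc, hcw⟩ := hw' s hs
    obtain ⟨d, hd, hdw⟩ := hv' s hs
    refine ⟨c + d, add_mem hc hd, fun H hH => ?_⟩
    rw [Pi.add_apply, Pi.add_apply, hcw H hH, hdw H hH]
  smul_mem' := by
    rintro r w ⟨hw, hw'⟩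
    refine ⟨fun s hs => by rw [Pi.smul_apply, hw s hs, smul_zero], fun s hs => ?_⟩
    obtain ⟨c, hc, hcw⟩ := hw' s hs
    refine ⟨r • c, Submodule.smul_mem _ r hc, fun H hH => ?_⟩
    rw [Pi.smul_apply, Pi.smul_apply, hcw H hH]

variable {M V} (w : minkowskiWeights M V) {s t : Finset (Set α)} {G H K S T : Set α}

open Classical in
/-- The balanced family of a Minkowski weight around the flag `t`; zero if `t` is not a flag. -/
noncomputable def slope (t : Finset (Set α)) (w : minkowskiWeights M V) : Set α → V :=
  if h : IsFlag M t then (w.2.2 t h).choose else 0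

theorem slope_of_not_isFlag (ht : ¬ IsFlag M t) : slope t w = 0 := dif_neg ht

theorem slope_mem_balanced : slope t w ∈ balanced M V := by
  rw [slope]
  split_ifs with h
  · exact (w.2.2 t h).choose_spec.1
  · exact zero_mem _

open Classical in
theorem slope_of_notMem (hH : H ∉ t) : slope t w H = w.1 (insert H t) := by
  by_cases h : IsFlag M t
  · rw [slope, dif_pos h]
    exact (w.2.2 t h).choose_spec.2 H hH
  · rw [slope_of_not_isFlag w h, w.2.1 _ fun hf => h (hf.mono (Finset.subset_insert H t)),
      Pi.zero_apply]

open Classical in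
theorem eq_slope {c : Set α → V} (ht : IsFlag M t) (hc : c ∈ balanced M V)
    (h : ∀ H, H ∉ t → c H = w.1 (insert H t)) : slope t w = c :=
  ht.balanced_ext (slope_mem_balanced w) hc fun H hH => by rw [slope_of_notMem w hH, h H hH]

theorem slope_eq_zero (hT : T ∈ t) (h₁ : ¬ S ⊆ T) (h₂ : ¬ T ⊆ S) : slope t w S = 0 := by
  classical
  by_cases ht : IsFlag M t
  · have hS : S ∉ t := fun hS => (ht.subset_or_subset hS hT).elim h₁ h₂
    rw [slope_of_notMem w hS, w.2.1]
    exact fun hf => ((isFlag_insert_iff.1 hf).2.2 T hT).elim h₂ h₁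
  · rw [slope_of_not_isFlag w ht, Pi.zero_apply]

open Classical in
theorem slope_insert_comm (hH : H ∉ s) (hK : K ∉ s) :
    slope (insert K s) w H = slope (insert H s) w K := by
  by_cases hHK : H = K
  · rw [hHK]
  · rw [slope_of_notMem w (by simp [hH, hHK]), slope_of_notMem w (by simp [hK, Ne.symm hHK]),
      Finset.insert_comm]

theorem slope_mem_minkowskiWeights (H : Set α) :
    (fun s => slope s w H) ∈ minkowskiWeights M V := by
  classical
  refine ⟨fun s hs => by simp only [slope_of_not_isFlag w hs, Pi.zero_apply], fun s hs => ?_⟩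
  by_cases hHs : H ∈ s
  · obtain ⟨j, hj, l, hl, hlH, hsep⟩ := hs.exists_separating hHs
    let others := {L ∈ groundSubsets M | (j ∈ L ∧ l ∉ L) ∧ L ≠ H}
    refine ⟨-∑ L ∈ others, slope (insert L s) w,
      neg_mem (sum_mem fun L _ => slope_mem_balanced w), fun K hK => ?_⟩
    change (-∑ L ∈ others, slope (insert L s) w) K = slope (insert K s) w H
    rw [eq_neg_sum_of_mem_balanced (slope_mem_balanced w) (hs.isProperFlat H hHs).1.subset_ground
      hj hl hlH fun S hlS hjS => slope_eq_zero w (Finset.mem_insert_of_mem hHs)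
        (fun h => hlH (h hlS)) fun h => hjS (h hj), Pi.neg_apply, Finset.sum_apply]
    refine congrArg _ (Finset.sum_congr rfl fun L hL => slope_insert_comm w hK fun hLs => ?_)
    obtain ⟨-, hjL, hne⟩ := Finset.mem_filter.1 hL
    exact hne (hsep L hLs hjL.1 hjL.2)
  · exact ⟨slope (insert H s) w, slope_mem_balanced w, fun K hK => slope_insert_comm w hK hHs⟩

theorem slope_add (w w' : minkowskiWeights M V) : slope t (w + w') = slope t w + slope t w' := by
  by_cases ht : IsFlag M t
  · refine eq_slope _ ht (add_mem (slope_mem_balanced w) (slope_mem_balanced w')) fun H hH => ?_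
    rw [Pi.add_apply, slope_of_notMem w hH, slope_of_notMem w' hH]
    rfl
  · simp only [slope_of_not_isFlag _ ht, add_zero]

theorem slope_smul (r : ℚ) : slope t (r • w) = r • slope t w := by
  by_cases ht : IsFlag M t
  · refine eq_slope _ ht (Submodule.smul_mem _ r (slope_mem_balanced w)) fun H hH => ?_
    rw [Pi.smul_apply, slope_of_notMem w hH]
    rfl
  · simp only [slope_of_not_isFlag _ ht, smul_zero]

variable (M V) in
/-- The intersection of Minkowski weights with the generator `x_H`. -/
noncomputable def cap (H : Set α) : Module.End ℚ (minkowskiWeights M V) where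
  toFun w := ⟨fun s => slope s w H, slope_mem_minkowskiWeights w H⟩
  map_add' w w' := Subtype.ext (funext fun _ => congrFun (slope_add w w') H)
  map_smul' r w := Subtype.ext (funext fun _ => congrFun (slope_smul w r) H)

theorem cap_apply : (cap M V H w).1 s = slope s w H := rfl

variable (M V) in
theorem cap_mem_balanced : cap M V ∈ balanced M (Module.End ℚ (minkowskiWeights M V)) := by
  have hslope := fun s (w : minkowskiWeights M V) => slope_mem_balanced (t := s) w
  refine ⟨fun S hS => ?_, fun j hj l hl => ?_⟩ <;> ext w s
  · exact (hslope s w).1 S hS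
  · simpa only [LinearMap.sum_apply, AddSubmonoidClass.coe_finsetSum, Finset.sum_apply,
      cap_apply]
      using (hslope s w).2 j hj l hl

theorem cap_mul_comm (H K : Set α) : cap M V H * cap M V K = cap M V K * cap M V H := by
  classical
  ext w s
  change slope s (cap M V K w) H = slope s (cap M V H w) K
  by_cases hs : IsFlag M s
  swap
  · simp only [slope_of_not_isFlag _ hs, Pi.zero_apply]
  have hleft : ∀ K, (fun H => slope s (cap M V K w) H) ∈ balanced M V := fun K =>
    slope_mem_balanced _
  have hright : ∀ H, (fun K => slope s (cap M V K w) H) ∈ balanced M V := by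
    intro H
    let ev : Module.End ℚ (minkowskiWeights M V) →ₗ[ℚ] V :=
      LinearMap.proj s ∘ₗ (minkowskiWeights M V).subtype ∘ₗ cap M V H ∘ₗ LinearMap.applyₗ w
    exact comp_mem_balanced ev (cap_mem_balanced M V)
  have hoff : ∀ H K, H ∉ s → K ∉ s → slope s (cap M V K w) H = slope s (cap M V H w) K := by
    intro H K hH hK
    rw [slope_of_notMem _ hH, slope_of_notMem _ hK, cap_apply, cap_apply,
      slope_insert_comm w hK hH]
  have hhalf : ∀ H K, K ∉ s → slope s (cap M V K w) H = slope s (cap M V H w) K := fun H K hK =>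
    congrFun (hs.balanced_ext (hleft K) (hright K) fun H hH => hoff H K hH hK) H
  exact congrFun (hs.balanced_ext (hright H) (hleft H) fun K hK => hhalf H K hK) K

theorem cap_mul_eq_zero (h₁ : ¬ H ⊆ K) (h₂ : ¬ K ⊆ H) : cap M V H * cap M V K = 0 := by
  classical
  have hout : ∀ {H K : Set α} {s}, ¬ H ⊆ K → ¬ K ⊆ H → H ∉ s →
      ∀ w : minkowskiWeights M V, slope s (cap M V K w) H = 0 := fun h₁ h₂ hH w => by
    rw [slope_of_notMem _ hH, cap_apply, slope_eq_zero w (Finset.mem_insert_self _ _) h₂ h₁]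
  ext w s
  by_cases hH : H ∈ s
  · by_cases hK : K ∈ s
    · exact slope_eq_zero _ hK h₁ h₂
    · rw [cap_mul_comm]
      exact hout h₂ h₁ hK w
  · exact hout h₁ h₂ hH w

variable (M V) in
theorem exists_algHom_cap : ∃ φ : CH M →ₐ[ℚ] Module.End ℚ (minkowskiWeights M V),
    ∀ S, φ (x M S) = cap M V S :=
  exists_algHom_of_commute (A := Module.End ℚ (minkowskiWeights M V)) (f := cap M V) cap_mul_comm
    (fun _ _ => cap_mul_eq_zero) (cap_mem_balanced M V)

variable (M V) in
/-- The action of the Chow ring on Minkowski weights, with `x_H` acting as `cap M V H`. -/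
noncomputable def capHom : CH M →ₐ[ℚ] Module.End ℚ (minkowskiWeights M V) :=
  (exists_algHom_cap M V).choose

theorem capHom_x (S : Set α) : capHom M V (x M S) = cap M V S :=
  (exists_algHom_cap M V).choose_spec S

theorem capHom_xs (s : Finset (Set α)) : (capHom M V (xs M s) w).1 ∅ = w.1 s := by
  classical
  induction s using Finset.induction_on generalizing w with
  | empty => rw [xs, Finset.prod_empty, map_one, Module.End.one_apply]
  | insert H s hH ih =>
    rw [xs_insert hH, map_mul, Module.End.mul_apply, ih, capHom_x, cap_apply, slope_of_notMem w hH]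

end MinkowskiWeights

/-- A degree map in terms of flags. The socle degree is `0` for the matroid on the empty set. -/
structure IsDeg (M : Matroid α) (D : CH M →ₗ[ℚ] ℚ) : Prop where
  eq_zero : ∀ k, k ≠ topDeg M → ∀ a ∈ gr M k, D a = 0
  flag : ∀ s, IsFlag M s → s.card = topDeg M → D (xs M s) = 1

section DegreeMap

variable {M : Matroid α} [M.Finite]

open Classical in
/-- The empty set is in no sum and the ground set is in all of them. -/
theorem ite_isProperFlat_mem_balanced {V : Type*} [AddCommGroup V] [Module ℚ V] {f : Set α → V}
    (hf : ∀ S, ¬ M.IsFlat S → f S = 0) (hsum : ∀ j ∈ M.E, ∀ l ∈ M.E,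
      ∑ S ∈ groundSubsets M with j ∈ S, f S = ∑ S ∈ groundSubsets M with l ∈ S, f S) :
    (fun S => if IsProperFlat M S then f S else 0) ∈ balanced M V := by
  have hground : ∀ j ∈ M.E,
      ∑ S ∈ groundSubsets M with j ∈ S, (if IsProperFlat M S then f S else 0) =
        ∑ S ∈ groundSubsets M with j ∈ S, f S - f M.E := by
    intro j hj
    rw [eq_sub_iff_add_eq', ← eq_sub_iff_add_eq, ← Finset.sum_sub_distrib,
      Finset.sum_eq_single M.E]
    · rw [if_neg fun h => h.2.2 rfl, sub_zero]
    · intro S hS hSE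
      by_cases hflat : M.IsFlat S
      · rw [if_pos ⟨hflat, ⟨j, (Finset.mem_filter.1 hS).2⟩, hSE⟩, sub_self]
      · rw [if_neg fun h => hflat h.1, hf S hflat, sub_zero]
    · exact fun h => absurd (Finset.mem_filter.2 ⟨(mem_groundSubsets M).2 subset_rfl, hj⟩) h
  refine ⟨fun S hS => if_neg hS, fun j hj l hl => ?_⟩
  rw [hground j hj, hground l hl, hsum j hj l hl]

open Classical in
theorem card_filter_between {A B : Set α} (hA : M.IsFlat A) (hB : M.IsFlat B)
    (hr : rk M B = rk M A + 2) (hAB : A ⊆ B) {U : Finset (Set α)}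
    (hU : ∀ S, S ∈ U ↔ M.IsFlat S ∧ A ⊂ S ∧ S ⊂ B) {j : α} (hjB : j ∈ B) (hjA : j ∉ A) :
    {S ∈ U | j ∈ S}.card = 1 := by
  obtain ⟨H, ⟨hH, hAH, hHB, hjH⟩, huniq⟩ := existsUnique_isFlat_between hA hB hr hAB hjB hjA
  refine Finset.card_eq_one.2 ⟨H, Finset.ext fun S => ?_⟩
  rw [Finset.mem_filter, hU, Finset.mem_singleton]
  refine ⟨fun h => huniq S ⟨h.1.1, h.1.2.1, h.1.2.2, h.2⟩, ?_⟩
  rintro rfl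
  exact ⟨⟨hH, hAH, hHB⟩, hjH⟩

theorem exists_balanced_of_rk_eq_add_two {A B : Set α} (hA : M.IsFlat A) (hB : M.IsFlat B)
    (hAB : A ⊂ B) (hr : rk M B = rk M A + 2) :
    ∃ c ∈ balanced M ℚ, (∀ H, IsProperFlat M H → A ⊂ H → H ⊂ B → c H = 1) ∧
      ∀ H, H ≠ A → H ≠ B → ¬ (A ⊂ H ∧ H ⊂ B) → c H = 0 := by
  classical
  let between := {S ∈ groundSubsets M | M.IsFlat S ∧ A ⊂ S ∧ S ⊂ B}
  let f : Set α → ℚ := fun S => (if S ∈ between then 1 else 0) +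
    (if S = A then 1 - (between.card : ℚ) else 0) - (if S = B then 1 else 0)
  have hmem : ∀ S, S ∈ between ↔ M.IsFlat S ∧ A ⊂ S ∧ S ⊂ B := fun S => by
    simp only [between, Finset.mem_filter, mem_groundSubsets, and_iff_right_iff_imp]
    exact fun h => h.1.subset_ground
  have hsum : ∀ j, ∑ S ∈ groundSubsets M with j ∈ S, f S = 0 := by
    intro j
    have hfilter : ∑ S ∈ groundSubsets M with j ∈ S, f S = ({S ∈ between | j ∈ S}.card : ℚ) +
        (if j ∈ A then 1 - (between.card : ℚ) else 0) - (if j ∈ B then 1 else 0) := by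
      simp only [f, Finset.sum_sub_distrib, Finset.sum_add_distrib, Finset.sum_ite_eq',
        Finset.mem_filter, mem_groundSubsets, hA.subset_ground, hB.subset_ground, true_and]
      rw [Finset.sum_boole]
      congr 4
      ext S
      simp only [between, Finset.mem_filter]
      tauto
    rw [hfilter]
    by_cases hjA : j ∈ A
    · rw [Finset.filter_true_of_mem fun S hS => ((hmem S).1 hS).2.1.1 hjA, if_pos hjA,
        if_pos (hAB.1 hjA)]
      ring
    by_cases hjB : j ∈ B
    · rw [card_filter_between hA hB hr hAB.1 hmem hjB hjA, if_neg hjA, if_pos hjB, Nat.cast_one,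
        add_zero, sub_self]
    · rw [Finset.filter_false_of_mem fun S hS hjS => hjB (((hmem S).1 hS).2.2.1 hjS), if_neg hjA,
        if_neg hjB, Finset.card_empty, Nat.cast_zero, add_zero, sub_zero]
  refine ⟨_, ite_isProperFlat_mem_balanced (f := f) (fun S hS => ?_) fun j _ l _ => by
    rw [hsum j, hsum l], fun H hH hAH hHB => ?_, fun H hHA hHB hH => ?_⟩
  · have hSA : S ≠ A := fun h => hS (h ▸ hA)
    have hSB : S ≠ B := fun h => hS (h ▸ hB)
    simp only [f, hmem, hS, hSA, hSB, false_and, if_false, add_zero, sub_zero]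
  · simp only [f, if_pos hH, if_pos ((hmem H).2 ⟨hH.1, hAH, hHB⟩), if_neg hAH.ne',
      if_neg hHB.ne, add_zero, sub_zero]
  · have hf : f H = 0 := by
      simp only [f, if_neg fun h => hH ((hmem H).1 h).2, if_neg hHA, if_neg hHB, add_zero, sub_zero]
    simp only [hf, ite_self]

theorem IsDeg.unique {D D' : CH M →ₗ[ℚ] ℚ} (h : IsDeg M D) (h' : IsDeg M D') : D = D' := by
  refine LinearMap.ext_on (span_xs M) ?_
  rintro _ ⟨s, hs, rfl⟩
  by_cases hc : s.card = topDeg M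
  · rw [h.flag s hs hc, h'.flag s hs hc]
  · rw [h.eq_zero _ hc _ (xs_mem_gr s), h'.eq_zero _ hc _ (xs_mem_gr s)]

variable [M.Loopless]

variable (M) in
open Classical in
/-- The fundamental Minkowski weight: `1` on the complete flags. -/
noncomputable def topWeight : minkowskiWeights M ℚ where
  val s := if IsFlag M s ∧ s.card = topDeg M then 1 else 0
  property := by
    refine ⟨fun s hs => if_neg fun h => hs h.1, fun s hs => ?_⟩
    by_cases hcard : s.card + 1 = topDeg M
    swap
    · refine ⟨0, zero_mem _, fun H hH => (if_neg fun h => hcard ?_).symm⟩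
      rw [← h.2, Finset.card_insert_of_notMem hH]
    obtain ⟨A, B, hg, hr⟩ := hs.exists_isGap_of_card_add_one hcard
    obtain ⟨c, hc, hc₁, hc₀⟩ := exists_balanced_of_rk_eq_add_two (hg.isFlat_lower hs)
      (hg.isFlat_upper hs) hg.ssubset hr
    refine ⟨c, hc, fun H hH => ?_⟩
    by_cases hf : IsFlag M (insert H s)
    · obtain ⟨hAH, hHB⟩ := hg.ssubset_of_isFlag_insert hcard (by omega) hH hf
      exact (hc₁ H (isFlag_insert_iff.1 hf).1 hAH hHB).trans
        (if_pos ⟨hf, by rw [Finset.card_insert_of_notMem hH, hcard]⟩).symm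
    refine Eq.trans ?_ (if_neg fun h => hf h.1).symm
    by_cases hflat : IsProperFlat M H
    swap
    · exact hc.1 H hflat
    refine hc₀ H ?_ ?_ fun h => hf (hg.isFlag_insert hs hflat.1 h.1 h.2).2
    · rintro rfl
      exact hg.lower.elim hflat.2.1.ne_empty hH
    · rintro rfl
      exact hg.upper.elim hflat.2.2 hH

open Classical in
theorem topWeight_apply (s : Finset (Set α)) :
    (topWeight M).1 s = if IsFlag M s ∧ s.card = topDeg M then 1 else 0 := rfl

variable (M) in
theorem exists_isDeg : ∃ D : CH M →ₗ[ℚ] ℚ, IsDeg M D := by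
  classical
  let D : CH M →ₗ[ℚ] ℚ := LinearMap.proj ∅ ∘ₗ (minkowskiWeights M ℚ).subtype ∘ₗ
    LinearMap.applyₗ (topWeight M) ∘ₗ (capHom M ℚ).toLinearMap
  have hD : ∀ s, D (xs M s) = if IsFlag M s ∧ s.card = topDeg M then 1 else 0 := fun s =>
    (capHom_xs (topWeight M) s).trans (topWeight_apply s)
  refine ⟨D, fun k hk a ha => ?_, fun s hs hc => (hD s).trans (if_pos ⟨hs, hc⟩)⟩
  suffices h : gr M k ≤ LinearMap.ker D from h ha
  refine (gr_le_span M k).trans (Submodule.span_le.2 ?_)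
  rintro _ ⟨s, -, rfl, rfl⟩
  exact (hD s).trans (if_neg fun h => hk h.2)

theorem isDeg_iff_isDegreeMap (hE : M.E.Nonempty) (D : CH M →ₗ[ℚ] ℚ) :
    IsDeg M D ↔ IsDegreeMap M D := by
  classical
  have hdeg : ∀ k : ℕ, k ≠ topDeg M ↔ (k : ℕ∞) + 1 ≠ M.eRank := by
    intro k
    rw [← Matroid.eRk_ground, ← coe_rk, topDeg, Ne, Ne, not_iff_not]
    have hpos := rk_pos (M := M) subset_rfl hE
    norm_cast
    omega
  have hprod : ∀ C : Finset (PFlat M), ∏ F ∈ C, x M F.1 = xs M (C.image Subtype.val) := fun C => by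
    rw [xs, Finset.prod_image Subtype.val_injective.injOn]
  constructor
  · refine fun h => ⟨fun k hk => h.eq_zero k ((hdeg k).2 hk), fun C hC => ?_⟩
    rw [hprod]
    exact h.flag _ ((isMaxChain_iff C).1 hC).1 ((isMaxChain_iff C).1 hC).2
  · refine fun h => ⟨fun k hk => h.eq_zero k ((hdeg k).1 hk), fun s hs hc => ?_⟩
    have himage : (s.subtype (IsProperFlat M)).image Subtype.val = s := by
      refine (Finset.map_eq_image _ _).symm.trans ((Finset.subtype_map _).trans ?_)
      exact Finset.filter_true_of_mem hs.isProperFlat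
    rw [← himage, ← hprod]
    exact h.flag _ ((isMaxChain_iff _).2 (by rw [himage]; exact ⟨hs, hc⟩))

theorem existsUnique_isDegreeMap (hE : M.E.Nonempty) :
    ∃! D : CH M →ₗ[ℚ] ℚ, IsDegreeMap M D := by
  obtain ⟨D, hD⟩ := exists_isDeg M
  exact ⟨D, (isDeg_iff_isDegreeMap hE D).1 hD,
    fun D' hD' => ((isDeg_iff_isDegreeMap hE D').2 hD').unique hD⟩

end DegreeMap

/-! ### Nondegenerate pairings and tensor products -/

/-- Nondegeneracy of the Poincaré pairing. It concerns every degree map; by `IsDeg.unique` there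
is just one. -/
def Nondeg (M : Matroid α) : Prop :=
  ∀ D : CH M →ₗ[ℚ] ℚ, IsDeg M D → ∀ a, (∀ b, D (a * b) = 0) → a = 0

/-- The tensor product of two functionals. -/
noncomputable def tensorDeg {A B : Type*} [CommRing A] [Algebra ℚ A] [CommRing B] [Algebra ℚ B]
    (DA : A →ₗ[ℚ] ℚ) (DB : B →ₗ[ℚ] ℚ) : A ⊗[ℚ] B →ₗ[ℚ] ℚ :=
  LinearMap.mul' ℚ ℚ ∘ₗ TensorProduct.map DA DB

theorem tensorDeg_tmul {A B : Type*} [CommRing A] [Algebra ℚ A] [CommRing B] [Algebra ℚ B]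
    (DA : A →ₗ[ℚ] ℚ) (DB : B →ₗ[ℚ] ℚ) (a : A) (b : B) :
    tensorDeg DA DB (a ⊗ₜ b) = DA a * DB b := rfl

theorem tensorDeg_nondegenerate {A B : Type*} [CommRing A] [Algebra ℚ A] [CommRing B]
    [Algebra ℚ B] [Module.Finite ℚ B] {DA : A →ₗ[ℚ] ℚ} {DB : B →ₗ[ℚ] ℚ}
    (hA : ∀ a, (∀ b, DA (a * b) = 0) → a = 0) (hB : ∀ a, (∀ b, DB (a * b) = 0) → a = 0)
    (t : A ⊗[ℚ] B) (ht : ∀ u, tensorDeg DA DB (t * u) = 0) : t = 0 := by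
  classical
  let b := Module.finBasis ℚ B
  let φ : B →ₗ[ℚ] Module.Dual ℚ B := (LinearMap.mul ℚ B).compr₂ DB
  have hφ : Function.Injective φ := by
    rw [injective_iff_map_eq_zero]
    exact fun a ha => hB a fun c => DFunLike.congr_fun ha c
  have hφs : Function.Surjective φ :=
    (LinearMap.injective_iff_surjective_of_finrank_eq_finrank
      (Subspace.dual_finrank_eq (K := ℚ) (V := B)).symm).1 hφ
  obtain ⟨c, rfl⟩ := TensorProduct.eq_repr_basis_right b t
  have hc : ∀ k, c k = 0 := by
    intro k
    refine hA _ fun a => ?_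
    obtain ⟨d, hd⟩ := hφs (b.coord k)
    have hdual : ∀ j, DB (b j * d) = if j = k then 1 else 0 := by
      intro j
      have hcoord : DB (d * b j) = b.coord k (b j) := DFunLike.congr_fun hd (b j)
      rw [mul_comm, hcoord, Module.Basis.coord_apply, Module.Basis.repr_self,
        Finsupp.single_apply]
    have hsum := ht (a ⊗ₜ d)
    rw [Finsupp.sum, Finset.sum_mul, map_sum] at hsum
    simp_rw [Algebra.TensorProduct.tmul_mul_tmul, tensorDeg_tmul, hdual, mul_ite, mul_one,
      mul_zero] at hsum
    rw [Finset.sum_ite_eq'] at hsum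
    split_ifs at hsum with hk
    · exact hsum
    · rw [Finsupp.notMem_support_iff.1 hk, zero_mul, map_zero]
  rw [Finsupp.sum, Finset.sum_eq_zero]
  intro k _
  rw [hc k, TensorProduct.zero_tmul]

section GradedTensor

variable (M N : Matroid α)

theorem grTensor_eq_span (k : ℕ) : grTensor M N k = Submodule.span ℚ
    {t | ∃ p q a b, p + q = k ∧ a ∈ gr M p ∧ b ∈ gr N q ∧ t = a ⊗ₜ[ℚ] b} := by
  apply le_antisymm
  · refine iSup₂_le fun p hp => ?_
    rw [Submodule.map₂_le]
    intro a ha b hb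
    exact Submodule.subset_span
      ⟨p.1, p.2, a, b, Finset.HasAntidiagonal.mem_antidiagonal.1 hp, ha, hb, rfl⟩
  · rw [Submodule.span_le]
    rintro _ ⟨p, q, a, b, hpq, ha, hb, rfl⟩
    refine Submodule.mem_iSup_of_mem (p, q) (Submodule.mem_iSup_of_mem ?_ ?_)
    · exact Finset.HasAntidiagonal.mem_antidiagonal.2 hpq
    · exact Submodule.apply_mem_map₂ _ ha hb

theorem tmul_mem_grTensor {p q k : ℕ} (h : p + q = k) {a : CH M} {b : CH N} (ha : a ∈ gr M p)
    (hb : b ∈ gr N q) : a ⊗ₜ[ℚ] b ∈ grTensor M N k := by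
  rw [grTensor_eq_span]
  exact Submodule.subset_span ⟨p, q, a, b, h, ha, hb, rfl⟩

theorem exists_components_tensor (t : CH M ⊗[ℚ] CH N) :
    ∃ c : ℕ →₀ CH M ⊗[ℚ] CH N, (∀ k, c k ∈ grTensor M N k) ∧ t = c.sum fun _ b => b := by
  have h : t ∈ ⨆ k, grTensor M N k := by
    induction t using TensorProduct.induction_on with
    | zero => exact zero_mem _
    | add a b ha hb => exact add_mem ha hb
    | tmul a b =>
      obtain ⟨c, hc, rfl⟩ := exists_components a
      obtain ⟨d, hd, rfl⟩ := exists_components b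
      rw [Finsupp.sum, Finsupp.sum, TensorProduct.sum_tmul]
      refine sum_mem fun k _ => ?_
      rw [TensorProduct.tmul_sum]
      exact sum_mem fun l _ => Submodule.mem_iSup_of_mem (k + l)
        (tmul_mem_grTensor M N rfl (hc k) (hd l))
  obtain ⟨c, hc, h⟩ := (Submodule.mem_iSup_iff_exists_finsupp _ _).1 h
  exact ⟨c, hc, h.symm⟩

theorem eq_zero_of_mem_grTensor [M.Finite] [M.Loopless] [N.Finite] [N.Loopless] {k : ℕ}
    (hk : topDeg M + topDeg N < k) {t : CH M ⊗[ℚ] CH N} (ht : t ∈ grTensor M N k) : t = 0 := by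
  rw [grTensor_eq_span] at ht
  rw [← Submodule.mem_bot ℚ]
  refine (Submodule.span_le.2 ?_ : _ ≤ (⊥ : Submodule ℚ _)) ht
  rintro _ ⟨p, q, a, b, h1, ha, hb, rfl⟩
  rw [SetLike.mem_coe, Submodule.mem_bot]
  by_cases hp : topDeg M < p
  · rw [eq_zero_of_mem_gr hp ha, TensorProduct.zero_tmul]
  · rw [eq_zero_of_mem_gr (by omega) hb, TensorProduct.tmul_zero]

end GradedTensor

/-! ### Flats of minors -/

section Minors

variable {M : Matroid α}

theorem loopless_delete [M.Loopless] (i : α) : (M ＼ {i}).Loopless :=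
  (M.delete_isRestriction {i}).loopless

theorem loopless_restrict [M.Loopless] {F : Set α} (hF : F ⊆ M.E) : (M ↾ F).Loopless :=
  (Matroid.restrict_isRestriction M F hF).loopless

theorem loopless_contract {K : Set α} (hK : M.IsFlat K) : (M ／ K).Loopless :=
  ⟨by rw [Matroid.contract_loops_eq, hK.closure, Set.sdiff_self]⟩

theorem isFlat_restrict_iff {F : Set α} (hF : M.IsFlat F) {S : Set α} :
    (M ↾ F).IsFlat S ↔ M.IsFlat S ∧ S ⊆ F := by
  constructor
  · intro h
    have hS : S ⊆ F := h.subset_ground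
    have hSF : M.closure S ⊆ F := (M.closure_subset_closure hS).trans hF.closure.subset
    have hclosure := h.closure
    rw [Matroid.restrict_closure_eq M hS hF.subset_ground, Set.inter_eq_left.2 hSF] at hclosure
    exact ⟨Matroid.isFlat_iff_closure_eq.2 hclosure, hS⟩
  · rintro ⟨h, hS⟩
    rw [Matroid.isFlat_iff_closure_eq, Matroid.restrict_closure_eq M hS hF.subset_ground,
      h.closure, Set.inter_eq_left.2 hS]

theorem isProperFlat_restrict_iff {F : Set α} (hF : IsProperFlat M F) {S : Set α} :
    IsProperFlat (M ↾ F) S ↔ IsProperFlat M S ∧ S ⊂ F := by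
  rw [IsProperFlat, isFlat_restrict_iff hF.1]
  constructor
  · rintro ⟨⟨hS, hSF⟩, hne, hSF'⟩
    exact ⟨⟨hS, hne, fun h => hF.2.2 (hF.1.subset_ground.antisymm (h ▸ hSF))⟩,
      hSF.ssubset_of_ne hSF'⟩
  · rintro ⟨⟨hS, hne, -⟩, hSF⟩
    exact ⟨⟨hS, hSF.subset⟩, hne, hSF.ne⟩

theorem isFlat_contract_iff {K : Set α} (hK : K ⊆ M.E) {S : Set α} (hS : Disjoint S K) :
    (M ／ K).IsFlat S ↔ M.IsFlat (S ∪ K) := by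
  rw [Matroid.isFlat_iff_closure_eq, Matroid.contract_closure_eq, Matroid.isFlat_iff_closure_eq]
  constructor
  · intro h
    have hSE : S ⊆ M.E := by
      rw [← h]
      exact Set.sdiff_subset.trans (M.closure_subset_ground _)
    refine Set.Subset.antisymm ?_ (M.subset_closure _ (Set.union_subset hSE hK))
    intro a ha
    by_cases haK : a ∈ K
    · exact Or.inr haK
    · exact Or.inl (h ▸ ⟨ha, haK⟩)
  · intro h
    rw [h, Set.union_sdiff_right, hS.sdiff_eq_left]

theorem isProperFlat_contract_iff {K : Set α} (hK : K ⊆ M.E) {S : Set α} :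
    IsProperFlat (M ／ K) S ↔ IsProperFlat M (S ∪ K) ∧ Disjoint S K ∧ S.Nonempty := by
  constructor
  · rintro ⟨hS, hne, hSE⟩
    have hd : Disjoint S K :=
      Set.disjoint_of_subset_left hS.subset_ground Set.disjoint_sdiff_left
    refine ⟨⟨(isFlat_contract_iff hK hd).1 hS, hne.mono Set.subset_union_left, fun h => hSE ?_⟩,
      hd, hne⟩
    rw [Matroid.contract_ground, ← h, Set.union_sdiff_right, hd.sdiff_eq_left]
  · rintro ⟨hSK, hd, hne⟩
    refine ⟨(isFlat_contract_iff hK hd).2 hSK.1, hne, fun h => hSK.2.2 ?_⟩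
    rw [h, Matroid.contract_ground, Set.sdiff_union_of_subset hK]

theorem rk_restrict (F : Set α) : rk (M ↾ F) (M ↾ F).E = rk M F := by
  rw [rk, rk, Matroid.restrict_ground_eq, Matroid.restrict_eRk_eq M subset_rfl]

theorem rk_contract [M.Finite] {K : Set α} (hK : K ⊆ M.E) :
    rk (M ／ K) (M ／ K).E + rk M K = rk M M.E := by
  obtain ⟨I, hI⟩ := M.exists_isBasis K
  obtain ⟨B, hB, hIB⟩ := hI.indep.exists_isBase_superset
  have hBK : B ∩ K = I :=
    (hI.eq_of_subset_indep (hB.indep.inter_right K) (Set.subset_inter hIB hI.subset)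
      Set.inter_subset_right).symm
  have hd : Disjoint K (B \ I) := by
    rw [Set.disjoint_left]
    exact fun a haK ha => ha.2 (hBK ▸ ⟨ha.1, haK⟩)
  have hindep : (M ／ K).Indep (B \ I) := by
    rw [hI.contract_indep_iff, Set.sdiff_union_of_subset hIB]
    exact ⟨hB.indep, hd⟩
  have hspan : (M ／ K).Spanning (B \ I) := by
    refine (Matroid.contract_spanning_iff hK).2 ⟨hB.spanning.superset ?_
      (Set.union_subset (Set.sdiff_subset.trans hB.subset_ground) hK), hd.symm⟩
    rw [← Set.sdiff_subset_iff, Set.sdiff_sdiff_cancel_left hIB]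
    exact hI.subset
  have hcard := Set.encard_sdiff_add_encard_of_subset hIB
  rw [(hindep.isBase_of_spanning hspan).encard_eq_eRank, hI.encard_eq_eRk, hB.encard_eq_eRank,
    ← Matroid.eRk_ground, ← Matroid.eRk_ground, ← coe_rk, ← coe_rk, ← coe_rk] at hcard
  exact_mod_cast hcard

theorem rk_delete_of_not_isColoop {i : α} (hi : ¬ M.IsColoop i) :
    rk (M ＼ {i}) (M ＼ {i}).E = rk M M.E := by
  rw [Matroid.isColoop_iff_sdiff_not_spanning, not_not] at hi
  rw [rk, rk, Matroid.eRk_ground, Matroid.eRk_ground, ← hi.eRank_restrict]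
  rfl

theorem rk_delete_of_isColoop [M.Finite] {i : α} (hi : M.IsColoop i) :
    rk (M ＼ {i}) (M ＼ {i}).E + 1 = rk M M.E := by
  have hinsert := rk_insert M (S := M.E \ {i}) hi.mem_ground
    (hi.notMem_closure_of_notMem fun h => h.2 rfl)
  rw [Set.insert_sdiff_singleton, Set.insert_eq_of_mem hi.mem_ground] at hinsert
  rw [hinsert, rk, rk, Matroid.delete_ground, Matroid.delete_eq_restrict,
    Matroid.restrict_eRk_eq M subset_rfl]

end Minors

section Si

variable {M : Matroid α} {i : α} {F : Set α}

theorem Si.notMem (hF : F ∈ Si M i) : i ∉ F := fun h => (hF.2.1.subset h).2 rfl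

theorem Si.subset (hF : F ∈ Si M i) : F ⊆ M.E \ {i} := hF.2.1.subset

theorem Si.exists_notMem (hF : F ∈ Si M i) : ∃ l ∈ M.E, l ∉ insert i F := by
  obtain ⟨l, hl, hlF⟩ := Set.exists_of_ssubset hF.2.1
  exact ⟨l, hl.1, fun h => h.elim hl.2 hlF⟩

theorem Si.isProperFlat (hF : F ∈ Si M i) : IsProperFlat M F := by
  obtain ⟨l, hl, hlF⟩ := Si.exists_notMem hF
  exact ⟨hF.2.2.1, hF.1, fun h => hlF (Or.inr (h ▸ hl))⟩

theorem Si.isProperFlat_insert (hF : F ∈ Si M i) : IsProperFlat M (insert i F) := by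
  obtain ⟨l, hl, hlF⟩ := Si.exists_notMem hF
  exact ⟨hF.2.2.2, Set.insert_nonempty _ _, fun h => hlF (h ▸ hl)⟩

theorem Si.isProperFlat_delete (hF : F ∈ Si M i) : IsProperFlat (M ＼ {i}) F :=
  ⟨isFlat_delete M i hF.2.2.1 (by simp [Si.notMem hF]), hF.1, hF.2.1.ne⟩

end Si

/-! ### Generators of the Chow ring over the Chow ring of the deletion -/

section Insert

variable (M : Matroid α) [M.Finite] {i : α}

variable {M} in
theorem notMem_of_mem_groundSubsets_delete {T : Set α} (hT : T ∈ groundSubsets (M ＼ {i})) :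
    i ∉ T :=
  fun h => ((mem_groundSubsets _).1 hT h).2 rfl

omit [M.Finite] in
variable {M} in
theorem isProperFlat_delete {T G : Set α} (hne : T.Nonempty) (hG : IsProperFlat M G)
    (hGT : T = G \ {i}) (hTE : T ≠ M.E \ {i}) : IsProperFlat (M ＼ {i}) T :=
  ⟨isFlat_delete M i hG.1 hGT, hne, hTE⟩

omit [M.Finite] in
theorem x_insert_compl : x M (insert i (M.E \ {i})) = 0 := by
  apply x_of_not
  rintro ⟨hflat, -, hne⟩
  have hi : i ∈ M.E := hflat.subset_ground (Set.mem_insert _ _)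
  exact hne (by rw [Set.insert_sdiff_singleton, Set.insert_eq_of_mem hi])

theorem theta_x_eq_add {T : Set α} (hT : T ⊆ M.E \ {i}) (hne : T.Nonempty) (hTE : T ≠ M.E \ {i}) :
    theta M i (x (M ＼ {i}) T) = x M T + x M (insert i T) := by
  by_cases h : IsProperFlat (M ＼ {i}) T
  · exact theta_x M i ⟨T, h⟩
  · have hiT : i ∉ T := fun h => (hT h).2 rfl
    rw [x_of_not _ h, map_zero, x_of_not M, x_of_not M, add_zero]
    · exact fun hflat => h (isProperFlat_delete hne hflat (by simp [hiT]) hTE)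
    · exact fun hflat => h (isProperFlat_delete hne hflat (by simp [hiT]) hTE)

theorem sum_groundSubsets_eq {A : Type*} [AddCommMonoid A] (hi : i ∈ M.E) (g : Set α → A) :
    ∑ S ∈ groundSubsets M, g S = ∑ T ∈ groundSubsets (M ＼ {i}), (g T + g (insert i T)) := by
  classical
  rw [← Finset.sum_filter_add_sum_filter_not (groundSubsets M) (fun S => i ∉ S),
    Finset.sum_add_distrib]
  congr 1
  · refine Finset.sum_congr ?_ fun _ _ => rfl
    ext S
    rw [Finset.mem_filter, mem_groundSubsets, mem_groundSubsets, Matroid.delete_ground,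
      Set.subset_sdiff, Set.disjoint_singleton_right]
  · have hinsert {S : Set α} (hS : S ∈ {S ∈ groundSubsets M | ¬ i ∉ S}) :
        insert i (S \ {i}) = S := by
      rw [Set.insert_sdiff_singleton,
        Set.insert_eq_of_mem (not_not.1 (Finset.mem_filter.1 hS).2)]
    refine Finset.sum_nbij' (· \ {i}) (insert i) (fun S hS => ?_) (fun T hT => ?_)
      (fun S hS => hinsert hS) (fun T hT => ?_) fun S hS => by rw [hinsert hS]
    · rw [Finset.mem_filter, mem_groundSubsets] at hS
      exact (mem_groundSubsets _).2 (Set.sdiff_subset_sdiff_left hS.1)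
    · rw [mem_groundSubsets] at hT
      rw [Finset.mem_filter, mem_groundSubsets, not_not]
      exact ⟨Set.insert_subset hi (hT.trans Set.sdiff_subset), Set.mem_insert _ _⟩
    · simp [notMem_of_mem_groundSubsets_delete hT]

open Classical in
/-- The class `∑_{j ∈ S} x_S`, which is the class `α` of `M` for every `j ∈ E`; it is `alphaAt M j`
as a sum over all subsets of the ground set. -/
noncomputable def linSum (j : α) : CH M := ∑ S ∈ groundSubsets M with j ∈ S, x M S

theorem linSum_congr {j l : α} (hj : j ∈ M.E) (hl : l ∈ M.E) : linSum M j = linSum M l :=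
  (x_mem_balanced M).2 j hj l hl

open Classical in
theorem linSum_of_ne (hi : i ∈ M.E) {j : α} (hj : j ≠ i) : linSum M j =
    ∑ T ∈ groundSubsets (M ＼ {i}) with j ∈ T, (x M T + x M (insert i T)) := by
  rw [linSum, Finset.sum_filter, sum_groundSubsets_eq M hi, Finset.sum_filter]
  refine Finset.sum_congr rfl fun T _ => ?_
  by_cases h : j ∈ T <;> simp [h, hj]

theorem linSum_self (hi : i ∈ M.E) :
    linSum M i = ∑ T ∈ groundSubsets (M ＼ {i}), x M (insert i T) := by
  classical
  rw [linSum, Finset.sum_filter, sum_groundSubsets_eq M hi]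
  refine Finset.sum_congr rfl fun T hT => ?_
  simp [notMem_of_mem_groundSubsets_delete hT]

theorem linSum_eq_theta {j : α} (hj : j ∈ M.E \ {i}) :
    linSum M j = theta M i (linSum (M ＼ {i}) j) + x M (M.E \ {i}) := by
  have linSum_eq_toCH (N : Matroid α) [N.Finite] : linSum N j = toCH N (linForm N j) :=
    (map_linForm_eq_sum (toCH N) (x N) (fun F => (x_of_pflat N F).symm)
      (fun _ => x_of_not N) j).symm
  rw [linSum_eq_toCH, linSum_eq_toCH, ← sub_eq_iff_eq_add]
  exact (thetaPoly_linForm M i j hj).symm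

theorem smul_eq_theta_mul (a : CH (M ＼ {i})) (b : CH M) : a • b = theta M i a * b := rfl

end Insert

section Product

variable {M : Matroid α} {i : α} {F T : Set α}

theorem x_mul_x_insert (hiT : i ∉ T) (hT : ¬ T ⊆ F) : x M T * x M (insert i F) = 0 :=
  x_mul_x M (fun h => hT ((Set.subset_insert_iff_of_notMem hiT).1 h))
    fun h => hiT (h (Set.mem_insert _ _))

theorem x_insert_mul_x_insert (hF : F ∈ Si M i) (hiT : i ∉ T) (h₁ : ¬ T ⊆ F) (h₂ : ¬ F ⊆ T) :
    x M (insert i T) * x M (insert i F) = 0 :=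
  x_mul_x M (fun h => h₁ ((Set.insert_subset_insert_iff hiT).1 h))
    fun h => h₂ ((Set.insert_subset_insert_iff (Si.notMem hF)).1 h)

theorem x_compl_mul_x_insert (hF : F ∈ Si M i) : x M (M.E \ {i}) * x M (insert i F) = 0 :=
  x_mul_x_insert (fun h => h.2 rfl) hF.2.1.2

theorem mem_Si_of_ssubset (hF : F ∈ Si M i) (hT : T ⊂ F) (hne : T.Nonempty)
    (h : M.IsFlat (insert i T)) : T ∈ Si M i := by
  refine ⟨hne, hT.subset.trans_ssubset hF.2.1, ?_, h⟩
  have hinter : insert i T ∩ F = T := by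
    rw [Set.insert_inter_of_notMem (Si.notMem hF), Set.inter_eq_left.2 hT.subset]
  rw [← hinter, Set.inter_eq_iInter]
  exact Matroid.IsFlat.iInter (Bool.forall_bool.2 ⟨hF.2.2.1, h⟩)

variable [M.Finite]

theorem Si.mem_groundSubsets (hF : F ∈ Si M i) : F ∈ groundSubsets (M ＼ {i}) :=
  (MatroidChow.mem_groundSubsets _).2 (Si.subset hF)

open Classical in
theorem sum_trichotomy {A : Type*} [AddCommMonoid A] (U : Finset (Set α)) (hF : F ∈ U)
    (h : Set α → A) (h0 : ∀ T ∈ U, ¬ T ⊆ F → ¬ F ⊆ T → h T = 0) :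
    ∑ T ∈ U, h T = ∑ T ∈ U with T ⊂ F, h T + h F + ∑ T ∈ U with F ⊂ T, h T := by
  rw [← Finset.sum_filter_add_sum_filter_not U (· ⊂ F), add_assoc,
    ← Finset.add_sum_erase {T ∈ U | ¬ T ⊂ F} h
      (Finset.mem_filter.2 ⟨hF, ssubset_irrefl F⟩)]
  congr 2
  refine (Finset.sum_subset (fun T hT => ?_) fun T hT hnot => ?_).symm
  · rw [Finset.mem_filter] at hT
    have hTF : ¬ T ⊂ F := fun h => hT.2.2 h.subset
    simp [hT.1, hT.2.ne', hTF]
  · simp only [Finset.mem_erase, Finset.mem_filter, not_and] at hT hnot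
    refine h0 T hT.2.1 (fun hTF => hT.2.2 (hTF.ssubset_of_ne hT.1)) fun hFT => ?_
    exact hnot hT.2.1 (hFT.ssubset_of_ne hT.1.symm)

open Classical in
theorem linSum_mul_of_notMem (hF : F ∈ Si M i) (hi : i ∈ M.E) {j : α} (hj : j ∉ insert i F) :
    linSum M j * x M (insert i F) =
      ∑ T ∈ groundSubsets (M ＼ {i}) with F ⊂ T ∧ j ∈ T, x M (insert i T) * x M (insert i F) := by
  obtain ⟨hji, hjF⟩ := not_or.1 hj
  rw [linSum_of_ne M hi hji, Finset.sum_mul, ← Finset.filter_filter, Finset.filter_comm,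
    Finset.sum_filter (F ⊂ ·)]
  refine Finset.sum_congr rfl fun T hT => ?_
  rw [Finset.mem_filter] at hT
  have hiT := notMem_of_mem_groundSubsets_delete hT.1
  have hTF : ¬ T ⊆ F := fun h => hjF (h hT.2)
  rw [add_mul, x_mul_x_insert hiT hTF, zero_add]
  split_ifs with hFT
  · rfl
  · exact x_insert_mul_x_insert hF hiT hTF fun h => hFT ⟨h, hTF⟩

open Classical in
theorem linSum_mul_of_mem (hF : F ∈ Si M i) (hi : i ∈ M.E) {j : α} (hj : j ∈ F) :
    linSum M j * x M (insert i F) =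
      ∑ T ∈ groundSubsets (M ＼ {i}) with T ⊂ F ∧ j ∈ T,
        (x M T + x M (insert i T)) * x M (insert i F) +
      (x M F + x M (insert i F)) * x M (insert i F) +
      ∑ T ∈ groundSubsets (M ＼ {i}) with F ⊂ T, x M (insert i T) * x M (insert i F) := by
  have hji : j ≠ i := fun h => Si.notMem hF (h ▸ hj)
  rw [linSum_of_ne M hi hji, Finset.sum_mul,
    sum_trichotomy _ (Finset.mem_filter.2 ⟨Si.mem_groundSubsets hF, hj⟩)]
  · rw [Finset.filter_filter, Finset.filter_filter]
    congr 1
    · simp only [and_comm]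
    · refine Finset.sum_congr (Finset.filter_congr fun T _ => ?_) fun T hT => ?_
      · exact ⟨fun h => h.2, fun h => ⟨h.subset hj, h⟩⟩
      · rw [Finset.mem_filter] at hT
        rw [add_mul, x_mul_x_insert (notMem_of_mem_groundSubsets_delete hT.1) hT.2.2, zero_add]
  · intro T hT h₁ h₂
    have hiT := notMem_of_mem_groundSubsets_delete (Finset.mem_filter.1 hT).1
    rw [add_mul, x_mul_x_insert hiT h₁, x_insert_mul_x_insert hF hiT h₁ h₂, add_zero]

open Classical in
theorem linSum_self_mul (hF : F ∈ Si M i) (hi : i ∈ M.E) :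
    linSum M i * x M (insert i F) =
      ∑ T ∈ groundSubsets (M ＼ {i}) with T ⊂ F, x M (insert i T) * x M (insert i F) +
      x M (insert i F) * x M (insert i F) +
      ∑ T ∈ groundSubsets (M ＼ {i}) with F ⊂ T, x M (insert i T) * x M (insert i F) := by
  rw [linSum_self M hi, Finset.sum_mul, sum_trichotomy _ (Si.mem_groundSubsets hF)]
  intro T hT h₁ h₂
  exact x_insert_mul_x_insert hF (notMem_of_mem_groundSubsets_delete hT) h₁ h₂

theorem x_insert_mul_of_ssubset (hF : F ∈ Si M i) (hT : T ⊆ M.E \ {i}) (hFT : F ⊂ T) :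
    x M (insert i T) * x M (insert i F) = theta M i (x (M ＼ {i}) T) * x M (insert i F) := by
  by_cases hTE : T = M.E \ {i}
  · have hT' : ¬ IsProperFlat (M ＼ {i}) T := fun h => h.2.2 hTE
    rw [x_of_not _ hT', map_zero, hTE, x_insert_compl]
  · rw [theta_x_eq_add M hT (hF.1.mono hFT.subset) hTE, add_mul,
      x_mul_x_insert (fun h => (hT h).2 rfl) hFT.2, zero_add]

theorem x_insert_mul_of_ssuperset (hF : F ∈ Si M i) (hTF : T ⊂ F) :
    x M (insert i T) * x M (insert i F) = theta M i (x (M ＼ {i}) F) * x M (insert i T) := by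
  rw [theta_x M i ⟨F, Si.isProperFlat_delete hF⟩, add_mul, x_mul_x_insert (Si.notMem hF) hTF.2,
    zero_add, mul_comm]

theorem x_compl_mul_self (hi : i ∈ M.E) {j : α} (hj : j ∈ M.E \ {i}) :
    x M (M.E \ {i}) * x M (M.E \ {i}) =
      - (theta M i (linSum (M ＼ {i}) j) * x M (M.E \ {i})) := by
  have hlin : linSum M i * x M (M.E \ {i}) = 0 := by
    rw [linSum_self M hi, Finset.sum_mul]
    refine Finset.sum_eq_zero fun T hT => ?_
    rw [mem_groundSubsets] at hT
    by_cases hTE : T = M.E \ {i}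
    · rw [hTE, x_insert_compl, zero_mul]
    · refine x_mul_x M (fun h => (h (Set.mem_insert _ _)).2 rfl) fun h => hTE ?_
      exact hT.antisymm fun a ha => (h ha).resolve_left ha.2
  rw [linSum_congr M hi hj.1, linSum_eq_theta M hj, add_mul] at hlin
  exact eq_neg_of_add_eq_zero_right hlin

end Product

section Span

variable (M : Matroid α) [M.Finite] (i : α)

/-- The `CH(M ∖ i)`-submodule of `CH(M)` generated by `1`, `x_{E ∖ i}` and the `x_{F ∪ i}` for
`F ∈ 𝒮_i`, that is, the sum of the summands of the decomposition. -/
noncomputable def summandSpan : Submodule (CH (M ＼ {i})) (CH M) :=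
  Submodule.span (CH (M ＼ {i}))
    (insert 1 (insert (x M (M.E \ {i})) (Set.range fun F : Si M i => x M (insert i F.1))))

theorem theta_mem_summandSpan (a : CH (M ＼ {i})) : theta M i a ∈ summandSpan M i := by
  have hone : (1 : CH M) ∈ summandSpan M i := Submodule.subset_span (Or.inl rfl)
  simpa [smul_eq_theta_mul] using (summandSpan M i).smul_mem a hone

theorem x_compl_mem_summandSpan : x M (M.E \ {i}) ∈ summandSpan M i :=
  Submodule.subset_span (Or.inr (Or.inl rfl))

variable {M i} {F : Set α}

theorem x_insert_mem_summandSpan_of_mem_Si (hF : F ∈ Si M i) :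
    x M (insert i F) ∈ summandSpan M i :=
  Submodule.subset_span (Or.inr (Or.inr ⟨⟨F, hF⟩, rfl⟩))

theorem theta_mul_mem_summandSpan (a : CH (M ＼ {i})) {b : CH M} (hb : b ∈ summandSpan M i) :
    theta M i a * b ∈ summandSpan M i :=
  (summandSpan M i).smul_mem a hb

theorem x_insert_mem_summandSpan {T : Set α} (hT : T ⊆ M.E \ {i}) (hne : T.Nonempty) :
    x M (insert i T) ∈ summandSpan M i := by
  by_cases hTE : T = M.E \ {i}
  · rw [hTE, x_insert_compl]
    exact zero_mem _
  by_cases hflat : M.IsFlat (insert i T)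
  swap
  · rw [x_of_not M fun h => hflat h.1]
    exact zero_mem _
  by_cases hTf : M.IsFlat T
  · exact x_insert_mem_summandSpan_of_mem_Si ⟨hne, hT.ssubset_of_ne hTE, hTf, hflat⟩
  · have htheta := theta_x_eq_add M hT hne hTE
    rw [x_of_not M fun h => hTf h.1, zero_add] at htheta
    exact htheta ▸ theta_mem_summandSpan M i _

theorem x_singleton_mem_summandSpan (hi : i ∈ M.E) : x M {i} ∈ summandSpan M i := by
  classical
  by_cases hproper : IsProperFlat M {i}
  swap
  · rw [x_of_not M hproper]
    exact zero_mem _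
  obtain ⟨j, hj, hji⟩ :=
    Set.exists_of_ssubset (hproper.1.subset_ground.ssubset_of_ne hproper.2.2)
  have hempty : (∅ : Set α) ∈ groundSubsets (M ＼ {i}) :=
    (mem_groundSubsets _).2 (Set.empty_subset _)
  have hsum := linSum_self M hi
  rw [linSum_congr M hi hj, linSum_eq_theta M ⟨hj, hji⟩, ← Finset.add_sum_erase _ _ hempty,
    insert_empty_eq, ← sub_eq_iff_eq_add] at hsum
  rw [← hsum]
  refine sub_mem (add_mem (theta_mem_summandSpan M i _) (x_compl_mem_summandSpan M i))
    (sum_mem fun T hT => ?_)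
  rw [Finset.mem_erase, mem_groundSubsets] at hT
  exact x_insert_mem_summandSpan hT.2 (Set.nonempty_iff_ne_empty.2 hT.1)

theorem x_mem_summandSpan (hi : i ∈ M.E) (G : Set α) : x M G ∈ summandSpan M i := by
  by_cases hproper : IsProperFlat M G
  swap
  · rw [x_of_not M hproper]
    exact zero_mem _
  by_cases hiG : i ∈ G
  · have hG : insert i (G \ {i}) = G := by
      rw [Set.insert_sdiff_singleton, Set.insert_eq_of_mem hiG]
    rcases (G \ {i}).eq_empty_or_nonempty with hempty | hne
    · rw [← hG, hempty, insert_empty_eq]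
      exact x_singleton_mem_summandSpan hi
    · rw [← hG]
      exact x_insert_mem_summandSpan
        (Set.sdiff_subset_sdiff_left hproper.1.subset_ground) hne
  · have hGE : G ⊆ M.E \ {i} := Set.subset_sdiff_singleton hproper.1.subset_ground hiG
    by_cases hG : G = M.E \ {i}
    · rw [hG]
      exact x_compl_mem_summandSpan M i
    · rw [eq_sub_of_add_eq (theta_x_eq_add M hGE hproper.2.1 hG).symm]
      exact sub_mem (theta_mem_summandSpan M i _)
        (x_insert_mem_summandSpan hGE hproper.2.1)

theorem x_compl_mul_self_mem_summandSpan (hi : i ∈ M.E) :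
    x M (M.E \ {i}) * x M (M.E \ {i}) ∈ summandSpan M i := by
  rcases (M.E \ {i}).eq_empty_or_nonempty with h | ⟨j, hj⟩
  · rw [x_of_not M fun h' => h'.2.1.ne_empty h, mul_zero]
    exact zero_mem _
  · rw [x_compl_mul_self hi hj]
    exact neg_mem (theta_mul_mem_summandSpan _ (x_compl_mem_summandSpan M i))

/- The square is found by multiplying `x_{F ∪ i}` by the two sides of the relation
`∑_{i ∈ S} x_S = ∑_{l ∈ S} x_S` for some `l ∉ F ∪ i`. -/
theorem x_insert_mul_self_mem_summandSpan (hi : i ∈ M.E) (hF : F ∈ Si M i) :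
    x M (insert i F) * x M (insert i F) ∈ summandSpan M i := by
  classical
  obtain ⟨l, hl, hlF⟩ := Si.exists_notMem hF
  have hsum := linSum_self_mul hF hi
  rw [linSum_congr M hi hl, linSum_mul_of_notMem hF hi hlF, ← sub_eq_iff_eq_add,
    ← sub_eq_iff_eq_add'] at hsum
  have habove {T : Set α} (hT : T ∈ groundSubsets (M ＼ {i})) (hFT : F ⊂ T) :
      x M (insert i T) * x M (insert i F) ∈ summandSpan M i := by
    rw [x_insert_mul_of_ssubset hF ((mem_groundSubsets _).1 hT) hFT]
    exact theta_mul_mem_summandSpan _ (x_insert_mem_summandSpan_of_mem_Si hF)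
  have hbelow {T : Set α} (hTF : T ⊂ F) :
      x M (insert i T) * x M (insert i F) ∈ summandSpan M i := by
    rw [x_insert_mul_of_ssuperset hF hTF]
    exact theta_mul_mem_summandSpan _ (x_mem_summandSpan hi _)
  rw [← hsum]
  refine sub_mem (sub_mem (sum_mem fun T hT => ?_) (sum_mem fun T hT => ?_))
    (sum_mem fun T hT => ?_) <;> rw [Finset.mem_filter] at hT
  · exact habove hT.1 hT.2.1
  · exact habove hT.1 hT.2
  · exact hbelow hT.2

theorem x_insert_mul_x_insert_mem_summandSpan (hi : i ∈ M.E) {F' : Set α} (hF : F ∈ Si M i)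
    (hF' : F' ∈ Si M i) : x M (insert i F) * x M (insert i F') ∈ summandSpan M i := by
  have hnested {F F' : Set α} (hF : F ∈ Si M i) (hF' : F' ∈ Si M i) (h : F ⊂ F') :
      x M (insert i F') * x M (insert i F) ∈ summandSpan M i := by
    rw [x_insert_mul_of_ssubset hF (Si.subset hF') h]
    exact theta_mul_mem_summandSpan _ (x_insert_mem_summandSpan_of_mem_Si hF)
  by_cases h : F ⊆ F'
  · obtain rfl | hss := h.eq_or_ssubset
    · exact x_insert_mul_self_mem_summandSpan hi hF
    · exact mul_comm (x M (insert i F)) _ ▸ hnested hF hF' hss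
  by_cases h' : F' ⊆ F
  · exact hnested hF' hF ⟨h', h⟩
  · rw [x_insert_mul_x_insert hF' (Si.notMem hF) h h']
    exact zero_mem _

theorem mul_mem_summandSpan (hi : i ∈ M.E) {a b : CH M} (ha : a ∈ summandSpan M i)
    (hb : b ∈ summandSpan M i) : a * b ∈ summandSpan M i := by
  suffices h : summandSpan M i * summandSpan M i ≤ summandSpan M i from
    h (Submodule.mul_mem_mul ha hb)
  conv_lhs => rw [summandSpan, Submodule.span_mul_span]
  rw [Submodule.span_le]
  rintro _ ⟨a, ha, b, hb, rfl⟩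
  rw [SetLike.mem_coe]
  dsimp only
  obtain rfl | ha := ha
  · rw [one_mul]
    exact Submodule.subset_span hb
  obtain rfl | hb := hb
  · rw [mul_one]
    exact Submodule.subset_span (Or.inr ha)
  obtain rfl | ⟨F, rfl⟩ := ha <;> obtain rfl | ⟨F', rfl⟩ := hb
  · exact x_compl_mul_self_mem_summandSpan hi
  · rw [x_compl_mul_x_insert F'.2]
    exact zero_mem _
  · rw [mul_comm, x_compl_mul_x_insert F.2]
    exact zero_mem _
  · exact x_insert_mul_x_insert_mem_summandSpan hi F.2 F'.2

theorem summandSpan_eq_top (hi : i ∈ M.E) : summandSpan M i = ⊤ := by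
  rw [eq_top_iff]
  rintro a -
  have ha : a ∈ Algebra.adjoin ℚ (Set.range (x M)) := adjoin_x M ▸ Algebra.mem_top
  induction ha using Algebra.adjoin_induction with
  | mem a ha =>
    obtain ⟨S, rfl⟩ := ha
    exact x_mem_summandSpan hi S
  | algebraMap c =>
    rw [← (theta M i).commutes]
    exact theta_mem_summandSpan M i _
  | add a b _ _ ha hb => exact add_mem ha hb
  | mul a b _ _ ha hb => exact mul_mem_summandSpan hi ha hb

theorem exists_decomposition [Fintype (Si M i)] (hi : i ∈ M.E) (y : CH M) :
    ∃ (a b : CH (M ＼ {i})) (c : Si M i → CH (M ＼ {i})),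
      y = theta M i a + x M (M.E \ {i}) * theta M i b +
        ∑ F, x M (insert i F.1) * theta M i (c F) := by
  have hy : y ∈ summandSpan M i := summandSpan_eq_top hi ▸ Submodule.mem_top
  obtain ⟨a, z, hz, rfl⟩ := Submodule.mem_span_insert.1 hy
  obtain ⟨b, w, hw, rfl⟩ := Submodule.mem_span_insert.1 hz
  obtain ⟨c, rfl⟩ := (Submodule.mem_span_range_iff_exists_fun _).1 hw
  refine ⟨a, b, c, ?_⟩
  simp only [smul_eq_theta_mul, mul_one, mul_comm (x M _), add_assoc]

end Span

/-! ### The summand of a flat in `𝒮_i` -/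

section AnnQuot

variable (M : Matroid α) (K : Set α)

/-- The quotient of the Chow ring by the annihilator of `x_K`; it is isomorphic to the principal
ideal of `x_K` through `mulX`, and it carries the ring structure of the summand `x_K · CH_(i)`. -/
abbrev AnnQuot : Type u := CH M ⧸ Ideal.torsionOf (CH M) (CH M) (x M K)

/-- The quotient map `CH(M) → CH(M) / Ann(x_K)`. -/
noncomputable def toAnnQuot : CH M →ₐ[ℚ] AnnQuot M K := Ideal.Quotient.mkₐ ℚ _

/-- Multiplication by `x_K`, as a map `CH(M) / Ann(x_K) → CH(M)`. -/
noncomputable def mulX : AnnQuot M K →ₗ[CH M] CH M :=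
  Submodule.liftQ _ (LinearMap.toSpanSingleton (CH M) (CH M) (x M K)) le_rfl

theorem mulX_toAnnQuot (a : CH M) : mulX M K (toAnnQuot M K a) = a * x M K := rfl

theorem mulX_injective : Function.Injective (mulX M K) := by
  rw [← LinearMap.ker_eq_bot]
  exact Submodule.ker_liftQ_eq_bot _ _ _ le_rfl

theorem toAnnQuot_surjective : Function.Surjective (toAnnQuot M K) :=
  Ideal.Quotient.mkₐ_surjective ℚ _

theorem mulX_toAnnQuot_mul (a : CH M) (q : AnnQuot M K) :
    mulX M K (toAnnQuot M K a * q) = a * mulX M K q := by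
  obtain ⟨b, rfl⟩ := toAnnQuot_surjective M K q
  rw [← map_mul, mulX_toAnnQuot, mulX_toAnnQuot, mul_assoc]

end AnnQuot

section AlphaBeta

variable (M : Matroid α) [M.Finite]

open Classical in
theorem finsum_x_eq_sum (p : Set α → Prop) :
    ∑ᶠ (G : PFlat M) (_ : p G.1), x M G.1 = ∑ S ∈ groundSubsets M with p S, x M S := by
  have := finite_pflat M
  have : Fintype (PFlat M) := Fintype.ofFinite _
  rw [finsum_eq_sum_of_fintype, Finset.sum_filter]
  refine Finset.sum_of_injOn (fun G => G.1) Subtype.val_injective.injOn (fun G _ => ?_)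
    (fun S _ hS => ?_) fun G _ => finsum_eq_if
  · exact (mem_groundSubsets M).2 G.2.1.subset_ground
  · rw [x_of_not M fun h => hS ⟨⟨S, h⟩, Finset.mem_coe.2 (Finset.mem_univ _), rfl⟩, ite_self]

theorem alphaAt_eq_linSum (j : α) : alphaAt M j = linSum M j := by
  classical
  rw [linSum, alphaAt]
  convert finsum_x_eq_sum M (j ∈ ·)

open Classical in
theorem betaAt_eq_sum (j : α) :
    betaAt M j = ∑ S ∈ groundSubsets M with j ∉ S, x M S := by
  rw [betaAt]
  convert finsum_x_eq_sum M (j ∉ ·)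

end AlphaBeta

theorem finite_restrict {M : Matroid α} [M.Finite] {F : Set α} (hF : F ⊆ M.E) :
    (M ↾ F).Finite :=
  ⟨M.ground_finite.subset hF⟩

section Classes

variable (M : Matroid α) (i : α) (F : Set α)

open Classical in
/-- The image of `x_S` under `CH(M_{F ∪ i}) → CH(M) / Ann(x_{F ∪ i})`. -/
noncomputable def aboveClass (S : Set α) : AnnQuot M (insert i F) :=
  if IsProperFlat (M ／ insert i F) S then toAnnQuot M _ (x M (S ∪ insert i F)) else 0

open Classical in
/-- The image of `x_S` under `CH(M^F) → CH(M) / Ann(x_{F ∪ i})`. -/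
noncomputable def belowClass (S : Set α) : AnnQuot M (insert i F) :=
  if IsProperFlat (M ↾ F) S then toAnnQuot M _ (x M S + x M (insert i S)) else 0

end Classes

section Lambda

variable {M : Matroid α} {i : α} {F S : Set α}

theorem mulX_aboveClass (hF : F ∈ Si M i) (hS : Disjoint S (insert i F)) (hne : S.Nonempty) :
    mulX M (insert i F) (aboveClass M i F S) = x M (insert i (S ∪ F)) * x M (insert i F) := by
  rw [aboveClass, ← Set.union_insert]
  split_ifs with h
  · rw [mulX_toAnnQuot]
  · have hx : x M (S ∪ insert i F) = 0 := x_of_not M fun hPF => h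
      ((isProperFlat_contract_iff hF.2.2.2.subset_ground).2 ⟨hPF, hS, hne⟩)
    rw [hx, zero_mul, map_zero]

theorem mulX_belowClass (hF : F ∈ Si M i) (hS : S ⊂ F) (hne : S.Nonempty) :
    mulX M (insert i F) (belowClass M i F S) =
      (x M S + x M (insert i S)) * x M (insert i F) := by
  rw [belowClass]
  split_ifs with h
  · rw [mulX_toAnnQuot]
  · rw [isProperFlat_restrict_iff (Si.isProperFlat hF), and_iff_left hS] at h
    have hx : x M S = 0 := x_of_not M h
    have hxi : x M (insert i S) = 0 := x_of_not M fun hi =>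
      h (Si.isProperFlat (mem_Si_of_ssubset hF hS hne hi.1))
    rw [hx, hxi, add_zero, zero_mul, map_zero]

theorem x_add_x_insert_mul_x_add_x_insert {S T : Set α} (hiS : i ∉ S) (hiT : i ∉ T)
    (hST : ¬ S ⊆ T) (hTS : ¬ T ⊆ S) :
    (x M S + x M (insert i S)) * (x M T + x M (insert i T)) = 0 := by
  have hST' : ¬ S ⊆ insert i T := fun h => hST ((Set.subset_insert_iff_of_notMem hiS).1 h)
  have hTS' : ¬ T ⊆ insert i S := fun h => hTS ((Set.subset_insert_iff_of_notMem hiT).1 h)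
  have hsub : ∀ U : Set α, U ⊆ insert i U := Set.subset_insert i
  rw [add_mul, mul_add, mul_add, x_mul_x M hST hTS,
    x_mul_x M hST' fun h => hTS ((hsub T).trans h),
    x_mul_x M (fun h => hST ((hsub S).trans h)) hTS',
    x_mul_x M (fun h => hST' ((hsub S).trans h)) fun h => hTS' ((hsub T).trans h)]
  simp only [add_zero]

theorem aboveClass_mul_aboveClass {S T : Set α} (hF : F ∈ Si M i) (hST : ¬ S ⊆ T)
    (hTS : ¬ T ⊆ S) : aboveClass M i F S * aboveClass M i F T = 0 := by
  classical
  rw [aboveClass, aboveClass, ite_zero_mul_ite_zero]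
  refine ite_eq_right_iff.2 fun ⟨hS, hT⟩ => ?_
  have hdisj : ∀ {S}, IsProperFlat (M ／ insert i F) S → Disjoint S (insert i F) := fun h =>
    ((isProperFlat_contract_iff hF.2.2.2.subset_ground).1 h).2.1
  rw [← map_mul, x_mul_x, map_zero]
  · exact fun h => hST fun a ha =>
      (h (Or.inl ha)).resolve_right (Set.disjoint_left.1 (hdisj hS) ha)
  · exact fun h => hTS fun a ha =>
      (h (Or.inl ha)).resolve_right (Set.disjoint_left.1 (hdisj hT) ha)

theorem belowClass_mul_belowClass {S T : Set α} (hF : F ∈ Si M i) (hST : ¬ S ⊆ T)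
    (hTS : ¬ T ⊆ S) : belowClass M i F S * belowClass M i F T = 0 := by
  classical
  rw [belowClass, belowClass, ite_zero_mul_ite_zero]
  refine ite_eq_right_iff.2 fun ⟨hS, hT⟩ => ?_
  have hi : ∀ {S}, IsProperFlat (M ↾ F) S → i ∉ S := fun h hiS =>
    Si.notMem hF (h.1.subset_ground hiS)
  rw [← map_mul, x_add_x_insert_mul_x_add_x_insert (hi hS) (hi hT) hST hTS, map_zero]

variable [M.Finite]

open Classical in
theorem sum_mulX_aboveClass (hF : F ∈ Si M i) (p q : Set α → Prop)
    (hpq : ∀ S ⊆ M.E \ insert i F, (p S ↔ q (S ∪ F))) :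
    ∑ S ∈ groundSubsets (M ／ insert i F) with p S,
      mulX M (insert i F) (aboveClass M i F S) =
    ∑ T ∈ groundSubsets (M ＼ {i}) with F ⊂ T ∧ q T,
      x M (insert i T) * x M (insert i F) := by
  have hempty : aboveClass M i F ∅ = 0 := if_neg fun h => Set.not_nonempty_empty h.2.1
  rw [← Finset.sum_filter_of_ne (p := Set.Nonempty) fun S _ hS =>
    Set.nonempty_iff_ne_empty.2 fun h => hS (by rw [h, hempty, map_zero])]
  have hdisj : ∀ S ⊆ M.E \ insert i F, Disjoint S (insert i F) :=
    fun S hS => (Set.subset_sdiff.1 hS).2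
  have hcancel : ∀ S ⊆ M.E \ insert i F, (S ∪ F) \ F = S := fun S hS => by
    rw [Set.union_sdiff_right, ((hdisj S hS).mono_right (Set.subset_insert _ _)).sdiff_eq_left]
  have hsub : ∀ T ⊆ M.E \ {i}, T \ F ⊆ M.E \ insert i F := fun T hT a ha =>
    ⟨(hT ha.1).1, fun h => h.elim (hT ha.1).2 ha.2⟩
  refine Finset.sum_nbij' (· ∪ F) (· \ F) (fun S hS => ?_) (fun T hT => ?_) (fun S hS => ?_)
    (fun T hT => ?_) fun S hS => ?_
  all_goals simp only [Finset.mem_filter, mem_groundSubsets, Matroid.contract_ground,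
    Matroid.delete_ground] at *
  · obtain ⟨⟨hSE, hp⟩, a, ha⟩ := hS
    refine ⟨Set.union_subset (hSE.trans ?_) (Si.subset hF),
      ⟨Set.subset_union_right, fun h => (hSE ha).2 (Or.inr (h (Or.inl ha)))⟩, (hpq S hSE).1 hp⟩
    exact Set.sdiff_subset_sdiff_right (Set.singleton_subset_iff.2 (Set.mem_insert _ _))
  · obtain ⟨hTE, hFT, hq⟩ := hT
    refine ⟨⟨hsub T hTE, (hpq _ (hsub T hTE)).2 ?_⟩, Set.nonempty_of_ssubset hFT⟩
    rwa [Set.sdiff_union_of_subset hFT.subset]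
  · exact hcancel S hS.1.1
  · exact Set.sdiff_union_of_subset hT.2.1.subset
  · exact mulX_aboveClass hF (hdisj S hS.1.1) hS.2

open Classical in
theorem sum_mulX_belowClass [(M ↾ F).Finite] (hF : F ∈ Si M i) (j : α) :
    ∑ S ∈ groundSubsets (M ↾ F) with j ∈ S, mulX M (insert i F) (belowClass M i F S) =
    ∑ T ∈ groundSubsets (M ＼ {i}) with T ⊂ F ∧ j ∈ T,
      (x M T + x M (insert i T)) * x M (insert i F) := by
  have hself : belowClass M i F F = 0 := if_neg fun h => h.2.2 rfl
  rw [← Finset.sum_filter_of_ne (p := (· ⊂ F)) fun S hS hne => by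
    refine ((mem_groundSubsets (M ↾ F)).1 (Finset.mem_filter.1 hS).1).ssubset_of_ne fun h => ?_
    rw [show S = F from h, hself, map_zero] at hne
    exact hne rfl]
  refine Finset.sum_congr (Finset.ext fun S => ?_) fun S hS => ?_
  all_goals simp only [Finset.mem_filter, mem_groundSubsets, Matroid.delete_ground,
    Matroid.restrict_ground_eq] at *
  · exact ⟨fun h => ⟨h.1.1.trans (Si.subset hF), h.2, h.1.2⟩,
      fun h => ⟨⟨h.2.1.subset, h.2.2⟩, h.2.1⟩⟩
  · exact mulX_belowClass hF hS.2.1 ⟨j, hS.2.2⟩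

theorem aboveClass_mem_balanced (hi : i ∈ M.E) (hF : F ∈ Si M i) :
    aboveClass M i F ∈ balanced (M ／ insert i F) (AnnQuot M (insert i F)) := by
  classical
  refine ⟨fun S hS => if_neg hS, fun j hj l hl => mulX_injective M _ ?_⟩
  have hlin : ∀ j ∈ M.E \ insert i F, mulX M (insert i F)
      (∑ S ∈ groundSubsets (M ／ insert i F) with j ∈ S, aboveClass M i F S) =
        linSum M j * x M (insert i F) := fun j hj => by
    rw [map_sum, linSum_mul_of_notMem hF hi hj.2]
    exact sum_mulX_aboveClass hF _ _ fun S _ =>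
      ⟨Or.inl, fun h => h.resolve_right fun h => hj.2 (Or.inr h)⟩
  rw [hlin j hj, hlin l hl, linSum_congr M hj.1 hl.1]

theorem belowClass_mem_balanced [(M ↾ F).Finite] (hi : i ∈ M.E) (hF : F ∈ Si M i) :
    belowClass M i F ∈ balanced (M ↾ F) (AnnQuot M (insert i F)) := by
  classical
  refine ⟨fun S hS => if_neg hS, fun j (hj : j ∈ F) l (hl : l ∈ F) => mulX_injective M _ ?_⟩
  rw [map_sum, map_sum, sum_mulX_belowClass hF, sum_mulX_belowClass hF]
  have hlin := congrArg (· * x M (insert i F))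
    (linSum_congr M (Si.subset hF hj).1 (Si.subset hF hl).1)
  simp only [linSum_mul_of_mem hF hi hj, linSum_mul_of_mem hF hi hl] at hlin
  exact add_right_cancel (add_right_cancel hlin)

/-- The homomorphism `CH(M_{F ∪ i}) → CH(M) / Ann(x_{F ∪ i})`, `x_S ↦ x_{S ∪ F ∪ i}`. -/
noncomputable def lambdaAbove (hi : i ∈ M.E) (hF : F ∈ Si M i) :
    CH (M ／ insert i F) →ₐ[ℚ] AnnQuot M (insert i F) :=
  liftCH (aboveClass M i F) (fun _ _ => aboveClass_mul_aboveClass hF)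
    (aboveClass_mem_balanced hi hF)

/-- The homomorphism `CH(M^F) → CH(M) / Ann(x_{F ∪ i})`, `x_S ↦ x_S + x_{S ∪ i}`. -/
noncomputable def lambdaBelow (hi : i ∈ M.E) (hF : F ∈ Si M i) :
    CH (M ↾ F) →ₐ[ℚ] AnnQuot M (insert i F) :=
  haveI := finite_restrict (Si.isProperFlat hF).1.subset_ground
  liftCH (belowClass M i F) (fun _ _ => belowClass_mul_belowClass hF)
    (belowClass_mem_balanced hi hF)

theorem lambdaAbove_x (hi : i ∈ M.E) (hF : F ∈ Si M i) (S : Set α) :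
    lambdaAbove hi hF (x _ S) = aboveClass M i F S :=
  liftCH_x _ _ _ S

theorem lambdaBelow_x (hi : i ∈ M.E) (hF : F ∈ Si M i) (S : Set α) :
    lambdaBelow hi hF (x _ S) = belowClass M i F S :=
  haveI := finite_restrict (Si.isProperFlat hF).1.subset_ground
  liftCH_x _ _ _ S

theorem toAnnQuot_theta_incomparable (hF : F ∈ Si M i) {G : Set α}
    (hG : IsProperFlat (M ＼ {i}) G) (hGF : ¬ G ⊆ F) (hFG : ¬ F ⊆ G) :
    toAnnQuot M (insert i F) (theta M i (x _ G)) = 0 := by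
  have hiG : i ∉ G := fun h => (hG.1.subset_ground h).2 rfl
  apply mulX_injective
  rw [mulX_toAnnQuot, map_zero, theta_x M i ⟨G, hG⟩, add_mul, x_mul_x_insert hiG hGF,
    x_insert_mul_x_insert hF hiG hGF hFG, add_zero]

theorem toAnnQuot_theta_below (hF : F ∈ Si M i) {G : Set α} (hG : IsProperFlat (M ＼ {i}) G)
    (hGF : G ⊂ F) : toAnnQuot M (insert i F) (theta M i (x _ G)) = belowClass M i F G := by
  apply mulX_injective
  rw [mulX_belowClass hF hGF hG.2.1, mulX_toAnnQuot, theta_x M i ⟨G, hG⟩]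

theorem toAnnQuot_theta_above (hF : F ∈ Si M i) {G : Set α} (hG : IsProperFlat (M ＼ {i}) G)
    (hFG : F ⊂ G) :
    toAnnQuot M (insert i F) (theta M i (x _ G)) = aboveClass M i F (G \ F) := by
  have hiG : i ∉ G := fun h => (hG.1.subset_ground h).2 rfl
  have hdisj : Disjoint (G \ F) (insert i F) :=
    Set.disjoint_insert_right.2 ⟨fun h => hiG h.1, Set.disjoint_sdiff_left⟩
  apply mulX_injective
  rw [mulX_aboveClass hF hdisj (Set.nonempty_of_ssubset hFG), mulX_toAnnQuot,
    theta_x M i ⟨G, hG⟩, add_mul, x_mul_x_insert hiG hFG.2, zero_add,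
    Set.sdiff_union_of_subset hFG.subset]

theorem toAnnQuot_theta_self (hi : i ∈ M.E) (hF : F ∈ Si M i) {j l : α}
    (hj : j ∈ F) (hl : l ∈ M.E \ insert i F) :
    toAnnQuot M (insert i F) (theta M i (x _ F)) =
      - lambdaBelow hi hF (alphaAt (M ↾ F) j) -
        lambdaAbove hi hF (betaAt (M ／ insert i F) l) := by
  classical
  have := finite_restrict (Si.isProperFlat hF).1.subset_ground
  apply mulX_injective
  have hbelow : mulX M (insert i F) (lambdaBelow hi hF (alphaAt (M ↾ F) j)) =
      ∑ T ∈ groundSubsets (M ＼ {i}) with T ⊂ F ∧ j ∈ T,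
        (x M T + x M (insert i T)) * x M (insert i F) := by
    simp_rw [alphaAt_eq_linSum, linSum, map_sum, lambdaBelow_x]
    convert sum_mulX_belowClass hF j
  have habove : mulX M (insert i F) (lambdaAbove hi hF (betaAt (M ／ insert i F) l)) =
      ∑ T ∈ groundSubsets (M ＼ {i}) with F ⊂ T ∧ l ∉ T,
        x M (insert i T) * x M (insert i F) := by
    simp_rw [betaAt_eq_sum, map_sum, lambdaAbove_x]
    convert sum_mulX_aboveClass hF (l ∉ ·) (l ∉ ·) fun S _ => not_congr
      ⟨Or.inl, fun h => h.resolve_right fun h => hl.2 (Or.inr h)⟩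
  have hlin := congrArg (· * x M (insert i F)) (linSum_congr M (Si.subset hF hj).1 hl.1)
  have hsplit := Finset.sum_filter_add_sum_filter_not
    {T ∈ groundSubsets (M ＼ {i}) | F ⊂ T} (l ∈ ·)
    fun T => x M (insert i T) * x M (insert i F)
  simp only [linSum_mul_of_mem hF hi hj, linSum_mul_of_notMem hF hi hl.2] at hlin
  rw [Finset.filter_filter, Finset.filter_filter] at hsplit
  rw [map_sub, map_neg, hbelow, habove, mulX_toAnnQuot, theta_x M i ⟨F, Si.isProperFlat_delete hF⟩]
  linear_combination hlin + hsplit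

end Lambda

/-! ### The isomorphism of a summand with a tensor product -/

theorem mem_imTheta (M : Matroid α) [M.Finite] {i : α} {y : CH M} :
    y ∈ imTheta M i ↔ ∃ a, y = theta M i a :=
  ⟨fun ⟨a, ha⟩ => ⟨a, ha.symm⟩, fun ⟨a, ha⟩ => ⟨a, ha.symm⟩⟩

theorem mem_xImTheta (M : Matroid α) [M.Finite] {i : α} {S : Set α} {y : CH M} :
    y ∈ xImTheta M i S ↔ ∃ a, y = x M S * theta M i a := by
  constructor
  · rintro ⟨_, ⟨a, rfl⟩, rfl⟩
    exact ⟨a, rfl⟩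
  · rintro ⟨a, rfl⟩
    exact ⟨_, ⟨a, rfl⟩, rfl⟩

theorem theta_mem_gr (M : Matroid α) [M.Finite] {i : α} {k : ℕ} {a : CH (M ＼ {i})}
    (ha : a ∈ gr (M ＼ {i}) k) : theta M i a ∈ gr M k := by
  refine map_mem_of_mem_gr (theta M i) (gr M) (one_mem_gr M) (fun k a b ha hb => ?_)
    (fun G => ?_) ha
  · rw [add_comm]
    exact mul_mem_gr ha hb
  · rw [theta_x M i G]
    exact add_mem (x_mem_gr M _) (x_mem_gr M _)

theorem exists_shift {M : Matroid α} {V : Type*} [AddCommGroup V] (f : V →+ CH M)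
    (s : ℕ) (c : ℕ →₀ V) : ∃ d : ℕ →₀ CH M, (∀ j, d (j + s) = f (c j)) ∧
      (∀ m, (∀ j, j + s ≠ m) → d m = 0) ∧ (d.sum fun _ b => b) = f (c.sum fun _ b => b) := by
  refine ⟨(c.mapRange f f.map_zero).embDomain (addRightEmbedding s), fun j => ?_,
    fun m hm => Finsupp.embDomain_of_notMem_range _ _ _ fun ⟨j, hj⟩ => hm j hj, ?_⟩
  · have := Finsupp.embDomain_apply_self (addRightEmbedding s) (c.mapRange f f.map_zero) j
    simpa using this
  · rw [Finsupp.sum_embDomain, Finsupp.sum_mapRange_index fun _ => rfl, Finsupp.sum, Finsupp.sum,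
      map_sum]

theorem sum_eq_component (M : Matroid α) [M.Finite] {V : Type*} [AddCommGroup V] {f : V →+ CH M}
    (hf : Function.Injective f) {s : ℕ} {c : ℕ →₀ V} (hc : ∀ j, f (c j) ∈ gr M (j + s)) {k : ℕ}
    (h : f (c.sum fun _ b => b) ∈ gr M (k + s)) : (c.sum fun _ b => b) = c k := by
  obtain ⟨d, hd, hd0, hsum⟩ := exists_shift f s c
  have hz : ∀ j, j ≠ k → c j = 0 := fun j hj => by
    apply hf
    rw [← hd, map_zero]
    refine eq_zero_of_sum_mem_gr (fun m => ?_) (hsum ▸ h) (by omega : j + s ≠ k + s)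
    by_cases hm : ∃ j, j + s = m
    · obtain ⟨j, rfl⟩ := hm
      rw [hd]
      exact hc j
    · rw [hd0 m fun j hj => hm ⟨j, hj⟩]
      exact zero_mem _
  rw [Finsupp.sum, Finset.sum_eq_single k (fun j _ hj => hz j hj)]
  exact Finsupp.notMem_support_iff.1

theorem mul_prod_congr {ι A : Type*} [CommRing A] {s : Finset ι} {a : A} {f g : ι → A}
    (h : ∀ S ∈ s, a * f S = a * g S) : a * ∏ S ∈ s, f S = a * ∏ S ∈ s, g S := by
  classical
  induction s using Finset.induction_on with
  | empty => rfl
  | insert S s hS ih =>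
    have ih := ih fun T hT => h T (Finset.mem_insert_of_mem hT)
    have hfg := h S (Finset.mem_insert_self _ _)
    rw [Finset.prod_insert hS, Finset.prod_insert hS]
    linear_combination f S * ih + (∏ S ∈ s, g S) * hfg

theorem IsDeg.apply_xs {M : Matroid α} {D : CH M →ₗ[ℚ] ℚ} (hD : IsDeg M D)
    {s : Finset (Set α)} (hs : IsFlag M s) : D (xs M s) = if s.card = topDeg M then 1 else 0 := by
  split_ifs with h
  · exact hD.flag _ hs h
  · exact hD.eq_zero _ h _ (xs_mem_gr s)

theorem xs_ne_zero {M : Matroid α} [M.Finite] [M.Loopless] {s : Finset (Set α)}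
    (hs : IsFlag M s) : xs M s ≠ 0 := by
  obtain ⟨t, hst, ht, hc⟩ := hs.exists_complete
  obtain ⟨D, hD⟩ := exists_isDeg M
  intro h
  have htop := hD.flag t ht hc
  rw [xs, ← Finset.prod_sdiff hst, ← xs, ← xs, h, mul_zero, map_zero] at htop
  exact zero_ne_one htop

theorem x_ne_zero {M : Matroid α} [M.Finite] [M.Loopless] {S : Set α} (hS : IsProperFlat M S) :
    x M S ≠ 0 := by
  classical
  have h := xs_ne_zero (isFlag_insert_iff.2 ⟨hS, isFlag_empty M, by simp⟩)
  simpa [xs] using h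

section JoinFlag

variable {M : Matroid α} {i : α} {F : Set α}

variable (i F) in
open Classical in
/-- The flag of `M` composed of a flag `s` of `M_{F ∪ i}`, a flag `t` of `M^F`, and the flats
`F` and `F ∪ i`. -/
noncomputable def joinFlag (s t : Finset (Set α)) : Finset (Set α) :=
  insert F (insert (insert i F) (s.image (· ∪ insert i F) ∪ t))

variable {s t : Finset (Set α)}

theorem union_injOn_flag (hF : F ∈ Si M i) (hs : IsFlag (M ／ insert i F) s) :
    Set.InjOn (· ∪ insert i F) (s : Set (Set α)) := by
  intro S hS T hT h
  have hdisj : ∀ S ∈ s, Disjoint S (insert i F) := fun S hS =>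
    ((isProperFlat_contract_iff (Si.isProperFlat_insert hF).1.subset_ground).1
      (hs.isProperFlat S hS)).2.1
  have hdiff := congrArg (· \ insert i F) h
  simpa only [Set.union_sdiff_right, (hdisj S hS).sdiff_eq_left,
    (hdisj T hT).sdiff_eq_left] using hdiff

theorem ssubset_of_mem_flag_restrict (hF : F ∈ Si M i) (ht : IsFlag (M ↾ F) t) {S : Set α}
    (hS : S ∈ t) : IsProperFlat M S ∧ S ⊂ F :=
  (isProperFlat_restrict_iff (Si.isProperFlat hF)).1 (ht.isProperFlat S hS)

theorem ssubset_union_of_mem_flag_contract (hF : F ∈ Si M i) (hs : IsFlag (M ／ insert i F) s)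
    {S : Set α} (hS : S ∈ s) : IsProperFlat M (S ∪ insert i F) ∧ insert i F ⊂ S ∪ insert i F := by
  obtain ⟨hPF, hdisj, a, ha⟩ :=
    (isProperFlat_contract_iff (Si.isProperFlat_insert hF).1.subset_ground).1 (hs.isProperFlat S hS)
  exact ⟨hPF, Set.subset_union_right, fun h => Set.disjoint_left.1 hdisj ha (h (Or.inl ha))⟩

theorem isFlag_joinFlag (hF : F ∈ Si M i) (hs : IsFlag (M ／ insert i F) s)
    (ht : IsFlag (M ↾ F) t) : IsFlag M (joinFlag i F s t) := by
  classical
  have ht' := fun S hS => ssubset_of_mem_flag_restrict hF ht (S := S) hS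
  have hs' := fun S hS => ssubset_union_of_mem_flag_contract hF hs (S := S) hS
  have hFK : F ⊆ insert i F := Set.subset_insert _ _
  rw [joinFlag, isFlag_insert_iff, isFlag_insert_iff]
  refine ⟨Si.isProperFlat hF, ⟨Si.isProperFlat_insert hF, ⟨?_, ?_⟩, ?_⟩, ?_⟩
  · intro S hS
    rw [Finset.mem_union, Finset.mem_image] at hS
    obtain ⟨T, hT, rfl⟩ | hS := hS
    · exact (hs' T hT).1
    · exact (ht' S hS).1
  · intro S hS T hT _
    rw [Finset.mem_coe, Finset.mem_union, Finset.mem_image] at hS hT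
    obtain ⟨S, hS, rfl⟩ | hS := hS <;> obtain ⟨T, hT, rfl⟩ | hT := hT
    · exact (hs.subset_or_subset hS hT).imp (Set.union_subset_union_left _)
        (Set.union_subset_union_left _)
    · exact Or.inr ((ht' T hT).2.subset.trans (hFK.trans (hs' S hS).2.subset))
    · exact Or.inl ((ht' S hS).2.subset.trans (hFK.trans (hs' T hT).2.subset))
    · exact ht.subset_or_subset hS hT
  · intro S hS
    rw [Finset.mem_union, Finset.mem_image] at hS
    obtain ⟨S, hS, rfl⟩ | hS := hS
    · exact Or.inr (hs' S hS).2.subset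
    · exact Or.inl ((ht' S hS).2.subset.trans hFK)
  · intro S hS
    rw [Finset.mem_insert, Finset.mem_union, Finset.mem_image] at hS
    obtain rfl | ⟨S, hS, rfl⟩ | hS := hS
    · exact Or.inr hFK
    · exact Or.inr (hFK.trans (hs' S hS).2.subset)
    · exact Or.inl (ht' S hS).2.subset

theorem prod_joinFlag (hF : F ∈ Si M i) (hs : IsFlag (M ／ insert i F) s)
    (ht : IsFlag (M ↾ F) t) {A : Type*} [CommMonoid A] (f : Set α → A) :
    ∏ S ∈ joinFlag i F s t, f S =
      f F * (f (insert i F) * ((∏ S ∈ s, f (S ∪ insert i F)) * ∏ S ∈ t, f S)) := by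
  classical
  have ht' := fun S hS => ssubset_of_mem_flag_restrict hF ht (S := S) hS
  have hs' := fun S hS => ssubset_union_of_mem_flag_contract hF hs (S := S) hS
  have hiF := Si.notMem hF
  have hdis : Disjoint (s.image (· ∪ insert i F)) t := by
    rw [Finset.disjoint_left]
    intro S hS hS'
    obtain ⟨T, -, rfl⟩ := Finset.mem_image.1 hS
    exact hiF ((ht' _ hS').2.subset (Or.inr (Set.mem_insert _ _)))
  rw [joinFlag, Finset.prod_insert, Finset.prod_insert, Finset.prod_union hdis,
    Finset.prod_image (union_injOn_flag hF hs)]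
  · rw [Finset.mem_union, Finset.mem_image]
    rintro (⟨T, hT, h⟩ | h)
    · exact (hs' T hT).2.ne h.symm
    · exact hiF ((ht' _ h).2.subset (Set.mem_insert _ _))
  · rw [Finset.mem_insert, Finset.mem_union, Finset.mem_image]
    rintro (h | ⟨T, -, h⟩ | h)
    · exact hiF (h ▸ Set.mem_insert _ _)
    · exact hiF (h ▸ Or.inr (Set.mem_insert _ _))
    · exact (ht' _ h).2.ne rfl

theorem card_joinFlag (hF : F ∈ Si M i) (hs : IsFlag (M ／ insert i F) s)
    (ht : IsFlag (M ↾ F) t) : (joinFlag i F s t).card = s.card + t.card + 2 := by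
  have hprod := prod_joinFlag hF hs ht fun _ => Multiplicative.ofAdd 1
  simp only [Finset.prod_const, ← ofAdd_nsmul, ← ofAdd_add, smul_eq_mul, mul_one] at hprod
  have hcard := Multiplicative.ofAdd.injective hprod
  omega

theorem x_mul_x_add_x_insert {S T : Set α} (hiT : i ∉ T) (hTS : ¬ T ⊆ S) :
    x M T * (x M S + x M (insert i S)) = x M T * x M S := by
  rw [mul_add, x_mul_x M (T := insert i S), add_zero]
  · exact fun h => hTS ((Set.subset_insert_iff_of_notMem hiT).1 h)
  · exact fun h => hiT (h (Set.mem_insert _ _))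

theorem x_mul_prod_restrict (hF : F ∈ Si M i) (ht : IsFlag (M ↾ F) t) :
    x M F * ∏ S ∈ t, (x M S + x M (insert i S)) = x M F * ∏ S ∈ t, x M S :=
  mul_prod_congr fun _ hS =>
    x_mul_x_add_x_insert (Si.notMem hF) (ssubset_of_mem_flag_restrict hF ht hS).2.2

theorem topDeg_summand [M.Finite] [M.Loopless] (hi : i ∈ M.E) (hF : F ∈ Si M i) :
    topDeg (M ／ insert i F) + topDeg (M ↾ F) + 2 = topDeg M := by
  have hcontract := rk_contract (Si.isProperFlat_insert hF).1.subset_ground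
  have hrestrict := rk_restrict (M := M) F
  have hinsert : rk M (insert i F) = rk M F + 1 := rk_insert M hi (by
    rw [(Si.isProperFlat hF).1.closure]
    exact Si.notMem hF)
  have hF' := Finset.mem_Ico.1 (Si.isProperFlat hF).rk_mem_Ico
  have hK := Finset.mem_Ico.1 (Si.isProperFlat_insert hF).rk_mem_Ico
  simp only [topDeg]
  omega

end JoinFlag

theorem range_le_of_x {M : Matroid α} {A : Type*} [CommRing A] [Algebra ℚ A]
    {φ : CH M →ₐ[ℚ] A} {B : Subalgebra ℚ A} (h : ∀ G : PFlat M, φ (x M G.1) ∈ B) :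
    φ.range ≤ B := by
  rw [← Algebra.map_top, ← adjoin_x, AlgHom.map_adjoin, Algebra.adjoin_le_iff]
  rintro _ ⟨_, ⟨S, rfl⟩, rfl⟩
  by_cases hS : IsProperFlat M S
  · exact h ⟨S, hS⟩
  · rw [x_of_not M hS, map_zero]
    exact zero_mem B

theorem map_mem_map_gr {M N : Matroid α} {A : Type*} [CommRing A] [Algebra ℚ A]
    {φ : CH N →ₐ[ℚ] A} {π : CH M →ₐ[ℚ] A}
    (hx : ∀ G : PFlat N, φ (x N G.1) ∈ (gr M 1).map π.toLinearMap) {k : ℕ} {a : CH N}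
    (ha : a ∈ gr N k) : φ a ∈ (gr M k).map π.toLinearMap := by
  refine map_mem_of_mem_gr φ (fun k => (gr M k).map π.toLinearMap)
    ⟨1, one_mem_gr M, map_one π⟩ ?_ hx ha
  rintro k _ _ ⟨a, ha, rfl⟩ ⟨b, hb, rfl⟩
  exact ⟨a * b, add_comm 1 k ▸ mul_mem_gr ha hb, map_mul π a b⟩

section Summand

variable {M : Matroid α} [M.Finite] {i : α} {F : Set α}

/-- The homomorphism `CH(M_{F ∪ i}) ⊗ CH(M^F) → CH(M) / Ann(x_{F ∪ i})`. -/
noncomputable def lambda (hi : i ∈ M.E) (hF : F ∈ Si M i) :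
    CH (M ／ insert i F) ⊗[ℚ] CH (M ↾ F) →ₐ[ℚ] AnnQuot M (insert i F) :=
  Algebra.TensorProduct.productMap (lambdaAbove hi hF) (lambdaBelow hi hF)

/-- The map `CH(M_{F ∪ i}) ⊗ CH(M^F) → CH(M)` that parametrizes the summand `x_{F ∪ i} CH_(i)`:
`lambda` followed by multiplication with `x_{F ∪ i}`. -/
noncomputable def summandMap (hi : i ∈ M.E) (hF : F ∈ Si M i) :
    CH (M ／ insert i F) ⊗[ℚ] CH (M ↾ F) →ₗ[ℚ] CH M :=
  (mulX M (insert i F)).restrictScalars ℚ ∘ₗ (lambda hi hF).toLinearMap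

theorem lambda_tmul (hi : i ∈ M.E) (hF : F ∈ Si M i) (a : CH (M ／ insert i F)) (b : CH (M ↾ F)) :
    lambda hi hF (a ⊗ₜ b) = lambdaAbove hi hF a * lambdaBelow hi hF b :=
  Algebra.TensorProduct.productMap_apply_tmul _ _ a b

theorem summandMap_eq (hi : i ∈ M.E) (hF : F ∈ Si M i)
    (t : CH (M ／ insert i F) ⊗[ℚ] CH (M ↾ F)) :
    summandMap hi hF t = mulX M (insert i F) (lambda hi hF t) :=
  rfl

theorem summandMap_one (hi : i ∈ M.E) (hF : F ∈ Si M i) :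
    summandMap hi hF 1 = x M (insert i F) := by
  rw [summandMap_eq, map_one, ← map_one (toAnnQuot M (insert i F)), mulX_toAnnQuot, one_mul]

theorem x_mul_summandMap_xs (hi : i ∈ M.E) (hF : F ∈ Si M i) {s t : Finset (Set α)}
    (hs : IsFlag (M ／ insert i F) s) (ht : IsFlag (M ↾ F) t) :
    x M F * summandMap hi hF (xs _ s ⊗ₜ xs _ t) = xs M (joinFlag i F s t) := by
  have habove : lambdaAbove hi hF (xs _ s) =
      toAnnQuot M (insert i F) (∏ S ∈ s, x M (S ∪ insert i F)) := by
    rw [xs, map_prod, map_prod]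
    exact Finset.prod_congr rfl fun S hS =>
      (lambdaAbove_x hi hF S).trans (if_pos (hs.isProperFlat S hS))
  have hbelow : lambdaBelow hi hF (xs _ t) =
      toAnnQuot M (insert i F) (∏ S ∈ t, (x M S + x M (insert i S))) := by
    rw [xs, map_prod, map_prod]
    exact Finset.prod_congr rfl fun S hS =>
      (lambdaBelow_x hi hF S).trans (if_pos (ht.isProperFlat S hS))
  rw [summandMap_eq, lambda_tmul, habove, hbelow, ← map_mul, mulX_toAnnQuot, xs,
    prod_joinFlag hF hs ht]
  linear_combination (∏ S ∈ s, x M (S ∪ insert i F)) * x M (insert i F) *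
    x_mul_prod_restrict hF ht

theorem deg_x_mul_summandMap [M.Loopless] (hi : i ∈ M.E) (hF : F ∈ Si M i)
    {D : CH M →ₗ[ℚ] ℚ} (hD : IsDeg M D) {DN : CH (M ／ insert i F) →ₗ[ℚ] ℚ}
    (hN : IsDeg (M ／ insert i F) DN) {DR : CH (M ↾ F) →ₗ[ℚ] ℚ} (hR : IsDeg (M ↾ F) DR)
    (t : CH (M ／ insert i F) ⊗[ℚ] CH (M ↾ F)) :
    D (x M F * summandMap hi hF t) = tensorDeg DN DR t := by
  have := finite_restrict (Si.isProperFlat hF).1.subset_ground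
  have := loopless_restrict (M := M) (Si.isProperFlat hF).1.subset_ground
  have := loopless_contract (Si.isProperFlat_insert hF).1
  suffices h : D ∘ₗ LinearMap.mulLeft ℚ (x M F) ∘ₗ summandMap hi hF = tensorDeg DN DR from
    LinearMap.congr_fun h t
  refine TensorProduct.ext (LinearMap.ext_on (span_xs _) ?_)
  rintro _ ⟨s, hs, rfl⟩
  refine LinearMap.ext_on (span_xs _) ?_
  rintro _ ⟨t, ht, rfl⟩
  change D (x M F * summandMap hi hF (xs _ s ⊗ₜ xs _ t)) = tensorDeg DN DR (xs _ s ⊗ₜ xs _ t)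
  rw [x_mul_summandMap_xs hi hF hs ht, hD.apply_xs (isFlag_joinFlag hF hs ht), tensorDeg_tmul,
    hN.apply_xs hs, hR.apply_xs ht, card_joinFlag hF hs ht, ite_zero_mul_ite_zero, one_mul]
  have htop := topDeg_summand hi hF
  have hscard := hs.card_le_topDeg
  have htcard := ht.card_le_topDeg
  exact if_congr (by omega) rfl rfl

theorem summandMap_injective [M.Loopless] (hi : i ∈ M.E) (hF : F ∈ Si M i)
    (hN : Nondeg (M ／ insert i F)) (hR : Nondeg (M ↾ F)) :
    Function.Injective (summandMap hi hF) := by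
  have := finite_restrict (Si.isProperFlat hF).1.subset_ground
  have := loopless_restrict (M := M) (Si.isProperFlat hF).1.subset_ground
  have := loopless_contract (Si.isProperFlat_insert hF).1
  have := finite_CH (M ↾ F)
  obtain ⟨D, hD⟩ := exists_isDeg M
  obtain ⟨DN, hDN⟩ := exists_isDeg (M ／ insert i F)
  obtain ⟨DR, hDR⟩ := exists_isDeg (M ↾ F)
  suffices hinj : Function.Injective (lambda hi hF) from (mulX_injective M _).comp hinj
  rw [injective_iff_map_eq_zero]
  intro t ht
  refine tensorDeg_nondegenerate (hN DN hDN) (hR DR hDR) t fun u => ?_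
  rw [← deg_x_mul_summandMap hi hF hD hDN hDR, summandMap_eq, map_mul (lambda hi hF), ht,
    zero_mul, map_zero, mul_zero, map_zero]

theorem lambdaAbove_range_le (hi : i ∈ M.E) (hF : F ∈ Si M i) :
    (lambdaAbove hi hF).range ≤ ((toAnnQuot M (insert i F)).comp (theta M i)).range := by
  refine range_le_of_x fun ⟨S, hS⟩ => ?_
  obtain ⟨hPF, hSK, a, ha⟩ :=
    (isProperFlat_contract_iff (Si.isProperFlat_insert hF).1.subset_ground).1 hS
  have hSF : Disjoint S F := hSK.mono_right (Set.subset_insert _ _)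
  have hiS : i ∉ S ∪ F := by
    rintro (h | h)
    · exact Set.disjoint_left.1 hSK h (Set.mem_insert _ _)
    · exact Si.notMem hF h
  have hflat : IsProperFlat (M ＼ {i}) (S ∪ F) := by
    refine isProperFlat_delete ⟨a, Or.inl ha⟩ hPF ?_ fun h => hPF.2.2 ?_
    · rw [Set.union_insert, Set.insert_sdiff_of_mem _ (Set.mem_singleton i),
        Set.sdiff_singleton_eq_self hiS]
    · rw [Set.union_insert, h, Set.insert_sdiff_singleton, Set.insert_eq_of_mem hi]
  refine ⟨x _ (S ∪ F), (toAnnQuot_theta_above hF hflat ?_).trans ?_⟩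
  · exact ⟨Set.subset_union_right, fun h => Set.disjoint_left.1 hSF ha (h (Or.inl ha))⟩
  · rw [lambdaAbove_x, Set.union_sdiff_right, hSF.sdiff_eq_left]

theorem lambdaBelow_range_le (hi : i ∈ M.E) (hF : F ∈ Si M i) :
    (lambdaBelow hi hF).range ≤ ((toAnnQuot M (insert i F)).comp (theta M i)).range := by
  refine range_le_of_x fun ⟨S, hS⟩ => ?_
  obtain ⟨hPF, hSF⟩ := (isProperFlat_restrict_iff (Si.isProperFlat hF)).1 hS
  have hflat : IsProperFlat (M ＼ {i}) S := by
    refine isProperFlat_delete hPF.2.1 hPF ?_ fun h => hSF.2 (h ▸ Si.subset hF)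
    exact (Set.sdiff_singleton_eq_self fun h => Si.notMem hF (hSF.subset h)).symm
  exact ⟨x _ S, (toAnnQuot_theta_below hF hflat hSF).trans (lambdaBelow_x hi hF S).symm⟩

theorem lambda_range (hi : i ∈ M.E) (hF : F ∈ Si M i) :
    (lambda hi hF).range = ((toAnnQuot M (insert i F)).comp (theta M i)).range := by
  obtain ⟨j, hj⟩ := (Si.isProperFlat hF).2.1
  obtain ⟨l, hlE, hl⟩ := Si.exists_notMem hF
  refine le_antisymm ((Algebra.TensorProduct.productMap_range _ _).trans_le
    (sup_le (lambdaAbove_range_le hi hF) (lambdaBelow_range_le hi hF)))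
    (range_le_of_x fun ⟨G, hG⟩ => ?_)
  change toAnnQuot M (insert i F) (theta M i (x _ G)) ∈ _
  by_cases hGF : G ⊆ F
  · obtain rfl | hGF := hGF.eq_or_ssubset
    · refine ⟨- (1 ⊗ₜ[ℚ] alphaAt (M ↾ G) j) - betaAt (M ／ (insert i G)) l ⊗ₜ[ℚ] 1, ?_⟩
      rw [toAnnQuot_theta_self hi hF hj ⟨hlE, hl⟩]
      simp [lambda]
    · exact ⟨1 ⊗ₜ x _ G, by rw [toAnnQuot_theta_below hF hG hGF]; simp [lambda, lambdaBelow_x]⟩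
  · by_cases hFG : F ⊆ G
    · exact ⟨x _ (G \ F) ⊗ₜ 1, by
        rw [toAnnQuot_theta_above hF hG ⟨hFG, hGF⟩]; simp [lambda, lambdaAbove_x]⟩
    · rw [toAnnQuot_theta_incomparable hF hG hGF hFG]
      exact zero_mem _

theorem summandMap_mem_gr (hi : i ∈ M.E) (hF : F ∈ Si M i) {k : ℕ}
    {t : CH (M ／ insert i F) ⊗[ℚ] CH (M ↾ F)} (ht : t ∈ grTensor (M ／ insert i F) (M ↾ F) k) :
    summandMap hi hF t ∈ gr M (k + 1) := by
  suffices h : grTensor (M ／ insert i F) (M ↾ F) k ≤ (gr M (k + 1)).comap (summandMap hi hF) from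
    h ht
  rw [grTensor_eq_span, Submodule.span_le]
  rintro _ ⟨p, q, a, b, rfl, ha, hb, rfl⟩
  obtain ⟨c, hc, hca⟩ := map_mem_map_gr (φ := lambdaAbove hi hF)
    (π := toAnnQuot M (insert i F)) (fun G => ⟨_, x_mem_gr M (G.1 ∪ insert i F),
      ((lambdaAbove_x hi hF G.1).trans (if_pos G.2)).symm⟩) ha
  obtain ⟨d, hd, hdb⟩ := map_mem_map_gr (φ := lambdaBelow hi hF)
    (π := toAnnQuot M (insert i F)) (fun G => ⟨_, add_mem (x_mem_gr M G.1)
      (x_mem_gr M (insert i G.1)), ((lambdaBelow_x hi hF G.1).trans (if_pos G.2)).symm⟩) hb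
  have h : summandMap hi hF (a ⊗ₜ b) = c * d * x M (insert i F) := by
    rw [summandMap_eq, lambda_tmul, ← hca, ← hdb, ← mulX_toAnnQuot]
    exact congrArg _ (map_mul (toAnnQuot M (insert i F)) c d).symm
  change summandMap hi hF (a ⊗ₜ b) ∈ gr M (p + q + 1)
  exact h ▸ mul_mem_gr (mul_mem_gr hc hd) (x_mem_gr M _)

theorem mem_grTensor_iff_summandMap_mem_gr [M.Loopless] (hi : i ∈ M.E) (hF : F ∈ Si M i)
    (hN : Nondeg (M ／ insert i F)) (hR : Nondeg (M ↾ F)) {k : ℕ}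
    {t : CH (M ／ insert i F) ⊗[ℚ] CH (M ↾ F)} :
    t ∈ grTensor (M ／ insert i F) (M ↾ F) k ↔ summandMap hi hF t ∈ gr M (k + 1) := by
  refine ⟨summandMap_mem_gr hi hF, fun ht => ?_⟩
  obtain ⟨c, hc, rfl⟩ := exists_components_tensor _ _ t
  rw [sum_eq_component M (f := (summandMap hi hF).toAddMonoidHom)
    (summandMap_injective hi hF hN hR) (fun j => summandMap_mem_gr hi hF (hc j)) ht]
  exact hc k

theorem exists_isRestriction [M.Loopless] (hi : i ∈ M.E) (hF : F ∈ Si M i)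
    (hN : Nondeg (M ／ insert i F)) (hR : Nondeg (M ↾ F)) :
    ∃ ρ : CH (M ＼ {i}) →ₐ[ℚ] CH (M ／ insert i F) ⊗[ℚ] CH (M ↾ F),
      IsRestriction M i F ρ ∧ Function.Surjective ρ ∧
      ∀ a t, summandMap hi hF (ρ a * t) = theta M i a * summandMap hi hF t := by
  have hinj : Function.Injective (lambda hi hF) := fun s t h =>
    summandMap_injective hi hF hN hR (congrArg (mulX M (insert i F)) h)
  have hmem : ∀ a, toAnnQuot M (insert i F) (theta M i a) ∈ (lambda hi hF).range := fun a => by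
    rw [lambda_range hi hF]
    exact ⟨a, rfl⟩
  let ρ : CH (M ＼ {i}) →ₐ[ℚ] CH (M ／ insert i F) ⊗[ℚ] CH (M ↾ F) :=
    (AlgEquiv.ofInjective (lambda hi hF) hinj).symm.toAlgHom.comp
      (((toAnnQuot M (insert i F)).comp (theta M i)).codRestrict (lambda hi hF).range hmem)
  have hρ : ∀ a, lambda hi hF (ρ a) = toAnnQuot M (insert i F) (theta M i a) := fun a =>
    congrArg Subtype.val ((AlgEquiv.ofInjective (lambda hi hF) hinj).apply_symm_apply ⟨_, hmem a⟩)
  refine ⟨ρ, ⟨fun G hGF hFG => hinj ?_, fun G hGF => hinj ?_, fun G hFG => hinj ?_,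
    fun j hj l hl => hinj ?_⟩, fun t => ?_, fun a t => ?_⟩
  · rw [hρ, toAnnQuot_theta_incomparable hF G.2 hGF hFG, map_zero]
  · rw [hρ, toAnnQuot_theta_below hF G.2 hGF]
    simp [lambda, lambdaBelow_x]
  · rw [hρ, toAnnQuot_theta_above hF G.2 hFG]
    simp [lambda, lambdaAbove_x]
  · rw [hρ, toAnnQuot_theta_self hi hF hj hl]
    simp [lambda]
  · have ht : lambda hi hF t ∈ (lambda hi hF).range := ⟨t, rfl⟩
    rw [lambda_range hi hF] at ht
    obtain ⟨a, ha⟩ := ht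
    exact ⟨a, hinj ((hρ a).trans ha)⟩
  · rw [summandMap_eq, summandMap_eq, map_mul, hρ, mulX_toAnnQuot_mul]

theorem summandMap_of_map_mul {hi : i ∈ M.E} {hF : F ∈ Si M i}
    {ρ : CH (M ＼ {i}) →ₐ[ℚ] CH (M ／ insert i F) ⊗[ℚ] CH (M ↾ F)}
    (hρ : ∀ a t, summandMap hi hF (ρ a * t) = theta M i a * summandMap hi hF t)
    (a : CH (M ＼ {i})) : summandMap hi hF (ρ a) = x M (insert i F) * theta M i a := by
  rw [← mul_one (ρ a), hρ, summandMap_one, mul_comm]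

theorem isoTensor [M.Loopless] (hi : i ∈ M.E) (hF : F ∈ Si M i) (hN : Nondeg (M ／ insert i F))
    (hR : Nondeg (M ↾ F)) : IsoTensor M i F := by
  obtain ⟨ρ, hρ, hsurj, hmul⟩ := exists_isRestriction hi hF hN hR
  have hmem : ∀ t, summandMap hi hF t ∈ xImTheta M i (insert i F) := fun t => by
    obtain ⟨a, rfl⟩ := hsurj t
    exact (mem_xImTheta M).2 ⟨a, summandMap_of_map_mul hmul a⟩
  let g : CH (M ／ insert i F) ⊗[ℚ] CH (M ↾ F) →+ xImTheta M i (insert i F) :=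
    (summandMap hi hF).toAddMonoidHom.codRestrict _ hmem
  have hg : Function.Bijective g := by
    refine ⟨fun s t h => summandMap_injective hi hF hN hR (congrArg Subtype.val h),
      fun ⟨y, hy⟩ => ?_⟩
    obtain ⟨a, rfl⟩ := (mem_xImTheta M).1 hy
    exact ⟨ρ a, Subtype.ext (summandMap_of_map_mul hmul a)⟩
  exact ⟨ρ, hρ, AddEquiv.ofBijective g hg, fun a t => Subtype.ext (hmul a t),
    fun k t => mem_grTensor_iff_summandMap_mem_gr hi hF hN hR⟩

theorem deg_x_insert_mul_theta [M.Loopless] (hi : i ∈ M.E) (hF : F ∈ Si M i)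
    (hN : Nondeg (M ／ insert i F)) (hR : Nondeg (M ↾ F)) {D : CH M →ₗ[ℚ] ℚ} (hD : IsDeg M D)
    (a : CH (M ＼ {i})) : D (x M (insert i F) * theta M i a) = 0 := by
  have := finite_restrict (Si.isProperFlat hF).1.subset_ground
  have := loopless_restrict (M := M) (Si.isProperFlat hF).1.subset_ground
  have := loopless_contract (Si.isProperFlat_insert hF).1
  obtain ⟨ρ, -, -, hmul⟩ := exists_isRestriction hi hF hN hR
  obtain ⟨c, hc, rfl⟩ := exists_components a
  rw [Finsupp.sum, map_sum, Finset.mul_sum, map_sum]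
  refine Finset.sum_eq_zero fun k _ => ?_
  have hk : x M (insert i F) * theta M i (c k) ∈ gr M (k + 1) :=
    add_comm 1 k ▸ mul_mem_gr (x_mem_gr M _) (theta_mem_gr M (hc k))
  by_cases h : k + 1 = topDeg M
  · have htop := topDeg_summand hi hF
    rw [← summandMap_of_map_mul hmul] at hk ⊢
    rw [eq_zero_of_mem_grTensor _ _ (by omega)
      ((mem_grTensor_iff_summandMap_mem_gr hi hF hN hR).2 hk), map_zero, map_zero]
  · exact hD.eq_zero _ h _ hk

theorem x_insert_mul_theta_eq_zero [M.Loopless] (hi : i ∈ M.E) (hF : F ∈ Si M i)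
    (hN : Nondeg (M ／ insert i F)) (hR : Nondeg (M ↾ F)) {D : CH M →ₗ[ℚ] ℚ} (hD : IsDeg M D)
    {a : CH (M ＼ {i})}
    (ha : ∀ b, D (x M (insert i F) * theta M i a * (x M (insert i F) * theta M i b)) = 0) :
    x M (insert i F) * theta M i a = 0 := by
  have := finite_restrict (Si.isProperFlat hF).1.subset_ground
  have := loopless_restrict (M := M) (Si.isProperFlat hF).1.subset_ground
  have := loopless_contract (Si.isProperFlat_insert hF).1
  have := finite_CH (M ↾ F)
  obtain ⟨ρ, -, hsurj, hmul⟩ := exists_isRestriction hi hF hN hR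
  obtain ⟨DN, hDN⟩ := exists_isDeg (M ／ insert i F)
  obtain ⟨DR, hDR⟩ := exists_isDeg (M ↾ F)
  suffices h : ρ a = 0 by rw [← summandMap_of_map_mul hmul, h, map_zero]
  refine tensorDeg_nondegenerate (hN DN hDN) (hR DR hDR) _ fun u => ?_
  obtain ⟨b, rfl⟩ := hsurj u
  rw [← deg_x_mul_summandMap hi hF hD hDN hDR, ← map_mul, summandMap_of_map_mul hmul]
  have hself := deg_x_insert_mul_theta hi hF hN hR hD (x _ F * (a * b))
  rw [map_mul (theta M i), theta_x M i ⟨F, Si.isProperFlat_delete hF⟩] at hself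
  have hexpand : x M F * (x M (insert i F) * theta M i (a * b)) =
      x M (insert i F) * ((x M F + x M (insert i F)) * theta M i (a * b)) -
      x M (insert i F) * theta M i a * (x M (insert i F) * theta M i b) := by
    rw [map_mul]
    ring
  rw [hexpand, map_sub, ha b, hself, sub_zero]

end Summand

/-! ### Degree maps under deletion -/

section Deletion

variable {M : Matroid α} {i : α}

/-- The minors of `M` at the flats in `𝒮_i` satisfy Poincaré duality, so that the summands
`x_{F ∪ i} CH_(i)` do. -/
def SummandNondeg (M : Matroid α) (i : α) : Prop :=
  ∀ F ∈ Si M i, Nondeg (M ／ insert i F) ∧ Nondeg (M ↾ F)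

theorem notMem_of_isProperFlat_delete {S : Set α} (hS : IsProperFlat (M ＼ {i}) S) : i ∉ S :=
  fun h => (hS.1.subset_ground h).2 rfl

theorem closure_sdiff_of_isProperFlat_delete {S : Set α} (hS : IsProperFlat (M ＼ {i}) S) :
    M.closure S \ {i} = S := by
  have h := hS.1.closure
  rwa [Matroid.delete_closure_eq, Set.sdiff_singleton_eq_self (notMem_of_isProperFlat_delete hS)]
    at h

theorem closure_eq_of_notMem_closure {S : Set α} (hS : IsProperFlat (M ＼ {i}) S)
    (h : i ∉ M.closure S) : M.closure S = S := by
  rw [← Set.sdiff_singleton_eq_self h, closure_sdiff_of_isProperFlat_delete hS]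

theorem closure_eq_insert_of_mem_closure {S : Set α} (hS : IsProperFlat (M ＼ {i}) S)
    (h : i ∈ M.closure S) : M.closure S = insert i S := by
  rw [← Set.insert_sdiff_self_of_mem h, closure_sdiff_of_isProperFlat_delete hS]

theorem isProperFlat_closure_of_delete {S : Set α} (hS : IsProperFlat (M ＼ {i}) S) :
    IsProperFlat M (M.closure S) := by
  have hSE : S ⊆ M.E \ {i} := hS.1.subset_ground
  refine ⟨M.isFlat_closure S, hS.2.1.mono (M.subset_closure S (hSE.trans Set.sdiff_subset)),
    fun h => hS.2.2 ?_⟩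
  rw [← closure_sdiff_of_isProperFlat_delete hS, h, Matroid.delete_ground]

theorem isFlag_image_closure [DecidableEq (Set α)] {s : Finset (Set α)}
    (hs : IsFlag (M ＼ {i}) s) : IsFlag M (s.image M.closure) := by
  constructor
  · intro S hS
    obtain ⟨T, hT, rfl⟩ := Finset.mem_image.1 hS
    exact isProperFlat_closure_of_delete (hs.isProperFlat T hT)
  · intro S hS T hT _
    obtain ⟨S, hS', rfl⟩ := Finset.mem_image.1 hS
    obtain ⟨T, hT', rfl⟩ := Finset.mem_image.1 hT
    exact (hs.subset_or_subset hS' hT').imp (fun h => M.closure_subset_closure h)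
      fun h => M.closure_subset_closure h

theorem closure_injOn_flag {s : Finset (Set α)} (hs : IsFlag (M ＼ {i}) s) :
    Set.InjOn M.closure (s : Set (Set α)) := by
  intro S hS T hT h
  rw [← closure_sdiff_of_isProperFlat_delete (hs.isProperFlat S hS), h,
    closure_sdiff_of_isProperFlat_delete (hs.isProperFlat T hT)]

theorem x_add_x_insert_of_mem_closure {S : Set α} (hS : IsProperFlat (M ＼ {i}) S)
    (h : i ∈ M.closure S) : x M S + x M (insert i S) = x M (M.closure S) := by
  have hnot : ¬ IsProperFlat M S := fun hPF =>
    notMem_of_isProperFlat_delete hS (hPF.1.closure ▸ h)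
  rw [x_of_not M hnot, zero_add, closure_eq_insert_of_mem_closure hS h]

theorem delete_ground_nonempty (hi : i ∈ M.E) (hE : M.E ≠ {i}) : (M.E \ {i}).Nonempty := by
  rw [Set.nonempty_iff_ne_empty, Ne, Set.sdiff_eq_empty]
  exact fun h => hE (h.antisymm (Set.singleton_subset_iff.2 hi))

theorem isProperFlat_compl (h : M.IsColoop i) (hE : M.E ≠ {i}) :
    IsProperFlat M (M.E \ {i}) := by
  refine ⟨?_, delete_ground_nonempty h.mem_ground hE, fun heq =>
    (heq.symm.subset h.mem_ground).2 rfl⟩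
  rw [Matroid.isFlat_iff_closure_eq]
  refine Set.Subset.antisymm (fun a ha => ⟨M.closure_subset_ground _ ha, ?_⟩)
    (M.subset_closure _ Set.sdiff_subset)
  rintro rfl
  exact h.notMem_closure_of_notMem (fun h => h.2 rfl) ha

theorem x_compl_eq_zero (hi : i ∈ M.E) (h : ¬ (M.IsColoop i ∧ M.E ≠ {i})) :
    x M (M.E \ {i}) = 0 := by
  refine x_of_not M fun hPF => h ⟨?_, fun hE => ?_⟩
  · rw [Matroid.isColoop_iff_sdiff_not_spanning, Matroid.spanning_iff_closure_eq,
      hPF.1.closure]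
    exact hPF.2.2
  · obtain ⟨a, ha, hai⟩ := hPF.2.1
    exact hai (hE ▸ ha)

variable [M.Finite]

theorem theta_xs {s : Finset (Set α)} (hs : IsFlag (M ＼ {i}) s) :
    theta M i (xs _ s) = ∏ S ∈ s, (x M S + x M (insert i S)) := by
  rw [xs, map_prod]
  exact Finset.prod_congr rfl fun S hS => theta_x M i ⟨S, hs.isProperFlat S hS⟩

theorem topDeg_delete_of_ground_eq (hE : M.E = {i}) : topDeg (M ＼ {i}) = topDeg M := by
  have hempty : (M ＼ {i}).E = ∅ := by simp [hE]
  have hle : rk M M.E ≤ 1 := by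
    rw [← Nat.cast_le (α := ℕ∞), coe_rk, hE]
    simp
  rw [topDeg, topDeg, hempty, rk_empty]
  omega

theorem topDeg_delete (h : ¬ (M.IsColoop i ∧ M.E ≠ {i})) : topDeg (M ＼ {i}) = topDeg M := by
  by_cases hco : M.IsColoop i
  · exact topDeg_delete_of_ground_eq (by_contra fun hE => h ⟨hco, hE⟩)
  · rw [topDeg, topDeg, rk_delete_of_not_isColoop hco]

theorem x_compl_mul_theta_xs {s : Finset (Set α)} (hs : IsFlag (M ＼ {i}) s) :
    x M (M.E \ {i}) * theta M i (xs _ s) = x M (M.E \ {i}) * xs M s := by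
  rw [theta_xs hs]
  refine mul_prod_congr fun S hS => x_mul_x_add_x_insert (fun h => h.2 rfl) fun hES => ?_
  exact (hs.isProperFlat S hS).2.2 ((hs.isProperFlat S hS).1.subset_ground.antisymm hES)

theorem finite_Si (M : Matroid α) [M.Finite] (i : α) : Finite (Si M i) :=
  Set.Finite.to_subtype (M.ground_finite.finite_subsets.subset fun _ hF => hF.2.2.1.subset_ground)

theorem x_compl_mul_theta_mul_summand {F : Set α} (hF : F ∈ Si M i) (a b : CH (M ＼ {i})) :
    x M (M.E \ {i}) * theta M i a * (x M (insert i F) * theta M i b) = 0 := by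
  linear_combination theta M i a * theta M i b * x_compl_mul_x_insert hF

variable [M.Loopless]

theorem deg_x_insert_mul_theta_of_notMem_closure (hi : i ∈ M.E) (hM : SummandNondeg M i)
    {D : CH M →ₗ[ℚ] ℚ} (hD : IsDeg M D) {T : Set α} (hT : IsProperFlat (M ＼ {i}) T)
    (hiT : i ∉ M.closure T) (a : CH (M ＼ {i})) : D (x M (insert i T) * theta M i a) = 0 := by
  by_cases hflat : M.IsFlat (insert i T)
  · have hTE : T ⊆ M.E \ {i} := hT.1.subset_ground
    have hTS : T ∈ Si M i := ⟨hT.2.1, hTE.ssubset_of_ne hT.2.2,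
      Matroid.isFlat_iff_closure_eq.2 (closure_eq_of_notMem_closure hT hiT), hflat⟩
    exact deg_x_insert_mul_theta hi hTS (hM T hTS).1 (hM T hTS).2 hD a
  · rw [x_of_not M fun h => hflat h.1, zero_mul, map_zero]

theorem deg_theta_xs (hi : i ∈ M.E) (hM : SummandNondeg M i) {D : CH M →ₗ[ℚ] ℚ}
    (hD : IsDeg M D) {s : Finset (Set α)} (hs : IsFlag (M ＼ {i}) s) :
    D (theta M i (xs _ s)) = D (∏ S ∈ s, x M (M.closure S)) := by
  classical
  by_cases hall : ∀ S ∈ s, i ∈ M.closure S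
  · rw [theta_xs hs]
    exact congrArg D (Finset.prod_congr rfl fun S hS =>
      x_add_x_insert_of_mem_closure (hs.isProperFlat S hS) (hall S hS))
  -- Let `T` be the largest member of the flag that is closed in `M`. In
  -- `(x_T + x_{T ∪ i}) θ_i(x_{s ∖ T})` the second term has degree zero, and multiplication by
  -- `x_T` kills `x_{S ∪ i}` for the smaller members `S`.
  obtain ⟨T, hT⟩ := Finset.exists_maximal (s := {S ∈ s | i ∉ M.closure S}) (by
    push Not at hall
    obtain ⟨S, hS, hiS⟩ := hall
    exact ⟨S, Finset.mem_filter.2 ⟨hS, hiS⟩⟩)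
  obtain ⟨hTs, hiT⟩ := Finset.mem_filter.1 hT.prop
  have hflatT := hs.isProperFlat T hTs
  have hker := deg_x_insert_mul_theta_of_notMem_closure hi hM hD hflatT hiT (xs _ (s.erase T))
  have hbelow : x M T * theta M i (xs _ (s.erase T)) =
      x M T * ∏ S ∈ s.erase T, x M (M.closure S) := by
    rw [theta_xs (hs.mono (s.erase_subset T))]
    refine mul_prod_congr fun S hS => ?_
    obtain ⟨hST, hSs⟩ := Finset.mem_erase.1 hS
    by_cases hiS : i ∈ M.closure S
    · rw [x_add_x_insert_of_mem_closure (hs.isProperFlat S hSs) hiS]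
    · rw [closure_eq_of_notMem_closure (hs.isProperFlat S hSs) hiS]
      exact x_mul_x_add_x_insert (notMem_of_isProperFlat_delete hflatT) fun hTS =>
        hST (hT.eq_of_ge (Finset.mem_filter.2 ⟨hSs, hiS⟩) hTS)
  have hsplit : theta M i (xs _ s) =
      (x M T + x M (insert i T)) * theta M i (xs _ (s.erase T)) := by
    rw [xs, xs, ← Finset.mul_prod_erase s _ hTs, map_mul, theta_x M i ⟨T, hflatT⟩]
  rw [hsplit, add_mul, map_add, hker, add_zero, hbelow, ← Finset.mul_prod_erase s _ hTs,
    closure_eq_of_notMem_closure hflatT hiT]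

theorem isDeg_comp_theta (hi : i ∈ M.E) (hM : SummandNondeg M i)
    (htop : topDeg (M ＼ {i}) = topDeg M) {D : CH M →ₗ[ℚ] ℚ} (hD : IsDeg M D) :
    IsDeg (M ＼ {i}) (D ∘ₗ (theta M i).toLinearMap) := by
  classical
  refine ⟨fun k hk a ha => hD.eq_zero k (htop ▸ hk) _ (theta_mem_gr M ha), fun s hs hc => ?_⟩
  change D (theta M i (xs _ s)) = 1
  rw [deg_theta_xs hi hM hD hs, ← Finset.prod_image (g := M.closure) (f := x M)
    (closure_injOn_flag hs)]
  refine hD.flag _ (isFlag_image_closure hs) ?_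
  rw [Finset.card_image_of_injOn (closure_injOn_flag hs), hc, htop]

theorem topDeg_delete_of_isColoop (h : M.IsColoop i) (hE : M.E ≠ {i}) :
    topDeg (M ＼ {i}) + 1 = topDeg M := by
  have := loopless_delete (M := M) i
  have hrk := rk_delete_of_isColoop h
  have hpos := rk_pos (M := M ＼ {i}) subset_rfl (delete_ground_nonempty h.mem_ground hE)
  rw [topDeg, topDeg]
  omega

theorem isDeg_compl_mul_theta (h : M.IsColoop i) (hE : M.E ≠ {i}) {D : CH M →ₗ[ℚ] ℚ}
    (hD : IsDeg M D) :
    IsDeg (M ＼ {i}) (D ∘ₗ LinearMap.mulLeft ℚ (x M (M.E \ {i})) ∘ₗ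
      (theta M i).toLinearMap) := by
  classical
  have htop := topDeg_delete_of_isColoop h hE
  refine ⟨fun k hk a ha => hD.eq_zero (1 + k) (by omega) _
    (mul_mem_gr (x_mem_gr M _) (theta_mem_gr M ha)), fun s hs hc => ?_⟩
  change D (x M (M.E \ {i}) * theta M i (xs _ s)) = 1
  have hSE : ∀ S ∈ s, S ⊆ M.E \ {i} := fun S hS => (hs.isProperFlat S hS).1.subset_ground
  have hcl : ∀ S ∈ s, M.closure S = S := fun S hS =>
    closure_eq_of_notMem_closure (hs.isProperFlat S hS)
      (h.notMem_closure_of_notMem fun hiS => (hSE S hS hiS).2 rfl)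
  have hflag : IsFlag M s := by
    have := isFlag_image_closure hs
    rwa [Finset.image_congr hcl, Finset.image_id'] at this
  have hnot : M.E \ {i} ∉ s := fun hmem => (hs.isProperFlat _ hmem).2.2 rfl
  rw [x_compl_mul_theta_xs hs, xs, ← Finset.prod_insert hnot]
  refine hD.flag _ (isFlag_insert_iff.2
    ⟨isProperFlat_compl h hE, hflag, fun S hS => Or.inl (hSE S hS)⟩) ?_
  rw [Finset.card_insert_of_notMem hnot, hc, htop]

theorem deg_theta_of_isColoop (h : M.IsColoop i) (hE : M.E ≠ {i}) {D : CH M →ₗ[ℚ] ℚ}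
    (hD : IsDeg M D) (a : CH (M ＼ {i})) : D (theta M i a) = 0 := by
  have := loopless_delete (M := M) i
  have htop := topDeg_delete_of_isColoop h hE
  obtain ⟨c, hc, rfl⟩ := exists_components a
  rw [Finsupp.sum, map_sum, map_sum]
  refine Finset.sum_eq_zero fun k _ => ?_
  by_cases hk : k = topDeg M
  · rw [eq_zero_of_mem_gr (by omega) (hc k), map_zero, map_zero]
  · exact hD.eq_zero k hk _ (theta_mem_gr M (hc k))

theorem eq_zero_of_deg_theta_mul_theta (hi : i ∈ M.E) (hM : SummandNondeg M i)
    (hdel : Nondeg (M ＼ {i})) (htop : topDeg (M ＼ {i}) = topDeg M) {D : CH M →ₗ[ℚ] ℚ}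
    (hD : IsDeg M D) {a : CH (M ＼ {i})} (h : ∀ z, D (theta M i a * z) = 0) : a = 0 :=
  hdel _ (isDeg_comp_theta hi hM htop hD) a fun d => by
    rw [LinearMap.comp_apply, AlgHom.toLinearMap_apply, map_mul]
    exact h _

theorem eq_zero_of_deg_theta_add_x_compl_mul (h : M.IsColoop i) (hE : M.E ≠ {i})
    (hdel : Nondeg (M ＼ {i})) {D : CH M →ₗ[ℚ] ℚ} (hD : IsDeg M D) {a b : CH (M ＼ {i})}
    (hab : ∀ z, D ((theta M i a + x M (M.E \ {i}) * theta M i b) * z) = 0) : a = 0 ∧ b = 0 := by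
  have hD' := isDeg_compl_mul_theta h hE hD
  have hb : b = 0 := hdel _ hD' b fun d => by
    have hθ := hab (theta M i d)
    rwa [add_mul, map_add, ← map_mul, deg_theta_of_isColoop h hE hD, zero_add, mul_assoc,
      ← map_mul] at hθ
  refine ⟨hdel _ hD' a fun d => ?_, hb⟩
  have hx := hab (x M (M.E \ {i}) * theta M i d)
  rwa [hb, map_zero, mul_zero, add_zero, mul_left_comm, ← map_mul] at hx

/-! ### The decomposition -/

theorem deg_summand_mul_summand (hi : i ∈ M.E) (hM : SummandNondeg M i) {D : CH M →ₗ[ℚ] ℚ}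
    (hD : IsDeg M D) {F G : Set α} (hF : F ∈ Si M i) (hG : G ∈ Si M i) (hFG : F ≠ G)
    (a b : CH (M ＼ {i})) :
    D (x M (insert i F) * theta M i a * (x M (insert i G) * theta M i b)) = 0 := by
  have of_ssubset : ∀ {F G a b}, F ∈ Si M i → G ∈ Si M i → F ⊂ G →
      D (x M (insert i F) * theta M i a * (x M (insert i G) * theta M i b)) = 0 := by
    intro F G a b hF hG hFG
    have hprod : x M (insert i F) * theta M i a * (x M (insert i G) * theta M i b) =
        x M (insert i F) * theta M i (x _ G * a * b) := by
      rw [map_mul, map_mul]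
      linear_combination theta M i a * theta M i b *
        x_insert_mul_of_ssubset hF (Si.subset hG) hFG
    rw [hprod]
    exact deg_x_insert_mul_theta hi hF (hM F hF).1 (hM F hF).2 hD _
  by_cases hFG' : F ⊆ G
  · exact of_ssubset hF hG (hFG'.ssubset_of_ne hFG)
  by_cases hGF : G ⊆ F
  · rw [mul_comm]
    exact of_ssubset hG hF (hGF.ssubset_of_ne hFG.symm)
  · have hprod : x M (insert i F) * theta M i a * (x M (insert i G) * theta M i b) = 0 := by
      linear_combination theta M i a * theta M i b *
        x_insert_mul_x_insert hG (Si.notMem hF) hFG' hGF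
    rw [hprod, map_zero]

theorem deg_theta_mul_summand (hi : i ∈ M.E) (hM : SummandNondeg M i) {D : CH M →ₗ[ℚ] ℚ}
    (hD : IsDeg M D) {F : Set α} (hF : F ∈ Si M i) (a b : CH (M ＼ {i})) :
    D (theta M i a * (x M (insert i F) * theta M i b)) = 0 := by
  rw [mul_left_comm, ← map_mul]
  exact deg_x_insert_mul_theta hi hF (hM F hF).1 (hM F hF).2 hD _

theorem x_insert_mul_component_eq_zero [Fintype (Si M i)] (hi : i ∈ M.E)
    (hM : SummandNondeg M i) {D : CH M →ₗ[ℚ] ℚ} (hD : IsDeg M D) {a b : CH (M ＼ {i})}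
    {c : Si M i → CH (M ＼ {i})}
    (h : ∀ z, D ((theta M i a + x M (M.E \ {i}) * theta M i b +
      ∑ F, x M (insert i F.1) * theta M i (c F)) * z) = 0) (F : Si M i) :
    x M (insert i F.1) * theta M i (c F) = 0 := by
  classical
  refine x_insert_mul_theta_eq_zero hi F.2 (hM F F.2).1 (hM F F.2).2 hD fun d => ?_
  have hpair := h (x M (insert i F.1) * theta M i d)
  rwa [add_mul, add_mul, map_add, map_add, Finset.sum_mul, map_sum,
    Finset.sum_eq_single F (fun G _ hG => deg_summand_mul_summand hi hM hD G.2 F.2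
      (fun h => hG (Subtype.ext h)) _ _) (fun h => absurd (Finset.mem_univ F) h),
    deg_theta_mul_summand hi hM hD F.2, x_compl_mul_theta_mul_summand F.2, map_zero, zero_add,
    zero_add] at hpair

theorem components_eq_zero [Fintype (Si M i)] (hi : i ∈ M.E) (hM : SummandNondeg M i)
    (hdel : Nondeg (M ＼ {i})) {D : CH M →ₗ[ℚ] ℚ} (hD : IsDeg M D) {a b : CH (M ＼ {i})}
    {c : Si M i → CH (M ＼ {i})}
    (h : ∀ z, D ((theta M i a + x M (M.E \ {i}) * theta M i b +
      ∑ F, x M (insert i F.1) * theta M i (c F)) * z) = 0) :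
    a = 0 ∧ (M.IsColoop i → M.E ≠ {i} → b = 0) ∧ x M (M.E \ {i}) * theta M i b = 0 ∧
      ∀ F, x M (insert i F.1) * theta M i (c F) = 0 := by
  have hc := x_insert_mul_component_eq_zero hi hM hD h
  simp only [hc, Finset.sum_const_zero, add_zero] at h
  by_cases hco : M.IsColoop i ∧ M.E ≠ {i}
  · obtain ⟨rfl, rfl⟩ := eq_zero_of_deg_theta_add_x_compl_mul hco.1 hco.2 hdel hD h
    exact ⟨rfl, fun _ _ => rfl, by rw [map_zero, mul_zero], hc⟩
  · have hx := x_compl_eq_zero hi hco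
    simp only [hx, zero_mul, add_zero] at h
    exact ⟨eq_zero_of_deg_theta_mul_theta hi hM hdel (topDeg_delete hco) hD h,
      fun hcoloop hE => absurd ⟨hcoloop, hE⟩ hco, by rw [hx, zero_mul], hc⟩

end Deletion

/-! ### Poincaré duality -/

theorem nondeg_of_ground_eq_empty {M : Matroid α} [M.Finite] (hE : M.E = ∅) : Nondeg M := by
  have hflag : ∀ s, IsFlag M s → s = ∅ := fun s hs => by
    refine Finset.eq_empty_of_forall_notMem fun S hS => (hs.isProperFlat S hS).2.1.ne_empty ?_
    exact Set.subset_empty_iff.1 (hE ▸ (hs.isProperFlat S hS).1.subset_ground)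
  intro D hD a ha
  have hmem : a ∈ Submodule.span ℚ {(1 : CH M)} := by
    have htop : a ∈ (⊤ : Submodule ℚ (CH M)) := trivial
    rw [← span_xs] at htop
    refine Submodule.span_mono ?_ htop
    rintro _ ⟨s, hs, rfl⟩
    rw [hflag s hs]
    exact Finset.prod_empty
  obtain ⟨c, rfl⟩ := Submodule.mem_span_singleton.1 hmem
  have hone : D 1 = 1 := by
    refine hD.flag ∅ (isFlag_empty M) ?_
    rw [topDeg, hE, rk_empty, Finset.card_empty]
  have hc := ha 1
  rw [mul_one, map_smul, hone, smul_eq_mul, mul_one] at hc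
  rw [hc, zero_smul]

theorem summandNondeg_of_forall_ssubset {M : Matroid α} [M.Finite] [M.Loopless]
    (h : ∀ N : Matroid α, N.Finite → N.Loopless → N.E ⊂ M.E → Nondeg N) (i : α) :
    SummandNondeg M i := by
  intro F hF
  have hE : F ⊂ M.E := hF.2.1.trans_subset Set.sdiff_subset
  have hiE : i ∈ M.E := hF.2.2.2.subset_ground (Set.mem_insert i F)
  refine ⟨h _ inferInstance (loopless_contract hF.2.2.2) ?_,
    h _ (finite_restrict hE.subset) (loopless_restrict hE.subset) hE⟩
  exact Set.sdiff_subset.ssubset_of_ne fun heq => (heq.symm.subset hiE).2 (Set.mem_insert i F)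

theorem nondeg (M : Matroid α) [M.Finite] [M.Loopless] : Nondeg M := by
  induction hn : M.E.ncard using Nat.strong_induction_on generalizing M with
  | _ n ih =>
  subst hn
  have hminor : ∀ N : Matroid α, N.Finite → N.Loopless → N.E ⊂ M.E → Nondeg N :=
    fun N _ _ hlt => ih _ (Set.ncard_lt_ncard hlt M.ground_finite) N rfl
  obtain hE | ⟨i, hi⟩ := M.E.eq_empty_or_nonempty
  · exact nondeg_of_ground_eq_empty hE
  have := finite_Si M i
  have : Fintype (Si M i) := Fintype.ofFinite _
  have hdel : Nondeg (M ＼ {i}) := hminor _ inferInstance (loopless_delete i) <|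
    Set.sdiff_subset.ssubset_of_ne fun h => (h.symm.subset hi).2 rfl
  intro D hD y hy
  obtain ⟨a, b, c, rfl⟩ := exists_decomposition hi y
  obtain ⟨rfl, -, hb, hc⟩ :=
    components_eq_zero hi (summandNondeg_of_forall_ssubset hminor i) hdel hD hy
  simp only [map_zero, hb, hc, Finset.sum_const_zero, add_zero]

theorem summandNondeg (M : Matroid α) [M.Finite] [M.Loopless] (i : α) : SummandNondeg M i :=
  summandNondeg_of_forall_ssubset (fun N _ _ _ => nondeg N) i

/-! ### Direct sums and cyclic modules -/

section Modules

variable {R V ι : Type*} [CommRing R] [AddCommGroup V] [Module R V]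

theorem isDirectSum_of_fintype [Fintype ι] {N : ι → Submodule R V}
    (hind : ∀ v : ι → V, (∀ s, v s ∈ N s) → ∑ s, v s = 0 → ∀ s, v s = 0)
    (hspan : ∀ y, ∃ v : ι → V, (∀ s, v s ∈ N s) ∧ y = ∑ s, v s) : IsDirectSum N := by
  classical
  refine (DirectSum.isInternal_submodule_iff_iSupIndep_and_iSup_eq_top N).2 ⟨?_, ?_⟩
  · rw [iSupIndep_iff_finsetSum_eq_zero_imp_eq_zero]
    intro s v hv h0 j hj
    have hzero := hind (fun j => if j ∈ s then v j else 0) (fun j => ?_) ?_ j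
    · simpa only [hj, if_true] using hzero
    · split_ifs with h
      · exact hv j h
      · exact zero_mem _
    · rwa [Finset.sum_ite_mem, Finset.univ_inter]
  · rw [eq_top_iff]
    intro y _
    obtain ⟨v, hv, rfl⟩ := hspan y
    exact sum_mem fun s _ => Submodule.mem_iSup_of_mem s (hv s)

theorem isDirectSum_comp {κ : Type*} {N : ι → Submodule R V} (hN : IsDirectSum N) {f : κ → ι}
    (hf : Function.Injective f) (hbot : ∀ s ∉ Set.range f, N s = ⊥) : IsDirectSum (N ∘ f) := by
  classical
  obtain ⟨hind, htop⟩ := (DirectSum.isInternal_submodule_iff_iSupIndep_and_iSup_eq_top N).1 hN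
  refine (DirectSum.isInternal_submodule_iff_iSupIndep_and_iSup_eq_top _).2 ⟨hind.comp hf, ?_⟩
  rw [eq_top_iff, ← htop]
  refine iSup_le fun s => ?_
  by_cases hs : s ∈ Set.range f
  · obtain ⟨j, rfl⟩ := hs
    exact le_iSup (N ∘ f) j
  · exact (hbot s hs).le.trans bot_le

theorem isIndecomposable_span_singleton [IsLocalRing R] {g : V} (hg : g ≠ 0) :
    IsIndecomposable (Submodule.span R {g}) := by
  refine ⟨by rwa [Ne, Submodule.span_singleton_eq_bot], fun A B hd hs => ?_⟩
  have of_isUnit : ∀ {A B : Submodule R V}, Disjoint A B → A ⊔ B = Submodule.span R {g} →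
      ∀ {r : R}, IsUnit r → r • g ∈ A → B = ⊥ := by
    intro A B hd hs r hr hrA
    have hgA : g ∈ A := (A.smul_mem_iff_of_isUnit hr).1 hrA
    have hle : B ≤ A := (le_sup_right.trans hs.le).trans
      ((Submodule.span_singleton_le_iff_mem g A).2 hgA)
    exact disjoint_self.1 (hd.mono_left hle)
  obtain ⟨a, ha, b, hb, hab⟩ := Submodule.mem_sup.1 (hs ▸ Submodule.mem_span_singleton_self g)
  obtain ⟨r, rfl⟩ := Submodule.mem_span_singleton.1 (hs ▸ Submodule.mem_sup_left ha)
  obtain hr | hr := IsLocalRing.isUnit_or_isUnit_one_sub_self r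
  · exact Or.inr (of_isUnit hd hs hr ha)
  · have hb' : b = (1 - r) • g := by
      rw [sub_smul, one_smul]
      exact eq_sub_of_add_eq' hab
    exact Or.inl (of_isUnit hd.symm (sup_comm A B ▸ hs) hr (hb' ▸ hb))

end Modules

theorem nontrivial_CH (M : Matroid α) [M.Finite] [M.Loopless] : Nontrivial (CH M) :=
  nontrivial_of_ne _ 0 (xs_ne_zero (isFlag_empty M))

theorem isLocalRing_CH (M : Matroid α) [M.Finite] [M.Loopless] : IsLocalRing (CH M) := by
  have := nontrivial_CH M
  refine IsLocalRing.of_isUnit_or_isUnit_one_sub_self fun a => ?_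
  obtain ⟨c, n, hn, rfl⟩ := exists_scalar_add_nilpotent a
  obtain rfl | hc := eq_or_ne c 0
  · rw [map_zero, zero_add]
    exact Or.inr hn.isUnit_one_sub
  · exact Or.inl (hn.isUnit_add_left_of_commute ((IsUnit.mk0 c hc).map _) (Commute.all _ _))

/-! ### The summands -/

section Graded

variable {M : Matroid α} [M.Finite] {i : α}

theorem xImTheta_eq_span (S : Set α) :
    xImTheta M i S = Submodule.span (CH (M ＼ {i})) {x M S} := by
  ext y
  rw [mem_xImTheta, Submodule.mem_span_singleton]
  exact exists_congr fun a => by rw [smul_eq_theta_mul, mul_comm, eq_comm]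

theorem imTheta_eq_span : imTheta M i = Submodule.span (CH (M ＼ {i})) {1} := by
  ext y
  rw [mem_imTheta, Submodule.mem_span_singleton]
  exact exists_congr fun a => by rw [smul_eq_theta_mul, mul_one, eq_comm]

theorem isGradedSubmodule_span {g : CH M} {s : ℕ} (hg : g ∈ gr M s) :
    IsGradedSubmodule M i (Submodule.span (CH (M ＼ {i})) {g}) := by
  intro y hy
  obtain ⟨a, rfl⟩ := Submodule.mem_span_singleton.1 hy
  obtain ⟨c, hc, rfl⟩ := exists_components a
  obtain ⟨d, hd, hd0, hsum⟩ := exists_shift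
    (LinearMap.toSpanSingleton (CH (M ＼ {i})) (CH M) g).toAddMonoidHom s c
  refine ⟨d, fun m => ?_, hsum.symm⟩
  by_cases hm : ∃ j, j + s = m
  · obtain ⟨j, rfl⟩ := hm
    rw [hd]
    exact ⟨Submodule.smul_mem _ _ (Submodule.mem_span_singleton_self g),
      mul_mem_gr (theta_mem_gr M (hc j)) hg⟩
  · rw [hd0 m fun j hj => hm ⟨j, hj⟩]
    exact ⟨zero_mem _, zero_mem _⟩

theorem isoDelete_span {g : CH M} {s : ℕ} (hg : g ∈ gr M s)
    (hinj : ∀ a, g * theta M i a = 0 → a = 0) :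
    IsoDelete M i s (Submodule.span (CH (M ＼ {i})) {g}) := by
  let f := LinearMap.toSpanSingleton (CH (M ＼ {i})) (CH M) g
  have hf : ∀ a, f a = theta M i a * g := fun _ => rfl
  have hfinj : Function.Injective f := (injective_iff_map_eq_zero f).2 fun a ha =>
    hinj a (by rw [mul_comm, ← hf, ha])
  have hgr : ∀ {k a}, a ∈ gr (M ＼ {i}) k → f a ∈ gr M (k + s) := fun ha =>
    mul_mem_gr (theta_mem_gr M ha) hg
  refine ⟨(LinearEquiv.ofInjective f hfinj).trans
    (LinearEquiv.ofEq _ _ (LinearMap.range_toSpanSingleton g)), fun k a => ?_⟩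
  change a ∈ gr (M ＼ {i}) k ↔ f a ∈ gr M (k + s)
  refine ⟨hgr, fun ha => ?_⟩
  obtain ⟨c, hc, rfl⟩ := exists_components a
  rw [sum_eq_component M (f := f.toAddMonoidHom) hfinj (fun j => hgr (hc j)) ha]
  exact hc k

theorem isGradedSubmodule_summandColoop (s : Option (Option (Si M i))) :
    IsGradedSubmodule M i (summandColoop M i s) := by
  rcases s with _ | _ | F
  · rw [summandColoop, imTheta_eq_span]
    exact isGradedSubmodule_span (one_mem_gr M)
  all_goals
    rw [summandColoop, xImTheta_eq_span]
    exact isGradedSubmodule_span (x_mem_gr M _)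

theorem summandColoop_some_none_eq_bot (hi : i ∈ M.E) (h : ¬ (M.IsColoop i ∧ M.E ≠ {i})) :
    summandColoop M i (some none) = ⊥ := by
  rw [summandColoop, xImTheta_eq_span, x_compl_eq_zero hi h, Submodule.span_singleton_eq_bot]

theorem summandColoop_comp_map_some : summandColoop M i ∘ Option.map some = summand M i := by
  ext1 (_ | _) <;> rfl

end Graded

section Summands

variable {M : Matroid α} [M.Finite] [M.Loopless] {i : α}

theorem isIndecomposable_summandColoop {s : Option (Option (Si M i))}
    (hs : s = some none → M.IsColoop i ∧ M.E ≠ {i}) :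
    IsIndecomposable (summandColoop M i s) := by
  have := loopless_delete (M := M) i
  have := isLocalRing_CH (M ＼ {i})
  have := nontrivial_CH M
  rcases s with _ | _ | F
  · rw [summandColoop, imTheta_eq_span]
    exact isIndecomposable_span_singleton one_ne_zero
  · obtain ⟨hco, hE⟩ := hs rfl
    rw [summandColoop, xImTheta_eq_span]
    exact isIndecomposable_span_singleton (x_ne_zero (isProperFlat_compl hco hE))
  · rw [summandColoop, xImTheta_eq_span]
    exact isIndecomposable_span_singleton (x_ne_zero (Si.isProperFlat_insert F.2))

theorem components_eq_zero_of_sum_eq_zero [Fintype (Si M i)] (hi : i ∈ M.E)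
    {a b : CH (M ＼ {i})} {c : Si M i → CH (M ＼ {i})}
    (h : theta M i a + x M (M.E \ {i}) * theta M i b +
      ∑ F, x M (insert i F.1) * theta M i (c F) = 0) :
    a = 0 ∧ (M.IsColoop i → M.E ≠ {i} → b = 0) ∧ x M (M.E \ {i}) * theta M i b = 0 ∧
      ∀ F, x M (insert i F.1) * theta M i (c F) = 0 := by
  have := loopless_delete (M := M) i
  obtain ⟨D, hD⟩ := exists_isDeg M
  refine components_eq_zero hi (summandNondeg M i) (nondeg _) hD fun z => ?_
  rw [h, zero_mul, map_zero]

theorem isoDelete_imTheta (hi : i ∈ M.E) : IsoDelete M i 0 (imTheta M i) := by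
  have := finite_Si M i
  have : Fintype (Si M i) := Fintype.ofFinite _
  rw [imTheta_eq_span]
  refine isoDelete_span (one_mem_gr M) fun a ha => ?_
  rw [one_mul] at ha
  exact (components_eq_zero_of_sum_eq_zero (b := 0) (c := 0) hi (by simp [ha])).1

theorem isoDelete_xImTheta_compl (hco : M.IsColoop i) (hE : M.E ≠ {i}) :
    IsoDelete M i 1 (xImTheta M i (M.E \ {i})) := by
  have := finite_Si M i
  have : Fintype (Si M i) := Fintype.ofFinite _
  rw [xImTheta_eq_span]
  refine isoDelete_span (x_mem_gr M _) fun a ha => ?_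
  exact (components_eq_zero_of_sum_eq_zero (a := 0) (c := 0) hco.mem_ground
    (by simp [ha])).2.1 hco hE

theorem isDirectSum_summandColoop (hi : i ∈ M.E) : IsDirectSum (summandColoop M i) := by
  have := finite_Si M i
  have : Fintype (Si M i) := Fintype.ofFinite _
  refine isDirectSum_of_fintype (fun v hv hsum => ?_) fun y => ?_
  · obtain ⟨a, ha⟩ := (mem_imTheta M).1 (hv none)
    obtain ⟨b, hb⟩ := (mem_xImTheta M).1 (hv (some none))
    choose c hc using fun F => (mem_xImTheta M).1 (hv (some (some F)))
    rw [Fintype.sum_option, Fintype.sum_option, ha, hb, Finset.sum_congr rfl fun F _ => hc F,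
      ← add_assoc] at hsum
    obtain ⟨rfl, -, hb0, hc0⟩ := components_eq_zero_of_sum_eq_zero hi hsum
    rintro (_ | _ | F)
    · rw [ha, map_zero]
    · rw [hb, hb0]
    · rw [hc, hc0]
  · obtain ⟨a, b, c, rfl⟩ := exists_decomposition hi y
    refine ⟨fun
      | none => theta M i a
      | some none => x M (M.E \ {i}) * theta M i b
      | some (some F) => x M (insert i F.1) * theta M i (c F), ?_, ?_⟩
    · rintro (_ | _ | F)
      · exact (mem_imTheta M).2 ⟨a, rfl⟩
      · exact (mem_xImTheta M).2 ⟨b, rfl⟩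
      · exact (mem_xImTheta M).2 ⟨c F, rfl⟩
    · rw [Fintype.sum_option, Fintype.sum_option, add_assoc]

theorem isDirectSum_summand (hi : i ∈ M.E) (hco : ¬ M.IsColoop i) :
    IsDirectSum (summand M i) := by
  rw [← summandColoop_comp_map_some]
  refine isDirectSum_comp (isDirectSum_summandColoop hi)
    (Option.map_injective (Option.some_injective _)) ?_
  rintro (_ | _ | F) hs
  · exact absurd ⟨none, rfl⟩ hs
  · exact summandColoop_some_none_eq_bot hi fun h => hco h.1
  · exact absurd ⟨some F, rfl⟩ hs

end Summands

/-! ### Orthogonality -/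

section Ortho

variable {M : Matroid α} [M.Finite] {i : α} {D : CH M →ₗ[ℚ] ℚ}

theorem IsOrtho.symm {N₁ N₂ : Submodule (CH (M ＼ {i})) (CH M)} (h : IsOrtho M i D N₁ N₂) :
    IsOrtho M i D N₂ N₁ := fun a ha b hb => by
  rw [mul_comm]
  exact h b hb a ha

theorem isOrtho_xImTheta_compl_xImTheta {F : Set α} (hF : F ∈ Si M i) :
    IsOrtho M i D (xImTheta M i (M.E \ {i})) (xImTheta M i (insert i F)) := by
  intro y hy z hz
  obtain ⟨a, rfl⟩ := (mem_xImTheta M).1 hy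
  obtain ⟨b, rfl⟩ := (mem_xImTheta M).1 hz
  rw [x_compl_mul_theta_mul_summand hF, map_zero]

variable [M.Loopless]

theorem isOrtho_imTheta_xImTheta (hi : i ∈ M.E) (hD : IsDeg M D) {F : Set α} (hF : F ∈ Si M i) :
    IsOrtho M i D (imTheta M i) (xImTheta M i (insert i F)) := by
  intro y hy z hz
  obtain ⟨a, rfl⟩ := (mem_imTheta M).1 hy
  obtain ⟨b, rfl⟩ := (mem_xImTheta M).1 hz
  exact deg_theta_mul_summand hi (summandNondeg M i) hD hF a b

theorem isOrtho_xImTheta_xImTheta (hi : i ∈ M.E) (hD : IsDeg M D) {F G : Set α}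
    (hF : F ∈ Si M i) (hG : G ∈ Si M i) (hFG : F ≠ G) :
    IsOrtho M i D (xImTheta M i (insert i F)) (xImTheta M i (insert i G)) := by
  intro y hy z hz
  obtain ⟨a, rfl⟩ := (mem_xImTheta M).1 hy
  obtain ⟨b, rfl⟩ := (mem_xImTheta M).1 hz
  exact deg_summand_mul_summand hi (summandNondeg M i) hD hF hG hFG a b

theorem isOrtho_summandColoop (hi : i ∈ M.E) (hD : IsDeg M D) {s t : Option (Option (Si M i))}
    (hst : s ≠ t) (h₁ : ¬ (s = none ∧ t = some none)) (h₂ : ¬ (s = some none ∧ t = none)) :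
    IsOrtho M i D (summandColoop M i s) (summandColoop M i t) := by
  rcases s with _ | _ | F <;> rcases t with _ | _ | G
  · exact absurd rfl hst
  · exact absurd ⟨rfl, rfl⟩ h₁
  · exact isOrtho_imTheta_xImTheta hi hD G.2
  · exact absurd ⟨rfl, rfl⟩ h₂
  · exact absurd rfl hst
  · exact isOrtho_xImTheta_compl_xImTheta G.2
  · exact (isOrtho_imTheta_xImTheta hi hD F.2).symm
  · exact (isOrtho_xImTheta_compl_xImTheta F.2).symm
  · exact isOrtho_xImTheta_xImTheta hi hD F.2 G.2
      fun h => hst (congrArg (some ∘ some) (Subtype.ext h))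

theorem not_isOrtho_imTheta_xImTheta_compl (hco : M.IsColoop i) (hE : M.E ≠ {i})
    (hD : IsDeg M D) : ¬ IsOrtho M i D (imTheta M i) (xImTheta M i (M.E \ {i})) := by
  have := loopless_delete (M := M) i
  intro hortho
  obtain ⟨s, -, hs, hc⟩ := (isFlag_empty (M ＼ {i})).exists_complete
  have hone : D (x M (M.E \ {i}) * theta M i (xs _ s)) = 1 :=
    (isDeg_compl_mul_theta hco hE hD).flag s hs hc
  have hzero := hortho 1 ((mem_imTheta M).2 ⟨1, (map_one _).symm⟩) _
    ((mem_xImTheta M).2 ⟨xs _ s, rfl⟩)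
  rw [one_mul, hone] at hzero
  exact one_ne_zero hzero

end Ortho

section Summand

variable {M : Matroid α} [M.Finite] {i : α}

theorem isGradedSubmodule_summand (s : Option (Si M i)) :
    IsGradedSubmodule M i (summand M i s) := by
  rw [← summandColoop_comp_map_some]
  exact isGradedSubmodule_summandColoop _

variable [M.Loopless]

theorem isIndecomposable_summand (s : Option (Si M i)) : IsIndecomposable (summand M i s) := by
  rw [← summandColoop_comp_map_some]
  refine isIndecomposable_summandColoop fun hs => ?_
  cases s <;> cases hs

theorem isOrtho_summand (hi : i ∈ M.E) {D : CH M →ₗ[ℚ] ℚ} (hD : IsDeg M D)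
    {s t : Option (Si M i)} (hst : s ≠ t) : IsOrtho M i D (summand M i s) (summand M i t) := by
  rw [← summandColoop_comp_map_some]
  refine isOrtho_summandColoop hi hD
    ((Option.map_injective (Option.some_injective _)).ne hst) (fun h => ?_) fun h => ?_
  · cases t <;> cases h.2
  · cases s <;> cases h.1

end Summand

end MatroidChow

open MatroidChow in
theorem theorem1p1 {α : Type*} (M : Matroid α) [M.Finite] [M.Loopless] (i : α) (hi : i ∈ M.E) :
    (∃! deg : CH M →ₗ[ℚ] ℚ, IsDegreeMap M deg) ∧
    (¬ M.IsColoop i →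
      IsDirectSum (summand M i) ∧
      (∀ s, IsGradedSubmodule M i (summand M i s) ∧ IsIndecomposable (summand M i s)) ∧
      (∀ deg, IsDegreeMap M deg →
        ∀ s t, s ≠ t → IsOrtho M i deg (summand M i s) (summand M i t))) ∧
    (M.IsColoop i →
      IsDirectSum (summandColoop M i) ∧
      (∀ s, IsGradedSubmodule M i (summandColoop M i s) ∧
        (s ≠ some none ∨ M.E ≠ {i} → IsIndecomposable (summandColoop M i s))) ∧
      (∀ deg, IsDegreeMap M deg →
        (∀ s t, s ≠ t → ¬ (s = none ∧ t = some none) → ¬ (s = some none ∧ t = none) →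
          IsOrtho M i deg (summandColoop M i s) (summandColoop M i t)) ∧
        (M.E ≠ {i} →
          ¬ IsOrtho M i deg (summandColoop M i none) (summandColoop M i (some none)))) ∧
      (M.E = {i} → summandColoop M i (some none) = ⊥) ∧
      (M.E ≠ {i} → IsoDelete M i 1 (xImTheta M i (M.E \ {i})))) ∧
    IsoDelete M i 0 (imTheta M i) ∧
    (∀ F ∈ Si M i, IsoTensor M i F) := by
  have hdeg {deg} : IsDegreeMap M deg → IsDeg M deg := (isDeg_iff_isDegreeMap ⟨i, hi⟩ deg).2
  refine ⟨existsUnique_isDegreeMap ⟨i, hi⟩, fun hco => ?_, fun hco => ?_, isoDelete_imTheta hi,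
    fun F hF => isoTensor hi hF (summandNondeg M i F hF).1 (summandNondeg M i F hF).2⟩
  · exact ⟨isDirectSum_summand hi hco,
      fun s => ⟨isGradedSubmodule_summand s, isIndecomposable_summand s⟩,
      fun deg h s t hst => isOrtho_summand hi (hdeg h) hst⟩
  · refine ⟨isDirectSum_summandColoop hi, fun s => ⟨isGradedSubmodule_summandColoop s, fun hs =>
        isIndecomposable_summandColoop fun hnone => ⟨hco, hs.resolve_left (not_not.2 hnone)⟩⟩,
      fun deg h => ⟨fun s t => isOrtho_summandColoop hi (hdeg h),
        fun hE => not_isOrtho_imTheta_xImTheta_compl hco hE (hdeg h)⟩,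
      fun hE => summandColoop_some_none_eq_bot hi fun h => h.2 hE,
      isoDelete_xImTheta_compl hco⟩
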